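/- **Setting.** Let $\lambda_{LSW}=3\,(1/2)^{2/3}$. Let $\Phi_{LSW}$ be the smooth LSW profile: $\Phi_{LSW}(z)=C\exp\Big(-\int_0^z\frac{2-\frac13\lambda_{LSW}\xi^{-2/3}}{\xi+1-\lambda_{LSW}\xi^{1/3}}\,d\xi\Big)$ for $0\le z<\tfrac12$ and $\Phi_{LSW}(z)=0$ for $z\ge\tfrac12$, where $C$ is such that $\int_0^\infty z\,\Phi_{LSW}\,dz=1$. For $\delta>0$ and $\varepsilon,\tilde\varepsilon\in\mathbb R$ let $\psi(\cdot)=\psi(\cdot\,;\varepsilon,\tilde\varepsilon,\delta)$ be the solution on $[0,\infty)$ of $$-\big(1+z-(\lambda_{LSW}-\delta)z^{1/3}\big)\psi'=\big(2-\tfrac13(\lambda_{LSW}-\delta)z^{-2/3}-\tilde\varepsilon z-\varepsilon\big)\psi,\qquad \int_0^1 z\,\psi(z)\,dz=1 .$$ Put $(\Phi_1*\Phi_2)(z)=\tfrac12\int_0^z\Phi_1(z-y)\Phi_2(y)\,dy$ and $$I[\Phi;\varepsilon,\tilde\varepsilon,\delta](z)=\varepsilon\int_z^\infty\frac{\xi}{\xi+1-(\lambda_{LSW}-\delta)\xi^{1/3}}\,\frac{\psi(z)}{\psi(\xi)}\,(\Phi*\Phi)(\xi)\,d\xi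 .$$ The compatibility conditions for $(\varepsilon,\tilde\varepsilon)$ are $$\varepsilon\int_0^\infty z\,I[\Phi;\varepsilon,\tilde\varepsilon,\delta]\,dz=\varepsilon,\qquad \varepsilon\int_0^\infty I[\Phi;\varepsilon,\tilde\varepsilon,\delta]\,dz=\tilde\varepsilon ;$$ they depend on $\Phi$ only through $\Phi*\Phi$. Fix $\beta_1>0$ and $\beta_2>1$. Let $Z$ be the space of measurable functions $\Phi$ on $[0,\infty)$ with $$\|\Phi\|_Z=\sup_{0\le z\le1}|\Phi(z)|+\sup_{z\ge1}\big|\Phi(z)\,e^{\beta_1z}z^{\beta_2}\big|<\infty .$$ **Theorem.** There exist $r_0,\eta_0>0$ such that for all $0<r\le r_0$ and $0<\eta\le\eta_0$ there is $\delta_0>0$ such that for all $0<\delta<\delta_0$ the following hold. 1. For every $\Phi\in Z$ with $\|\Phi-\Phi_{LSW}\|_Z\le r$ there is exactly one pair $(\varepsilon,\tilde\varepsilon)=(\varepsilon[\Phi*\Phi;\delta],\tilde\varepsilon[\Phi*\Phi;\delta])$ with $0<\varepsilon\le\eta\sqrt\delta$ and $0<\tilde\varepsilon\le\eta\sqrt\delta$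 that satisfies the compatibility conditions. Hence the operator $$\bar I_\delta[\Phi]=I\big[\Phi;\varepsilon[\Phi*\Phi;\delta],\tilde\varepsilon[\Phi*\Phi;\delta],\delta\big]$$ is well defined on this ball. 2. There is a nonnegative $\Phi\in Z$ with $\|\Phi-\Phi_{LSW}\|_Z<r$ and $\Phi=\bar I_\delta[\Phi]$ on $[0,\infty)$. It is the only fixed point of $\bar I_\delta$ in the ball $\{\Psi\in Z:\|\Psi-\Phi_{LSW}\|_Z\le r\}$. In particular it is isolated in $Z$: for some $\rho>0$, every fixed point $\Psi\in Z$ of $\bar I_\delta$ with $\|\Psi-\Phi\|_Z<\rho$ equals $\Phi$. 3. This $\Phi$ is an exponentially decaying stationary solution of the LSW model with encounters, with $\varepsilon=\varepsilon[\Phi*\Phi;\delta]$ and $\lambda=\lambda_{LSW}-\delta$. That is, $\Phi\ge0$; the functions $\Phi$, $z^{1/3}\Phi$ and $z\Phi$ are integrable on $(0,\infty)$; $\Phi$ is differentiable on $(0,\infty)$; for all $z>0$ $$-z\Phi'-2\Phi+\frac{d}{dz}\Big(\big(-1+\lambda z^{1/3}\big)\Phi\Big)=\varepsilon\Big[\tfrac12\int_0^z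 z\,\Phi(z-y)\Phi(y)\,dy-\Phi(z)\int_0^\infty(z+y)\Phi(y)\,dy\Big];$$ moreover $$\int_0^\infty z\,\Phi\,dz=1,\qquad \lambda=\frac{\int_0^\infty\Phi\,dz}{\int_0^\infty z^{1/3}\Phi\,dz};$$ and there is a constant $C$ with $\Phi(z)\le C e^{-\beta_1z}$ for all $z\ge0$. -/

import Mathlib

noncomputable section

open MeasureTheory Set
open scoped ENNReal

namespace LSW

/-- The mean field `λ_LSW = 3 (1/2)^(2/3)` of the smooth LSW solution. -/
def lamLSW : ℝ := 3 * (1 / 2 : ℝ) ^ (2 / 3 : ℝ)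

/-- Unnormalised smooth LSW profile on `[0, ∞)`. At `z = 1/2` the integral in the exponent diverges
to `+∞`, so the value there is `0`. -/
def phiRaw (z : ℝ) : ℝ :=
  if z < 1 / 2 then
    Real.exp (-∫ ξ in (0 : ℝ)..z,
      (2 - lamLSW / 3 * ξ ^ (-2 / 3 : ℝ)) / (ξ + 1 - lamLSW * ξ ^ (1 / 3 : ℝ)))
  else 0

/-- The smooth LSW solution `Φ_LSW`, normalised by `∫ z Φ_LSW dz = 1`. -/
def phiLSW (z : ℝ) : ℝ := phiRaw z / ∫ y in (0 : ℝ)..(1 / 2), y * phiRaw y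

/-- `a_δ(z) = 1 / (1 + z - (λ_LSW - δ) z^(1/3))`. -/
def aCoef (δ z : ℝ) : ℝ := 1 / (1 + z - (lamLSW - δ) * z ^ (1 / 3 : ℝ))

/-- `b_δ(z) = 2 - (1/3) (λ_LSW - δ) z^(-2/3)`. -/
def bCoef (δ z : ℝ) : ℝ := 2 - (lamLSW - δ) / 3 * z ^ (-2 / 3 : ℝ)

/-- The solution of `ψ' = - a_δ (b_δ - ε' z - ε) ψ` on `[0, ∞)` with `ψ 0 = 1`. -/
def psiRaw (δ ε ε' z : ℝ) : ℝ :=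
  Real.exp (-∫ y in (0 : ℝ)..z, aCoef δ y * (bCoef δ y - ε' * y - ε))

/-- The solution `ψ(z; ε, ε', δ)` of the homogeneous problem
`ψ' = - a_δ (b_δ - ε' z - ε) ψ`, normalised by `∫₀¹ z ψ dz = 1`. -/
def psi (δ ε ε' z : ℝ) : ℝ :=
  psiRaw δ ε ε' z / ∫ y in (0 : ℝ)..1, y * psiRaw δ ε ε' y

/-- The denominator of `a_δ` is positive on `[0, ∞)` for `δ > 0`. -/
theorem denom_pos {δ z : ℝ} (hδ : 0 < δ) (hz : 0 ≤ z) :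
    0 < 1 + z - (lamLSW - δ) * z ^ (1 / 3 : ℝ) := by
  have ht : 0 ≤ z ^ (1 / 3 : ℝ) := Real.rpow_nonneg hz _
  have hz3 : (z ^ (1 / 3 : ℝ)) ^ 3 = z := by
    rw [← Real.rpow_natCast, ← Real.rpow_mul hz]; norm_num
  have hs : 0 < (1 / 2 : ℝ) ^ (1 / 3 : ℝ) := by positivity
  have hs3 : ((1 / 2 : ℝ) ^ (1 / 3 : ℝ)) ^ 3 = 1 / 2 := by
    rw [← Real.rpow_natCast, ← Real.rpow_mul (by norm_num)]; norm_num
  have hs2 : lamLSW = 3 * ((1 / 2 : ℝ) ^ (1 / 3 : ℝ)) ^ 2 := by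
    unfold lamLSW
    rw [← Real.rpow_natCast, ← Real.rpow_mul (by norm_num)]; norm_num
  rw [hs2]
  generalize z ^ (1 / 3 : ℝ) = t at *
  generalize (1 / 2 : ℝ) ^ (1 / 3 : ℝ) = s at *
  have key : 1 + z - (3 * s ^ 2 - δ) * t = (t - s) ^ 2 * (t + 2 * s) + δ * t := by
    rw [← hz3]; linear_combination (-2) * hs3
  rw [key]
  rcases ht.eq_or_lt with h | h
  · rw [← h]; nlinarith [pow_pos hs 3]
  · positivity

/-- For `δ > 0` the function `ψ` satisfies `ψ' = - a_δ (b_δ - ε' z - ε) ψ` at every `z > 0`. -/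
theorem hasDerivAt_psi {δ : ℝ} (hδ : 0 < δ) (ε ε' : ℝ) {z : ℝ} (hz : 0 < z) :
    HasDerivAt (psi δ ε ε')
      (-(aCoef δ z * (bCoef δ z - ε' * z - ε)) * psi δ ε ε' z) z := by
  have ha : ContinuousOn (aCoef δ) (Ici 0) := by
    refine ContinuousOn.div continuousOn_const ?_ fun y hy => (denom_pos hδ hy).ne'
    exact (((continuous_const.add continuous_id).sub (continuous_const.mul
      (Real.continuous_rpow_const (by norm_num)))).continuousOn)
  have hb : IntervalIntegrable (fun y => bCoef δ y - ε' * y - ε) volume 0 z := by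
    unfold bCoef
    refine ((IntervalIntegrable.sub ?_ ?_).sub ?_).sub ?_
    · exact intervalIntegrable_const
    · exact (intervalIntegral.intervalIntegrable_rpow' (by norm_num)).const_mul _
    · exact (continuous_const.mul continuous_id).intervalIntegrable _ _
    · exact intervalIntegrable_const
  have hint : IntervalIntegrable
      (fun y => aCoef δ y * (bCoef δ y - ε' * y - ε)) volume 0 z := by
    refine hb.continuousOn_mul (ha.mono ?_)
    rw [uIcc_of_le hz.le]
    exact Icc_subset_Ici_self
  have hcont : ContinuousOn (fun y => aCoef δ y * (bCoef δ y - ε' * y - ε)) (Ioi 0) := by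
    refine (ha.mono Ioi_subset_Ici_self).mul ?_
    unfold bCoef
    have hr : ContinuousOn (fun y : ℝ => y ^ (-2 / 3 : ℝ)) (Ioi 0) := fun y hy =>
      (Real.continuousAt_rpow_const _ _ (Or.inl (ne_of_gt hy))).continuousWithinAt
    fun_prop
  have hd := intervalIntegral.integral_hasDerivAt_right hint
    (hcont.stronglyMeasurableAtFilter isOpen_Ioi z hz)
    (hcont.continuousAt (Ioi_mem_nhds hz))
  have h2 := (hd.neg.exp).div_const (∫ y in (0 : ℝ)..1, y * psiRaw δ ε ε' y)
  refine h2.congr_deriv ?_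
  simp only [psi, psiRaw, Pi.neg_apply]
  ring

/-- The convolution `(Φ₁ * Φ₂)(z) = (1/2) ∫₀^z Φ₁(z - y) Φ₂(y) dy`. -/
def conv (Φ₁ Φ₂ : ℝ → ℝ) (z : ℝ) : ℝ := 1 / 2 * ∫ y in (0 : ℝ)..z, Φ₁ (z - y) * Φ₂ y

/-- `ε ∫_z^∞ ξ / (ξ + 1 - (λ_LSW - δ) ξ^(1/3)) * (ψ(z) / ψ(ξ)) * h(ξ) dξ`. -/
def varConst (δ ε ε' : ℝ) (h : ℝ → ℝ) (z : ℝ) : ℝ :=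
  ε * ∫ ξ in Ioi z, ξ * aCoef δ ξ * (psi δ ε ε' z / psi δ ε ε' ξ) * h ξ

/-- The integral operator `I[Φ; ε, ε', δ]`. -/
def opI (δ ε ε' : ℝ) (Φ : ℝ → ℝ) : ℝ → ℝ := varConst δ ε ε' (conv Φ Φ)

/-- The compatibility conditions `ε ∫ z I dz = ε`, `ε ∫ I dz = ε'`, where
`I = I[Φ; ε, ε', δ]` depends on `Φ` only through `h = Φ * Φ`. -/
def Compatible (δ : ℝ) (h : ℝ → ℝ) (ε ε' : ℝ) : Prop :=
  ε * ∫ z in Ioi (0 : ℝ), z * varConst δ ε ε' h z = ε ∧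
    ε * ∫ z in Ioi (0 : ℝ), varConst δ ε ε' h z = ε'

/-- `p = (ε, ε')` is a positive solution of the compatibility conditions in the smallness regime
`ε, ε' ≤ η √δ`. (Positivity excludes the trivial solution `(0, 0)`.) -/
def IsCoupling (η δ : ℝ) (h : ℝ → ℝ) (p : ℝ × ℝ) : Prop :=
  (0 < p.1 ∧ p.1 ≤ η * √δ) ∧ (0 < p.2 ∧ p.2 ≤ η * √δ) ∧ Compatible δ h p.1 p.2

/-- The pair `(ε[h; δ], ε'[h; δ])`: the coupling in the smallness regime (an arbitrary value if there
is none). -/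
def coupling (η δ : ℝ) (h : ℝ → ℝ) : ℝ × ℝ := Classical.epsilon (IsCoupling η δ h)

/-- The full operator `Ī_δ[Φ] = I[Φ; ε[Φ * Φ; δ], ε'[Φ * Φ; δ], δ]`. -/
def opIbar (η δ : ℝ) (Φ : ℝ → ℝ) : ℝ → ℝ :=
  opI δ (coupling η δ (conv Φ Φ)).1 (coupling η δ (conv Φ Φ)).2 Φ

/-- `sup_{0 ≤ z ≤ 1} |Φ(z)| + sup_{z ≥ 1} |Φ(z) exp(β₁ z) z^β₂|`, with values in `[0, ∞]`. Functions
on `[0, ∞)` are represented by functions on `ℝ` whose values at negative arguments play no role. -/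
def normZ (β₁ β₂ : ℝ) (Φ : ℝ → ℝ) : ℝ≥0∞ :=
  (⨆ z ∈ Icc (0 : ℝ) 1, ENNReal.ofReal |Φ z|) +
    ⨆ z ∈ Ici (1 : ℝ), ENNReal.ofReal |Φ z * Real.exp (β₁ * z) * z ^ β₂|

/-- The space `Z` of (measurable) functions on `[0, ∞)` with finite weighted norm. -/
def spaceZ (β₁ β₂ : ℝ) : Set (ℝ → ℝ) :=
  {Φ | AEStronglyMeasurable Φ (volume.restrict (Ici 0)) ∧ normZ β₁ β₂ Φ < ∞}

/-- The coagulation operator with additive kernel. -/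
def coag (Φ : ℝ → ℝ) (z : ℝ) : ℝ :=
  1 / 2 * (∫ y in (0 : ℝ)..z, z * Φ (z - y) * Φ y) - Φ z * ∫ y in Ioi (0 : ℝ), (z + y) * Φ y

/-- `Φ` is a (nonnegative, normalised) stationary solution of the LSW model with encounters, with
coupling constant `ε` and mean field `lam`. -/
structure IsStationarySolution (ε lam : ℝ) (Φ : ℝ → ℝ) : Prop where
  nonneg : ∀ z, 0 ≤ z → 0 ≤ Φ z
  integrable_zero : IntegrableOn Φ (Ioi 0)
  integrable_third : IntegrableOn (fun z => z ^ (1 / 3 : ℝ) * Φ z) (Ioi 0)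
  integrable_one : IntegrableOn (fun z => z * Φ z) (Ioi 0)
  volume_eq : ∫ z in Ioi (0 : ℝ), z * Φ z = 1
  meanField : lam = (∫ z in Ioi (0 : ℝ), Φ z) / ∫ z in Ioi (0 : ℝ), z ^ (1 / 3 : ℝ) * Φ z
  differentiable : ∀ z, 0 < z → DifferentiableAt ℝ Φ z
  equation : ∀ z, 0 < z →
    -z * deriv Φ z - 2 * Φ z + deriv (fun y => (-1 + lam * y ^ (1 / 3 : ℝ)) * Φ y) z
      = ε * coag Φ z

end LSW

end

open MeasureTheory Set Filter Topology
open scoped ENNReal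

noncomputable section

namespace LSW

/-! Put t = z^(1/3) and s = 2^(-1/3). Then `den δ z` = (t - s)^2 (t + 2s) + δ t: at δ = 0 it has a
double zero at z = 1/2, and for δ > 0 it is comparable to (z - 1/2)^2 + δ on [0, 1]. Since `bCoef`
is 2 `den`' plus (λ_LSW - δ)/3 z^(-2/3), the homogeneous solution is `den`^(-2) exp(-`Q`) exp(`P`)
(`psiRaw_eq`). Here `Q` climbs by at least a multiple of 1/√δ on each side of 1/2 (`Q_sub_ge`),
while the coupling part `P` stays bounded on [0, 1] as long as both couplings are at most √δ
(`P_le`).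

Hence the kernel `ker δ p z ξ` reaches its full size `kerSize δ`, which exceeds every power of 1/δ,
only when z < 1/2 < ξ; with both points on one side it loses every power of δ
(`exists_kerMaj_le_pow`). The crossing part has rank one: it equals `psiRaw` at z times a number
`gInt` depending on the source. So the integral is `gInt * lead + rInt` with a relatively negligible
remainder (`jInt_eq_add`, `exists_uFun_bound`). After division by its amplitude, the solution
depends on the source Φ * Φ only through terms smaller than any power of δ, apart from the
dependence through the couplings.

With U, V the first and zeroth moments of the normalised solution and g = `gInt`, the compatibility
conditions for ε > 0 read ε = 1/(U g), ε' = V/(U^2 g). As g is of order at least `kerSize δ`, this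
fixed point problem has a tiny Lipschitz constant in (ε, ε') and in the source; its solution is
smaller than any power of δ (`exists_fMap_bound`, `exists_coupling`). The amplitude is bounded below
near the LSW profile because Φ_LSW * Φ_LSW is positive beyond z = 1/2, although Φ_LSW vanishes
there.

Thus `opIbar` is a contraction, and its values are close to `psiRaw` on [0, 1/2) divided by its
volume, hence to Φ_LSW (`exists_tFun_sub_phiLSW_le`). Iteration gives the unique nonnegative fixed
point. The compatibility conditions turn it into a solution with unit volume and ε' = ε ∫ Φ; the
mean field relation follows by integrating the derivative of z `den` Φ
(`isStationarySolution_of_fixed`). -/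

/-- The weight `exp (-β₁ z) (1 + z)^(-β₂)`. -/
def wt (β₁ β₂ z : ℝ) : ℝ := Real.exp (-β₁ * z) * (1 + z) ^ (-β₂)

/-- Measurable functions on `[0, ∞)` dominated by `K` times the weight. -/
structure MemW (β₁ β₂ K : ℝ) (f : ℝ → ℝ) : Prop where
  meas : AEStronglyMeasurable f (volume.restrict (Ioi 0))
  bound : ∀ z, 0 ≤ z → |f z| ≤ K * wt β₁ β₂ z

/-! ### Elementary properties of the weight, tails and moments. -/

theorem wt_pos (β₁ β₂ : ℝ) {z : ℝ} (hz : 0 ≤ z) : 0 < wt β₁ β₂ z := by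
  unfold wt
  have : 0 < 1 + z := by linarith
  positivity

theorem one_add_rpow_neg_le_one {β₂ z : ℝ} (hβ₂ : 0 ≤ β₂) (hz : 0 ≤ z) :
    (1 + z) ^ (-β₂) ≤ 1 :=
  Real.rpow_le_one_of_one_le_of_nonpos (by linarith) (by linarith)

theorem wt_le_exp {β₁ β₂ z : ℝ} (hβ₂ : 0 ≤ β₂) (hz : 0 ≤ z) :
    wt β₁ β₂ z ≤ Real.exp (-β₁ * z) := by
  unfold wt
  exact mul_le_of_le_one_right (Real.exp_pos _).le (one_add_rpow_neg_le_one hβ₂ hz)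

theorem wt_le_one {β₁ β₂ z : ℝ} (hβ₁ : 0 ≤ β₁) (hβ₂ : 0 ≤ β₂) (hz : 0 ≤ z) :
    wt β₁ β₂ z ≤ 1 :=
  (wt_le_exp hβ₂ hz).trans (Real.exp_le_one_iff.2 (by nlinarith))

theorem wt_le_mul {β₁ β₂ z ξ : ℝ} (hβ₂ : 0 ≤ β₂) (hz : 0 ≤ z) (hzξ : z ≤ ξ) :
    wt β₁ β₂ ξ ≤ Real.exp (-β₁ * (ξ - z)) * wt β₁ β₂ z := by
  unfold wt
  rw [← mul_assoc, ← Real.exp_add]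
  have h1 : -β₁ * (ξ - z) + -β₁ * z = -β₁ * ξ := by ring
  rw [h1]
  gcongr ?_ * ?_
  exact Real.rpow_le_rpow_of_nonpos (by linarith) (by linarith) (by linarith)

theorem wt_anti {β₁ β₂ z ξ : ℝ} (hβ₁ : 0 ≤ β₁) (hβ₂ : 0 ≤ β₂) (hz : 0 ≤ z) (hzξ : z ≤ ξ) :
    wt β₁ β₂ ξ ≤ wt β₁ β₂ z := by
  refine (wt_le_mul hβ₂ hz hzξ).trans (mul_le_of_le_one_left (wt_pos _ _ hz).le ?_)
  exact Real.exp_le_one_iff.2 (by nlinarith)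

theorem continuousOn_wt (β₁ β₂ : ℝ) : ContinuousOn (wt β₁ β₂) (Ici 0) := by
  unfold wt
  refine ContinuousOn.mul (by fun_prop) ?_
  refine ContinuousOn.rpow_const (by fun_prop) fun x hx => Or.inl ?_
  have : (0 : ℝ) ≤ x := hx
  linarith

/-- Polynomials are dominated by exponentials. -/
theorem exists_pow_le_exp {β : ℝ} (hβ : 0 < β) (n : ℕ) :
    ∃ C : ℝ, 0 < C ∧ ∀ u : ℝ, 0 ≤ u → (1 + u) ^ n ≤ C * Real.exp (β * u) := by
  refine ⟨n.factorial / β ^ n * Real.exp β, by positivity, fun u hu => ?_⟩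
  have h := Real.pow_div_factorial_le_exp (β * (1 + u)) (by positivity) n
  rw [div_le_iff₀ (by positivity), mul_pow] at h
  have h2 : Real.exp (β * (1 + u)) = Real.exp β * Real.exp (β * u) := by
    rw [← Real.exp_add]; ring_nf
  rw [h2] at h
  have : (1 + u) ^ n = (β ^ n * (1 + u) ^ n) / β ^ n := by field_simp
  rw [this, div_mul_eq_mul_div, div_mul_eq_mul_div, div_le_div_iff_of_pos_right (by positivity)]
  linarith

/-- Integrals over tails against the weight, with a polynomial loss. -/
theorem exists_tail_bound {β₁ β₂ : ℝ} (hβ₁ : 0 < β₁) (hβ₂ : 0 ≤ β₂) (n : ℕ) :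
    ∃ C : ℝ, 0 < C ∧ ∀ (z B : ℝ) (f : ℝ → ℝ), 0 ≤ z → 0 ≤ B →
      AEStronglyMeasurable f (volume.restrict (Ioi z)) →
      (∀ ξ, z < ξ → |f ξ| ≤ B * (1 + (ξ - z)) ^ n * wt β₁ β₂ ξ) →
      IntegrableOn f (Ioi z) ∧ |∫ ξ in Ioi z, f ξ| ≤ C * B * wt β₁ β₂ z := by
  -- Half of the exponential decay absorbs the polynomial; the other half is integrated.
  obtain ⟨C, hC, hpow⟩ := exists_pow_le_exp (half_pos hβ₁) n
  refine ⟨C * (2 / β₁), by positivity, fun z B f hz hB hf hb => ?_⟩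
  have hneg : -(β₁ / 2) < 0 := by linarith
  set g : ℝ → ℝ := fun ξ =>
    (B * C * wt β₁ β₂ z * Real.exp (β₁ / 2 * z)) * Real.exp (-(β₁ / 2) * ξ) with hg
  have hgi : IntegrableOn g (Ioi z) := (integrableOn_exp_mul_Ioi hneg z).const_mul _
  have hle : ∀ ξ ∈ Ioi z, ‖f ξ‖ ≤ g ξ := by
    intro ξ hξ
    have hξ' : z < ξ := hξ
    have h1 := hpow (ξ - z) (by linarith)
    have h2 := wt_le_mul (β₁ := β₁) hβ₂ hz hξ'.le
    have h3 : g ξ = B * (C * Real.exp (β₁ / 2 * (ξ - z))) *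
        (Real.exp (-β₁ * (ξ - z)) * wt β₁ β₂ z) := by
      have e1 : Real.exp (β₁ / 2 * (ξ - z)) * Real.exp (-β₁ * (ξ - z))
          = Real.exp (β₁ / 2 * z) * Real.exp (-(β₁ / 2) * ξ) := by
        rw [← Real.exp_add, ← Real.exp_add]; ring_nf
      simp only [hg]
      linear_combination (-(B * C * wt β₁ β₂ z)) * e1
    rw [h3, Real.norm_eq_abs]
    refine (hb ξ hξ').trans ?_
    have := (wt_pos β₁ β₂ (hz.trans hξ'.le)).le
    gcongr
  have hint : IntegrableOn f (Ioi z) :=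
    Integrable.mono' hgi hf ((ae_restrict_iff' measurableSet_Ioi).2 (Eventually.of_forall hle))
  refine ⟨hint, ?_⟩
  have h4 := norm_integral_le_of_norm_le hgi
    ((ae_restrict_iff' measurableSet_Ioi).2 (Eventually.of_forall hle))
  rw [Real.norm_eq_abs] at h4
  refine h4.trans (le_of_eq ?_)
  simp only [hg]
  rw [integral_const_mul, integral_exp_mul_Ioi hneg]
  have e2 : Real.exp (β₁ / 2 * z) * Real.exp (-(β₁ / 2) * z) = 1 := by
    rw [← Real.exp_add]; simp
  generalize Real.exp (β₁ / 2 * z) = a at *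
  generalize Real.exp (-(β₁ / 2) * z) = b at *
  field_simp
  linear_combination (B * wt β₁ β₂ z) * e2

theorem MemW.aestronglyMeasurable_Ioi {β₁ β₂ K : ℝ} {f : ℝ → ℝ} (hf : MemW β₁ β₂ K f) {z : ℝ}
    (hz : 0 ≤ z) : AEStronglyMeasurable f (volume.restrict (Ioi z)) :=
  hf.meas.mono_measure (Measure.restrict_mono (Ioi_subset_Ioi hz) le_rfl)

theorem MemW.nonneg {β₁ β₂ K : ℝ} {f : ℝ → ℝ} (hf : MemW β₁ β₂ K f) : 0 ≤ K := by
  have h := (abs_nonneg _).trans (hf.bound 0 le_rfl)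
  exact nonneg_of_mul_nonneg_left h (wt_pos β₁ β₂ le_rfl)

theorem MemW.mono {β₁ β₂ K K' : ℝ} {f : ℝ → ℝ} (hf : MemW β₁ β₂ K f) (h : K ≤ K') :
    MemW β₁ β₂ K' f :=
  ⟨hf.meas, fun z hz => (hf.bound z hz).trans
    (mul_le_mul_of_nonneg_right h (wt_pos _ _ hz).le)⟩

theorem MemW.add {β₁ β₂ K K' : ℝ} {f g : ℝ → ℝ} (hf : MemW β₁ β₂ K f) (hg : MemW β₁ β₂ K' g) :
    MemW β₁ β₂ (K + K') (f + g) :=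
  ⟨hf.meas.add hg.meas, fun z hz => by
    rw [add_mul]; exact (abs_add_le _ _).trans (add_le_add (hf.bound z hz) (hg.bound z hz))⟩

theorem MemW.sub {β₁ β₂ K K' : ℝ} {f g : ℝ → ℝ} (hf : MemW β₁ β₂ K f) (hg : MemW β₁ β₂ K' g) :
    MemW β₁ β₂ (K + K') (f - g) :=
  ⟨hf.meas.sub hg.meas, fun z hz => by
    rw [add_mul]; exact (abs_sub _ _).trans (add_le_add (hf.bound z hz) (hg.bound z hz))⟩

/-- Moments of weighted functions. -/
theorem exists_moment_bound {β₁ β₂ : ℝ} (hβ₁ : 0 < β₁) (hβ₂ : 0 ≤ β₂) :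
    ∃ C : ℝ, 0 < C ∧ ∀ (K : ℝ) (f m : ℝ → ℝ), MemW β₁ β₂ K f →
      AEStronglyMeasurable m (volume.restrict (Ioi 0)) → (∀ z, 0 < z → |m z| ≤ (1 + z) ^ 2) →
      IntegrableOn (fun z => m z * f z) (Ioi 0) ∧ |∫ z in Ioi (0 : ℝ), m z * f z| ≤ C * K := by
  obtain ⟨C, hC, h⟩ := exists_tail_bound hβ₁ hβ₂ 2
  refine ⟨C, hC, fun K f m hf hm hb => ?_⟩
  obtain ⟨h1, h2⟩ := h 0 K (fun z => m z * f z) le_rfl hf.nonneg (hm.mul hf.meas) (fun ξ hξ => by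
    rw [abs_mul, sub_zero]
    have h3 := hb ξ hξ
    have h4 := hf.bound ξ hξ.le
    calc |m ξ| * |f ξ| ≤ (1 + ξ) ^ 2 * (K * wt β₁ β₂ ξ) := by gcongr
      _ = _ := by ring)
  refine ⟨h1, h2.trans ?_⟩
  have := wt_le_one hβ₁.le hβ₂ (le_refl (0 : ℝ))
  have := hf.nonneg
  exact mul_le_of_le_one_right (by positivity) (by assumption)

theorem MemW.integrableOn {β₁ β₂ K : ℝ} {f : ℝ → ℝ} (hβ₁ : 0 < β₁) (hβ₂ : 0 ≤ β₂)
    (hf : MemW β₁ β₂ K f) : IntegrableOn f (Ioi 0) := by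
  obtain ⟨C, -, h⟩ := exists_moment_bound hβ₁ hβ₂
  simpa using (h K f (fun _ => 1) hf aestronglyMeasurable_const
    (fun z hz => by rw [abs_one]; nlinarith)).1

/-! ### Convolution in the weighted space. -/

/-- One of y and z - y is at least z/2, so its factor is at most 2^β₂ (1 + z)^(-β₂); the other
factor is kept for integration. -/
theorem rpow_neg_mul_le {β₂ z y : ℝ} (hβ₂ : 0 ≤ β₂) (hy : 0 ≤ y) (hyz : y ≤ z) :
    (1 + (z - y)) ^ (-β₂) * (1 + y) ^ (-β₂)
      ≤ 2 ^ β₂ * (1 + z) ^ (-β₂) * ((1 + (z - y)) ^ (-β₂) + (1 + y) ^ (-β₂)) := by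
  have hz : 0 ≤ z := hy.trans hyz
  have key : ∀ x, 0 ≤ x → (1 + z) / 2 ≤ 1 + x →
      (1 + x) ^ (-β₂) ≤ 2 ^ β₂ * (1 + z) ^ (-β₂) := by
    intro x hx h
    calc (1 + x) ^ (-β₂) ≤ ((1 + z) / 2) ^ (-β₂) :=
          Real.rpow_le_rpow_of_nonpos (by linarith) h (by linarith)
      _ = 2 ^ β₂ * (1 + z) ^ (-β₂) := by
          rw [Real.div_rpow (by linarith) (by norm_num), Real.rpow_neg (by norm_num : (0:ℝ) ≤ 2)]
          field_simp
  have p1 : 0 < (1 + (z - y)) ^ (-β₂) := Real.rpow_pos_of_pos (by linarith) _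
  have p2 : 0 < (1 + y) ^ (-β₂) := Real.rpow_pos_of_pos (by linarith) _
  have p3 : 0 < 2 ^ β₂ * (1 + z) ^ (-β₂) := by
    have : 0 < 1 + z := by linarith
    positivity
  rcases le_total (z / 2) y with h | h
  · have := key y hy (by linarith)
    nlinarith [mul_le_mul_of_nonneg_left this p1.le, mul_pos p3 p2]
  · have := key (z - y) (by linarith) (by linarith)
    nlinarith [mul_le_mul_of_nonneg_right this p2.le, mul_pos p3 p1]

/-- This is where β₂ > 1 enters: the polynomial part of the weight is integrable, with a bound
uniform in z. -/
theorem integral_one_add_rpow_le {β₂ z : ℝ} (hβ₂ : 1 < β₂) (hz : 0 ≤ z) :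
    ∫ y in (0 : ℝ)..z, (1 + y) ^ (-β₂) ≤ 1 / (β₂ - 1) := by
  have h : ∫ y in (0 : ℝ)..z, (1 + y) ^ (-β₂) = ∫ y in (1 + 0 : ℝ)..(1 + z), y ^ (-β₂) :=
    intervalIntegral.integral_comp_add_left (fun y => y ^ (-β₂)) 1
  rw [h, integral_rpow (Or.inr ⟨by linarith, by
    rw [uIcc_of_le (by linarith)]; intro hm; linarith [hm.1]⟩)]
  have h1 : 0 ≤ (1 + z) ^ (-β₂ + 1) := Real.rpow_nonneg (by linarith) _
  rw [add_zero, Real.one_rpow, show -β₂ + 1 = -(β₂ - 1) by ring, div_neg, ← neg_div]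
  rw [show -β₂ + 1 = -(β₂ - 1) by ring] at h1
  have : 0 < β₂ - 1 := by linarith
  gcongr
  linarith

theorem continuousOn_one_add_rpow (β₂ : ℝ) {z : ℝ} :
    ContinuousOn (fun y : ℝ => (1 + y) ^ (-β₂)) (Icc 0 z) :=
  ContinuousOn.rpow_const (by fun_prop) fun x hx => Or.inl (by linarith [hx.1])

theorem continuousOn_one_add_sub_rpow (β₂ : ℝ) {z : ℝ} :
    ContinuousOn (fun y : ℝ => (1 + (z - y)) ^ (-β₂)) (Icc 0 z) :=
  ContinuousOn.rpow_const (by fun_prop) fun x hx => Or.inl (by linarith [hx.2])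

/-- The weight is an algebra weight for the convolution on the half line. -/
theorem exists_integral_wt_mul_wt_le {β₁ β₂ : ℝ} (hβ₂ : 1 < β₂) :
    ∃ C : ℝ, 0 < C ∧ ∀ z : ℝ, 0 ≤ z →
      IntervalIntegrable (fun y => wt β₁ β₂ (z - y) * wt β₁ β₂ y) volume 0 z ∧
      ∫ y in (0 : ℝ)..z, wt β₁ β₂ (z - y) * wt β₁ β₂ y ≤ C * wt β₁ β₂ z := by
  have h0 : 0 < β₂ - 1 := by linarith
  refine ⟨2 ^ β₂ * (2 / (β₂ - 1)), by positivity, fun z hz => ?_⟩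
  have hc1 := continuousOn_one_add_rpow β₂ (z := z)
  have hc2 := continuousOn_one_add_sub_rpow β₂ (z := z)
  rw [← uIcc_of_le hz] at hc1 hc2
  have heq : ∀ y, wt β₁ β₂ (z - y) * wt β₁ β₂ y
      = Real.exp (-β₁ * z) * ((1 + (z - y)) ^ (-β₂) * (1 + y) ^ (-β₂)) := by
    intro y
    unfold wt
    have : Real.exp (-β₁ * z) = Real.exp (-β₁ * (z - y)) * Real.exp (-β₁ * y) := by
      rw [← Real.exp_add]; ring_nf
    rw [this]; ring
  simp only [heq]
  refine ⟨((hc2.mul hc1).intervalIntegrable).const_mul _, ?_⟩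
  rw [intervalIntegral.integral_const_mul]
  have h1 : ∫ y in (0 : ℝ)..z, (1 + (z - y)) ^ (-β₂) * (1 + y) ^ (-β₂)
      ≤ ∫ y in (0 : ℝ)..z, 2 ^ β₂ * (1 + z) ^ (-β₂) *
          ((1 + (z - y)) ^ (-β₂) + (1 + y) ^ (-β₂)) := by
    refine intervalIntegral.integral_mono_on hz (hc2.mul hc1).intervalIntegrable
      ((hc2.add hc1).intervalIntegrable.const_mul _) fun y hy => ?_
    exact rpow_neg_mul_le (by linarith) hy.1 hy.2
  rw [intervalIntegral.integral_const_mul, intervalIntegral.integral_add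
    hc2.intervalIntegrable hc1.intervalIntegrable,
    intervalIntegral.integral_comp_sub_left (fun y => (1 + y) ^ (-β₂)) z, sub_self, sub_zero] at h1
  have h2 := integral_one_add_rpow_le hβ₂ hz
  have h3 : 0 < (1 + z) ^ (-β₂) := Real.rpow_pos_of_pos (by linarith) _
  unfold wt
  calc _ ≤ Real.exp (-β₁ * z) * (2 ^ β₂ * (1 + z) ^ (-β₂) * (1 / (β₂ - 1) + 1 / (β₂ - 1))) := by
        gcongr
        exact h1.trans (by gcongr)
    _ = _ := by ring

theorem exists_integral_mul_le {β₁ β₂ : ℝ} (hβ₂ : 1 < β₂) :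
    ∃ C : ℝ, 0 < C ∧ ∀ (z B : ℝ) (F : ℝ → ℝ), 0 ≤ z → 0 ≤ B →
      (∀ y, 0 ≤ y → y ≤ z → |F y| ≤ B * (wt β₁ β₂ (z - y) * wt β₁ β₂ y)) →
      |1 / 2 * ∫ y in (0 : ℝ)..z, F y| ≤ C * B * wt β₁ β₂ z := by
  obtain ⟨C, hC, h⟩ := exists_integral_wt_mul_wt_le (β₁ := β₁) hβ₂
  refine ⟨C, hC, fun z B F hz hB hF => ?_⟩
  obtain ⟨hi, hle⟩ := h z hz
  have h1 := intervalIntegral.norm_integral_le_of_norm_le hz (f := F)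
    (Eventually.of_forall fun y hy => by
      rw [Real.norm_eq_abs]; exact hF y hy.1.le hy.2) (hi.const_mul B)
  rw [intervalIntegral.integral_const_mul, Real.norm_eq_abs] at h1
  rw [abs_mul, abs_of_pos (by norm_num : (0:ℝ) < 1 / 2)]
  have h2 : B * ∫ y in (0 : ℝ)..z, wt β₁ β₂ (z - y) * wt β₁ β₂ y ≤ B * (C * wt β₁ β₂ z) := by
    gcongr
  have h3 := (abs_nonneg _).trans h1
  linarith

theorem MemW.convIntegrand_meas {β₁ β₂ K₁ K₂ : ℝ} {f g : ℝ → ℝ} (hf : MemW β₁ β₂ K₁ f)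
    (hg : MemW β₁ β₂ K₂ g) (z : ℝ) :
    AEStronglyMeasurable (fun y => f (z - y) * g y) (volume.restrict (Ioo 0 z)) := by
  have hg' : AEStronglyMeasurable g (volume.restrict (Ioo 0 z)) :=
    hg.meas.mono_measure (Measure.restrict_mono Ioo_subset_Ioi_self le_rfl)
  refine AEStronglyMeasurable.mul ?_ hg'
  have hmp : MeasurePreserving (fun y : ℝ => z - y) (volume.restrict (Ioo 0 z))
      (volume.restrict (Ioo 0 z)) := by
    have h := (Measure.measurePreserving_sub_left volume z).restrict_preimage
      (measurableSet_Ioo (a := (0:ℝ)) (b := z))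
    have : (fun y : ℝ => z - y) ⁻¹' Ioo 0 z = Ioo 0 z := by ext y; simp [and_comm]
    rwa [this] at h
  have hf' : AEStronglyMeasurable f (volume.restrict (Ioo 0 z)) :=
    hf.meas.mono_measure (Measure.restrict_mono Ioo_subset_Ioi_self le_rfl)
  exact hf'.comp_measurePreserving hmp

theorem MemW.convIntegrand_le {β₁ β₂ K₁ K₂ : ℝ} {f g : ℝ → ℝ} (hf : MemW β₁ β₂ K₁ f)
    (hg : MemW β₁ β₂ K₂ g) {z y : ℝ} (hy : 0 ≤ y) (hyz : y ≤ z) :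
    |f (z - y) * g y| ≤ K₁ * K₂ * (wt β₁ β₂ (z - y) * wt β₁ β₂ y) := by
  rw [abs_mul]
  have h1 := hf.bound (z - y) (by linarith)
  have h2 := hg.bound y hy
  calc |f (z - y)| * |g y| ≤ (K₁ * wt β₁ β₂ (z - y)) * (K₂ * wt β₁ β₂ y) :=
        mul_le_mul h1 h2 (abs_nonneg _) ((abs_nonneg _).trans h1)
    _ = _ := by ring

theorem MemW.convIntegrand_integrable {β₁ β₂ K₁ K₂ : ℝ} {f g : ℝ → ℝ} (hβ₂ : 1 < β₂)
    (hf : MemW β₁ β₂ K₁ f) (hg : MemW β₁ β₂ K₂ g) {z : ℝ} (hz : 0 ≤ z) :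
    IntervalIntegrable (fun y => f (z - y) * g y) volume 0 z := by
  obtain ⟨C, hC, h⟩ := exists_integral_wt_mul_wt_le (β₁ := β₁) hβ₂
  have hi := (h z hz).1.const_mul (K₁ * K₂)
  rw [intervalIntegrable_iff_integrableOn_Ioo_of_le hz] at hi ⊢
  refine Integrable.mono' hi (hf.convIntegrand_meas hg z)
    ((ae_restrict_iff' measurableSet_Ioo).2 (Eventually.of_forall fun y hy => ?_))
  exact hf.convIntegrand_le hg hy.1.le hy.2.le

/-- On (0, ∞) the convolution is half of a `posConvolution`, whose integrability (a Fubini argument)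
includes measurability. -/
theorem MemW.conv_meas {β₁ β₂ K₁ K₂ : ℝ} {f g : ℝ → ℝ} (hβ₁ : 0 < β₁) (hβ₂ : 0 ≤ β₂)
    (hf : MemW β₁ β₂ K₁ f) (hg : MemW β₁ β₂ K₂ g) :
    AEStronglyMeasurable (conv f g) (volume.restrict (Ioi 0)) := by
  have h := (integrable_posConvolution (μ := volume) (ν := volume) (hg.integrableOn hβ₁ hβ₂)
    (hf.integrableOn hβ₁ hβ₂) (ContinuousLinearMap.mul ℝ ℝ)).aestronglyMeasurable
  have h2 := (h.mono_measure (Measure.restrict_le_self (s := Ioi (0:ℝ)))).const_mul (1 / 2)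
  refine h2.congr ((ae_restrict_iff' measurableSet_Ioi).2 (Eventually.of_forall fun z hz => ?_))
  simp only [posConvolution, conv, indicator_of_mem hz, ContinuousLinearMap.mul_apply']
  congr 1
  exact intervalIntegral.integral_congr fun y _ => mul_comm _ _

theorem exists_conv_memW {β₁ β₂ : ℝ} (hβ₁ : 0 < β₁) (hβ₂ : 1 < β₂) :
    ∃ C : ℝ, 0 < C ∧ ∀ (K₁ K₂ : ℝ) (f g : ℝ → ℝ), MemW β₁ β₂ K₁ f → MemW β₁ β₂ K₂ g →
      MemW β₁ β₂ (C * (K₁ * K₂)) (conv f g) := by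
  obtain ⟨C, hC, h⟩ := exists_integral_mul_le (β₁ := β₁) hβ₂
  refine ⟨C, hC, fun K₁ K₂ f g hf hg => ⟨hf.conv_meas hβ₁ (by linarith) hg, fun z hz => ?_⟩⟩
  exact h z _ _ hz (mul_nonneg hf.nonneg hg.nonneg) fun y hy hyz => hf.convIntegrand_le hg hy hyz

/-- Polarisation of the quadratic map f ↦ f * f, which makes it Lipschitz on bounded sets. -/
theorem conv_self_sub {β₁ β₂ K₁ K₂ : ℝ} {f g : ℝ → ℝ} (hβ₂ : 1 < β₂)
    (hf : MemW β₁ β₂ K₁ f) (hg : MemW β₁ β₂ K₂ g) {z : ℝ} (hz : 0 ≤ z) :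
    conv f f z - conv g g z = conv (f - g) f z + conv g (f - g) z := by
  unfold conv
  rw [← mul_sub, ← mul_add, ← intervalIntegral.integral_sub
    (hf.convIntegrand_integrable hβ₂ hf hz) (hg.convIntegrand_integrable hβ₂ hg hz),
    ← intervalIntegral.integral_add ((hf.sub hg).convIntegrand_integrable hβ₂ hf hz)
    (hg.convIntegrand_integrable hβ₂ (hf.sub hg) hz)]
  congr 1
  refine intervalIntegral.integral_congr fun y _ => ?_
  simp only [Pi.sub_apply]
  ring

theorem exists_conv_self_sub_le {β₁ β₂ : ℝ} (hβ₁ : 0 < β₁) (hβ₂ : 1 < β₂) :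
    ∃ C : ℝ, 0 < C ∧ ∀ (K X : ℝ) (f g : ℝ → ℝ), MemW β₁ β₂ K f → MemW β₁ β₂ K g →
      MemW β₁ β₂ X (f - g) → ∀ z, 0 ≤ z →
      |conv f f z - conv g g z| ≤ C * (K * X) * wt β₁ β₂ z := by
  obtain ⟨C, hC, h⟩ := exists_conv_memW hβ₁ hβ₂
  refine ⟨2 * C, by positivity, fun K X f g hf hg hfg z hz => ?_⟩
  rw [conv_self_sub hβ₂ hf hg hz]
  have h1 := (h _ _ _ _ hfg hf).bound z hz
  have h2 := (h _ _ _ _ hg hfg).bound z hz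
  refine (abs_add_le _ _).trans ((add_le_add h1 h2).trans (le_of_eq ?_))
  ring

/-! ### Comparison with the norm of `Z` -/

/-- The constant e^β₁ 2^β₂ is 1/`wt` at z = 1: the weight decreases, which settles [0, 1], and for z
≥ 1 one has 1 + z ≤ 2z. Together with `normZ_le_of_wt` this lets all estimates be pointwise ones
against a single weight. -/
theorem exists_wt_compare {β₁ β₂ : ℝ} (hβ₁ : 0 < β₁) (hβ₂ : 0 ≤ β₂) :
    ∃ C : ℝ, 0 < C ∧ ∀ (R : ℝ) (f : ℝ → ℝ), 0 ≤ R → normZ β₁ β₂ f ≤ ENNReal.ofReal R →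
      ∀ z, 0 ≤ z → |f z| ≤ C * R * wt β₁ β₂ z := by
  refine ⟨Real.exp β₁ * 2 ^ β₂, by positivity, fun R f hR h z hz => ?_⟩
  have h1 : (1:ℝ) ≤ Real.exp β₁ := Real.one_le_exp hβ₁.le
  have h2 : (1:ℝ) ≤ 2 ^ β₂ := Real.one_le_rpow (by norm_num) hβ₂
  rcases le_total z 1 with hz1 | hz1
  · have h3 : ENNReal.ofReal |f z| ≤ ENNReal.ofReal R := by
      refine le_trans ?_ ((le_self_add).trans h)
      exact le_iSup₂ (f := fun z (_ : z ∈ Icc (0:ℝ) 1) => ENNReal.ofReal |f z|) z ⟨hz, hz1⟩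
    rw [ENNReal.ofReal_le_ofReal_iff hR] at h3
    have h4 : 1 ≤ Real.exp β₁ * 2 ^ β₂ * wt β₁ β₂ z := by
      unfold wt
      have e1 : 1 ≤ Real.exp β₁ * Real.exp (-β₁ * z) := by
        rw [← Real.exp_add]; exact Real.one_le_exp (by nlinarith)
      have e2 : 1 ≤ 2 ^ β₂ * (1 + z) ^ (-β₂) := by
        rw [Real.rpow_neg (by linarith), ← div_eq_mul_inv, one_le_div (by positivity)]
        exact Real.rpow_le_rpow (by linarith) (by linarith) hβ₂
      calc (1:ℝ) ≤ (Real.exp β₁ * Real.exp (-β₁ * z)) * (2 ^ β₂ * (1 + z) ^ (-β₂)) :=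
            one_le_mul_of_one_le_of_one_le e1 e2
        _ = _ := by ring
    nlinarith
  · have h3 : ENNReal.ofReal |f z * Real.exp (β₁ * z) * z ^ β₂| ≤ ENNReal.ofReal R := by
      refine le_trans ?_ ((le_add_self).trans h)
      exact le_iSup₂ (f := fun z (_ : z ∈ Ici (1:ℝ)) =>
        ENNReal.ofReal |f z * Real.exp (β₁ * z) * z ^ β₂|) z hz1
    rw [ENNReal.ofReal_le_ofReal_iff hR, abs_mul, abs_mul, abs_of_pos (Real.exp_pos _),
      abs_of_nonneg (Real.rpow_nonneg hz _)] at h3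
    have e1 : Real.exp (β₁ * z) * Real.exp (-β₁ * z) = 1 := by rw [← Real.exp_add]; simp
    have e2 : 1 ≤ z ^ β₂ * (2 ^ β₂ * (1 + z) ^ (-β₂)) := by
      rw [Real.rpow_neg (by linarith), ← mul_assoc, ← div_eq_mul_inv, one_le_div (by positivity),
        ← Real.mul_rpow hz (by norm_num)]
      exact Real.rpow_le_rpow (by linarith) (by linarith) hβ₂
    have e3 : |f z| ≤ |f z| * (z ^ β₂ * (2 ^ β₂ * (1 + z) ^ (-β₂))) :=
      le_mul_of_one_le_right (abs_nonneg _) e2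
    have e4 : |f z| * (z ^ β₂ * (2 ^ β₂ * (1 + z) ^ (-β₂)))
        = (|f z| * Real.exp (β₁ * z) * z ^ β₂) * (2 ^ β₂ * wt β₁ β₂ z) := by
      unfold wt
      linear_combination (-(|f z| * z ^ β₂ * 2 ^ β₂ * (1 + z) ^ (-β₂))) * e1
    have hw := wt_pos β₁ β₂ hz
    calc |f z| ≤ (|f z| * Real.exp (β₁ * z) * z ^ β₂) * (2 ^ β₂ * wt β₁ β₂ z) := e4 ▸ e3
      _ ≤ R * (2 ^ β₂ * wt β₁ β₂ z) := by gcongr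
      _ ≤ Real.exp β₁ * (R * (2 ^ β₂ * wt β₁ β₂ z)) := le_mul_of_one_le_left (by positivity) h1
      _ = _ := by ring

theorem normZ_le_of_wt {β₁ β₂ R : ℝ} (hβ₁ : 0 ≤ β₁) (hβ₂ : 0 ≤ β₂) (hR : 0 ≤ R) {f : ℝ → ℝ}
    (h : ∀ z, 0 ≤ z → |f z| ≤ R * wt β₁ β₂ z) : normZ β₁ β₂ f ≤ ENNReal.ofReal (2 * R) := by
  rw [two_mul, ENNReal.ofReal_add hR hR]
  refine add_le_add (iSup₂_le fun z hz => ENNReal.ofReal_le_ofReal ?_)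
    (iSup₂_le fun z hz => ENNReal.ofReal_le_ofReal ?_)
  · exact (h z hz.1).trans (mul_le_of_le_one_right hR (wt_le_one hβ₁ hβ₂ hz.1))
  · have hz1 : (1:ℝ) ≤ z := hz
    have hz0 : 0 ≤ z := by linarith
    rw [abs_mul, abs_mul, abs_of_pos (Real.exp_pos _), abs_of_nonneg (Real.rpow_nonneg hz0 _)]
    have e1 : Real.exp (β₁ * z) * Real.exp (-β₁ * z) = 1 := by rw [← Real.exp_add]; simp
    have e2 : (1 + z) ^ (-β₂) * z ^ β₂ ≤ 1 := by
      rw [Real.rpow_neg (by linarith), inv_mul_le_one₀ (by positivity)]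
      exact Real.rpow_le_rpow hz0 (by linarith) hβ₂
    calc |f z| * Real.exp (β₁ * z) * z ^ β₂
        ≤ (R * wt β₁ β₂ z) * Real.exp (β₁ * z) * z ^ β₂ := by gcongr; exact h z hz0
      _ = R * ((1 + z) ^ (-β₂) * z ^ β₂) := by
          unfold wt; linear_combination (R * (1 + z) ^ (-β₂) * z ^ β₂) * e1
      _ ≤ R := mul_le_of_le_one_right hR e2

theorem normZ_triangle (β₁ β₂ : ℝ) (f g h : ℝ → ℝ) :
    normZ β₁ β₂ (f - h) ≤ normZ β₁ β₂ (f - g) + normZ β₁ β₂ (g - h) := by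
  unfold normZ
  rw [add_add_add_comm]
  refine add_le_add (iSup₂_le fun z hz => ?_) (iSup₂_le fun z hz => ?_)
  · refine le_trans ?_ (add_le_add
      (le_iSup₂ (f := fun z (_ : z ∈ Icc (0:ℝ) 1) => ENNReal.ofReal |(f - g) z|) z hz)
      (le_iSup₂ (f := fun z (_ : z ∈ Icc (0:ℝ) 1) => ENNReal.ofReal |(g - h) z|) z hz))
    rw [← ENNReal.ofReal_add (abs_nonneg _) (abs_nonneg _)]
    refine ENNReal.ofReal_le_ofReal ?_
    simpa using abs_sub_le (f z) (g z) (h z)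
  · refine le_trans ?_ (add_le_add
      (le_iSup₂ (f := fun z (_ : z ∈ Ici (1:ℝ)) =>
        ENNReal.ofReal |(f - g) z * Real.exp (β₁ * z) * z ^ β₂|) z hz)
      (le_iSup₂ (f := fun z (_ : z ∈ Ici (1:ℝ)) =>
        ENNReal.ofReal |(g - h) z * Real.exp (β₁ * z) * z ^ β₂|) z hz))
    rw [← ENNReal.ofReal_add (abs_nonneg _) (abs_nonneg _)]
    refine ENNReal.ofReal_le_ofReal ?_
    refine le_trans (le_of_eq ?_) (abs_add_le _ _)
    congr 1
    simp only [Pi.sub_apply]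
    ring

/-! ### The denominator and its near double zero at 1/2. -/

/-- The denominator of `aCoef`. -/
def den (δ z : ℝ) : ℝ := 1 + z - (lamLSW - δ) * z ^ (1 / 3 : ℝ)

theorem aCoef_eq (δ z : ℝ) : aCoef δ z = (den δ z)⁻¹ := one_div _

theorem exists_cube_root : ∃ s : ℝ, 79 / 100 < s ∧ s < 4 / 5 ∧ s ^ 3 = 1 / 2 ∧ lamLSW = 3 * s ^ 2 := by
  have hs : 0 < (1 / 2 : ℝ) ^ (1 / 3 : ℝ) := by positivity
  have hs3 : ((1 / 2 : ℝ) ^ (1 / 3 : ℝ)) ^ 3 = 1 / 2 := by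
    rw [← Real.rpow_natCast, ← Real.rpow_mul (by norm_num)]; norm_num
  have hs2 : lamLSW = 3 * ((1 / 2 : ℝ) ^ (1 / 3 : ℝ)) ^ 2 := by
    unfold lamLSW
    rw [← Real.rpow_natCast, ← Real.rpow_mul (by norm_num)]; norm_num
  refine ⟨_, ?_, ?_, hs3, hs2⟩
  · by_contra! h
    have := pow_le_pow_left₀ hs.le h 3
    rw [hs3] at this; norm_num at this
  · by_contra! h
    have := pow_le_pow_left₀ (by norm_num) h 3
    rw [hs3] at this; norm_num at this

theorem lamLSW_bounds : 18 / 10 < lamLSW ∧ lamLSW < 2 := by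
  obtain ⟨s, h1, h2, -, h⟩ := exists_cube_root
  rw [h]
  constructor <;> nlinarith

theorem cbrt_cube {z : ℝ} (hz : 0 ≤ z) : (z ^ (1 / 3 : ℝ)) ^ 3 = z := by
  rw [← Real.rpow_natCast, ← Real.rpow_mul hz]; norm_num

/-- In t = z^(1/3) the denominator at δ = 0 is the cubic t^3 - 3 s^2 t + 1; since 2 s^3 = 1, it has
s as a double root and -2s as its third root. -/
theorem exists_den_eq (δ : ℝ) {z : ℝ} (hz : 0 ≤ z) :
    ∃ s t : ℝ, 79 / 100 < s ∧ s < 4 / 5 ∧ s ^ 3 = 1 / 2 ∧ 0 ≤ t ∧ t ^ 3 = z ∧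
      t = z ^ (1 / 3 : ℝ) ∧ den δ z = (t - s) ^ 2 * (t + 2 * s) + δ * t := by
  obtain ⟨s, h1, h2, h3, h⟩ := exists_cube_root
  refine ⟨s, z ^ (1 / 3 : ℝ), h1, h2, h3, Real.rpow_nonneg hz _, cbrt_cube hz, rfl, ?_⟩
  unfold den
  rw [h]
  have hz3 := cbrt_cube hz
  generalize z ^ (1 / 3 : ℝ) = t at *
  rw [← hz3]; linear_combination (-2) * h3

theorem den_zero (δ : ℝ) : den δ 0 = 1 := by
  unfold den
  rw [Real.zero_rpow (by norm_num)]; ring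

theorem den_le {δ z : ℝ} (hδ1 : δ ≤ 1) (hz : 0 ≤ z) : den δ z ≤ 1 + z := by
  unfold den
  have := Real.rpow_nonneg hz (1 / 3)
  have := lamLSW_bounds.1
  nlinarith

/-- The factor t^2 + ts + s^2 in z - 1/2 = (t - s)(t^2 + ts + s^2) is bounded, so (t - s)^2 controls
(z - 1/2)^2. -/
theorem den_ge_sq {δ z : ℝ} (hδ : 0 ≤ δ) (hδ1 : δ ≤ 1) (hz : 0 ≤ z) (hz1 : z ≤ 1) :
    ((z - 1 / 2) ^ 2 + δ) / 20 ≤ den δ z := by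
  obtain ⟨s, t, h1, h2, h3, ht, htz, -, hd⟩ := exists_den_eq δ hz
  rw [hd]
  have ht1 : t ≤ 1 := by
    by_contra! h
    have := one_lt_pow₀ h (by norm_num : 3 ≠ 0)
    linarith
  have e1 : z - 1 / 2 = (t - s) * (t ^ 2 + t * s + s ^ 2) := by
    rw [← htz, ← h3]; ring
  have e2 : (z - 1 / 2) ^ 2 ≤ 9 * (t - s) ^ 2 := by
    rw [e1, mul_pow]
    have hq : t ^ 2 + t * s + s ^ 2 ≤ 3 := by nlinarith
    have hq0 : 0 ≤ t ^ 2 + t * s + s ^ 2 := by positivity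
    have : (t ^ 2 + t * s + s ^ 2) ^ 2 ≤ 9 := by nlinarith
    nlinarith [sq_nonneg (t - s)]
  have e3 : (t - s) ^ 2 * (158 / 100) ≤ (t - s) ^ 2 * (t + 2 * s) := by
    gcongr; linarith
  -- For small t the term δ t does not dominate δ/20, but then (t - s)^2 is bounded below and δ ≤ 1
  -- suffices.
  rcases le_total t (3 / 10) with h | h
  · have : (49 / 100) ^ 2 ≤ (t - s) ^ 2 := by nlinarith
    nlinarith [mul_nonneg hδ ht]
  · nlinarith [sq_nonneg (t - s)]

/-- Beyond 3/5 the double zero is out of reach, and the cubic grows like t^3 = z uniformly in δ. At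
z = 3/5 the inequality (1 + z)/16 ≤ z - 1/2 used below is an equality. -/
theorem den_ge_lin {δ z : ℝ} (hδ : 0 ≤ δ) (hz : 3 / 5 ≤ z) : (1 + z) / 4000 ≤ den δ z := by
  obtain ⟨s, t, h1, h2, h3, ht, htz, -, hd⟩ := exists_den_eq δ (z := z) (by linarith)
  rw [hd]
  have hst : s < t := by
    by_contra! h
    have := pow_le_pow_left₀ ht h 3
    linarith
  have e1 : z - 1 / 2 = (t - s) * (t ^ 2 + t * s + s ^ 2) := by
    rw [← htz, ← h3]; ring
  have hq : t ^ 2 + t * s + s ^ 2 ≤ 3 * t ^ 2 := by nlinarith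
  have e2 : (1 + z) / 16 ≤ (t - s) * (3 * t ^ 2) := by
    calc (1 + z) / 16 ≤ z - 1 / 2 := by linarith
      _ ≤ _ := by rw [e1]; gcongr
  have e3 : ((1 + z) / 16) ^ 2 ≤ ((t - s) * (3 * t ^ 2)) ^ 2 :=
    pow_le_pow_left₀ (by linarith) e2 2
  have e4 : (1 + z) / 4000 * (9 * z) ≤ ((1 + z) / 16) ^ 2 := by nlinarith
  have e5 : ((t - s) * (3 * t ^ 2)) ^ 2 ≤ ((t - s) ^ 2 * (t + 2 * s)) * (9 * z) := by
    rw [← htz]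
    have : 0 ≤ (t - s) ^ 2 * (2 * s) * (9 * t ^ 3) := by
      have : 0 < s := by linarith
      positivity
    nlinarith
  have e6 : (1 + z) / 4000 * (9 * z) ≤ ((t - s) ^ 2 * (t + 2 * s)) * (9 * z) :=
    e4.trans (e3.trans e5)
  have e7 := le_of_mul_le_mul_right e6 (by linarith)
  nlinarith [mul_nonneg hδ ht]

theorem den_ge_delta {δ z : ℝ} (hδ : 0 ≤ δ) (hδ1 : δ ≤ 1) (hz : 0 ≤ z) :
    δ * (1 + z) / 4000 ≤ den δ z := by
  rcases le_total z 1 with h | h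
  · refine le_trans ?_ (den_ge_sq hδ hδ1 hz h)
    nlinarith [sq_nonneg (z - 1 / 2)]
  · refine le_trans ?_ (den_ge_lin hδ (by linarith))
    have : δ * (1 + z) ≤ 1 * (1 + z) := by gcongr
    linarith

theorem den_le_sq {δ z : ℝ} (hδ : 0 ≤ δ) (hz : 0 ≤ z) (hz1 : z ≤ 1) :
    den δ z ≤ 10 * ((z - 1 / 2) ^ 2 + δ) := by
  obtain ⟨s, t, h1, h2, h3, ht, htz, -, hd⟩ := exists_den_eq δ hz
  rw [hd]
  have ht1 : t ≤ 1 := by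
    by_contra! h
    have := one_lt_pow₀ h (by norm_num : 3 ≠ 0)
    linarith
  have e1 : z - 1 / 2 = (t - s) * (t ^ 2 + t * s + s ^ 2) := by
    rw [← htz, ← h3]; ring
  have e2 : (t - s) ^ 2 * (36 / 100) ≤ (z - 1 / 2) ^ 2 := by
    rw [e1, mul_pow]
    have hq0 : 6 / 10 ≤ t ^ 2 + t * s + s ^ 2 := by nlinarith
    have : 36 / 100 ≤ (t ^ 2 + t * s + s ^ 2) ^ 2 := by nlinarith
    gcongr
  have e3 : (t - s) ^ 2 * (t + 2 * s) ≤ (t - s) ^ 2 * 3 := by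
    gcongr; linarith
  nlinarith [sq_nonneg (t - s)]

theorem den_pos {δ z : ℝ} (hδ : 0 < δ) (hz : 0 ≤ z) : 0 < den δ z := denom_pos hδ hz

theorem continuous_den (δ : ℝ) : Continuous (den δ) :=
  (continuous_const.add continuous_id).sub (continuous_const.mul
    (Real.continuous_rpow_const (by norm_num)))

theorem hasDerivAt_den (δ : ℝ) {z : ℝ} (hz : 0 < z) :
    HasDerivAt (den δ) (1 - (lamLSW - δ) / 3 * z ^ (-2 / 3 : ℝ)) z := by
  have h := (Real.hasDerivAt_rpow_const (x := z) (p := (1 / 3 : ℝ)) (Or.inl hz.ne'))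
  have h2 := ((hasDerivAt_id z).const_add 1).sub (h.const_mul (lamLSW - δ))
  refine h2.congr_deriv ?_
  norm_num
  ring

theorem continuousOn_aCoef {δ : ℝ} (hδ : 0 < δ) : ContinuousOn (aCoef δ) (Ici 0) :=
  ContinuousOn.div continuousOn_const (continuous_den δ).continuousOn
    fun _ hy => (denom_pos hδ hy).ne'

theorem aCoef_pos {δ z : ℝ} (hδ : 0 < δ) (hz : 0 ≤ z) : 0 < aCoef δ z := by
  rw [aCoef_eq]; exact inv_pos.2 (den_pos hδ hz)

theorem intervalIntegrable_aCoef_mul {δ z ξ : ℝ} {f : ℝ → ℝ} (hδ : 0 < δ) (hz : 0 ≤ z)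
    (hξ : 0 ≤ ξ) (hf : IntervalIntegrable f volume z ξ) :
    IntervalIntegrable (fun y => aCoef δ y * f y) volume z ξ := by
  refine hf.continuousOn_mul ((continuousOn_aCoef hδ).mono ?_)
  intro y hy
  rw [mem_uIcc] at hy
  show 0 ≤ y
  rcases hy with h | h <;> linarith [h.1]

/-! ### The singular exponent `Q` and the coupling exponent `P`. -/

/-- The density of the exponent `Q`. -/
def qDens (δ y : ℝ) : ℝ := aCoef δ y * ((lamLSW - δ) / 3 * y ^ (-2 / 3 : ℝ))

/-- The singular part of the exponent of `psiRaw`. -/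
def Q (δ z : ℝ) : ℝ := ∫ y in (0 : ℝ)..z, qDens δ y

/-- The contribution of the couplings to the exponent of `psiRaw`. -/
def P (δ : ℝ) (p : ℝ × ℝ) (z : ℝ) : ℝ := ∫ y in (0 : ℝ)..z, aCoef δ y * (p.2 * y + p.1)

theorem intervalIntegrable_rpow_two_thirds (a b : ℝ) :
    IntervalIntegrable (fun y : ℝ => y ^ (-2 / 3 : ℝ)) volume a b :=
  intervalIntegral.intervalIntegrable_rpow' (by norm_num)

theorem intervalIntegrable_qDens {δ z ξ : ℝ} (hδ : 0 < δ) (hz : 0 ≤ z) (hξ : 0 ≤ ξ) :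
    IntervalIntegrable (qDens δ) volume z ξ :=
  intervalIntegrable_aCoef_mul hδ hz hξ ((intervalIntegrable_rpow_two_thirds z ξ).const_mul _)

theorem intervalIntegrable_pDens {δ z ξ : ℝ} (p : ℝ × ℝ) (hδ : 0 < δ) (hz : 0 ≤ z) (hξ : 0 ≤ ξ) :
    IntervalIntegrable (fun y => aCoef δ y * (p.2 * y + p.1)) volume z ξ :=
  intervalIntegrable_aCoef_mul hδ hz hξ (Continuous.intervalIntegrable (by fun_prop) _ _)

theorem Q_sub {δ z ξ : ℝ} (hδ : 0 < δ) (hz : 0 ≤ z) (hξ : 0 ≤ ξ) :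
    Q δ ξ - Q δ z = ∫ y in z..ξ, qDens δ y :=
  intervalIntegral.integral_interval_sub_left (intervalIntegrable_qDens hδ le_rfl hξ)
    (intervalIntegrable_qDens hδ le_rfl hz)

theorem P_sub {δ z ξ : ℝ} (p : ℝ × ℝ) (hδ : 0 < δ) (hz : 0 ≤ z) (hξ : 0 ≤ ξ) :
    P δ p ξ - P δ p z = ∫ y in z..ξ, aCoef δ y * (p.2 * y + p.1) :=
  intervalIntegral.integral_interval_sub_left (intervalIntegrable_pDens p hδ le_rfl hξ)
    (intervalIntegrable_pDens p hδ le_rfl hz)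

theorem qDens_nonneg {δ y : ℝ} (hδ : 0 < δ) (hδ1 : δ ≤ 1) (hy : 0 ≤ y) : 0 ≤ qDens δ y := by
  unfold qDens
  have := (aCoef_pos hδ hy).le
  have := Real.rpow_nonneg hy (-2 / 3)
  have : 0 ≤ lamLSW - δ := by linarith [lamLSW_bounds.1]
  positivity

theorem Q_mono {δ z ξ : ℝ} (hδ : 0 < δ) (hδ1 : δ ≤ 1) (hz : 0 ≤ z) (hzξ : z ≤ ξ) :
    Q δ z ≤ Q δ ξ := by
  have h := Q_sub hδ hz (hz.trans hzξ)
  have : 0 ≤ ∫ y in z..ξ, qDens δ y :=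
    intervalIntegral.integral_nonneg hzξ fun y hy => qDens_nonneg hδ hδ1 (hz.trans hy.1)
  linarith

theorem Q_zero (δ : ℝ) : Q δ 0 = 0 := by simp [Q]

theorem P_zero (δ : ℝ) (p : ℝ × ℝ) : P δ p 0 = 0 := by simp [P]

/-- Past 3/5 the density is at most 4000 y^(-5/3), which is integrable at infinity, so `Q δ (3 / 5)`
is the total height of `Q` up to a constant. The constant is 4000 · (3/2) · (5/3). -/
theorem Q_le_add {δ ξ : ℝ} (hδ : 0 < δ) (hδ1 : δ ≤ 1) (hξ : 0 ≤ ξ) :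
    Q δ ξ ≤ Q δ (3 / 5) + 10000 := by
  rcases le_total ξ (3 / 5) with h | h
  · linarith [Q_mono hδ hδ1 hξ h]
  have h1 := Q_sub (z := 3 / 5) hδ (by norm_num) hξ
  have hmem : (0:ℝ) ∉ uIcc (3 / 5) ξ := by
    rw [uIcc_of_le h]; intro hm; linarith [hm.1]
  have h2 : ∫ y in (3 / 5 : ℝ)..ξ, qDens δ y ≤ ∫ y in (3 / 5 : ℝ)..ξ, 4000 * y ^ (-5 / 3 : ℝ) := by
    refine intervalIntegral.integral_mono_on h (intervalIntegrable_qDens hδ (by norm_num) hξ)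
      ((intervalIntegral.intervalIntegrable_rpow (Or.inr hmem)).const_mul _) fun y hy => ?_
    have hy0 : 0 < y := by linarith [hy.1]
    have e1 : aCoef δ y ≤ 4000 * y⁻¹ := by
      rw [aCoef_eq]
      have := den_ge_lin hδ.le hy.1
      calc (den δ y)⁻¹ ≤ (y / 4000)⁻¹ := by
            apply inv_anti₀ (by positivity); linarith
        _ = _ := by field_simp
    have e2 : y ^ (-5 / 3 : ℝ) = y⁻¹ * y ^ (-2 / 3 : ℝ) := by
      rw [← Real.rpow_neg_one, ← Real.rpow_add hy0]; norm_num
    have e3 : (lamLSW - δ) / 3 * y ^ (-2 / 3 : ℝ) ≤ 1 * y ^ (-2 / 3 : ℝ) := by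
      gcongr; linarith [lamLSW_bounds.2]
    have e4 : 0 ≤ y ^ (-2 / 3 : ℝ) := Real.rpow_nonneg hy0.le _
    have e5 : 0 ≤ (lamLSW - δ) / 3 := by linarith [lamLSW_bounds.1]
    unfold qDens
    rw [e2]
    calc _ ≤ (4000 * y⁻¹) * (1 * y ^ (-2 / 3 : ℝ)) := by gcongr
      _ = _ := by ring
  rw [intervalIntegral.integral_const_mul, integral_rpow (Or.inr ⟨by norm_num, hmem⟩)] at h2
  have e1 : 0 ≤ ξ ^ (-5 / 3 + 1 : ℝ) := Real.rpow_nonneg hξ _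
  have e2 : (3 / 5 : ℝ) ^ (-5 / 3 + 1 : ℝ) ≤ (3 / 5 : ℝ) ^ (-1 : ℝ) :=
    Real.rpow_le_rpow_of_exponent_ge (by norm_num) (by norm_num) (by norm_num)
  rw [Real.rpow_neg_one] at e2
  have e3 : 4000 * ((ξ ^ (-5 / 3 + 1 : ℝ) - (3 / 5 : ℝ) ^ (-5 / 3 + 1 : ℝ)) / (-5 / 3 + 1)) ≤ 10000 := by
    norm_num at e1 e2 ⊢
    linarith
  linarith

/-- Within √δ/10 of 1/2 the denominator is at most 11 δ, so the density is at least 1/(50 δ) on an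
interval of length √δ/10. Applied with z = 1/2 - √δ/10 and z = 1/2 it gives a jump on each side. -/
theorem Q_sub_ge {δ z : ℝ} (hδ : 0 < δ) (hδ1 : δ ≤ 1) (hz : 1 / 2 - √δ / 10 ≤ z)
    (hz2 : z ≤ 1 / 2) : 1 / (500 * √δ) ≤ Q δ (z + √δ / 10) - Q δ z := by
  have hs : 0 < √δ := Real.sqrt_pos.2 hδ
  have hs1 : √δ ≤ 1 := Real.sqrt_le_one.2 hδ1
  have hss : √δ ^ 2 = δ := Real.sq_sqrt hδ.le
  rw [Q_sub hδ (by linarith) (by linarith)]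
  have h : ∫ y in z..(z + √δ / 10), (1 / (50 * δ)) ≤ ∫ y in z..(z + √δ / 10), qDens δ y := by
    refine intervalIntegral.integral_mono_on (by linarith) (by simp)
      (intervalIntegrable_qDens hδ (by linarith) (by linarith)) fun y hy => ?_
    have hy0 : 0 < y := by linarith [hy.1]
    have hy1 : y ≤ 1 := by linarith [hy.2]
    have e1 := den_le_sq hδ.le hy0.le hy1
    have e2 : (y - 1 / 2) ^ 2 ≤ δ / 100 := by
      have : |y - 1 / 2| ≤ √δ / 10 := by rw [abs_le]; constructor <;> linarith [hy.1, hy.2]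
      calc (y - 1 / 2) ^ 2 = |y - 1 / 2| ^ 2 := (sq_abs _).symm
        _ ≤ (√δ / 10) ^ 2 := by gcongr
        _ = δ / 100 := by rw [div_pow, hss]; norm_num
    have e3 : 1 / (11 * δ) ≤ aCoef δ y := by
      rw [aCoef_eq, one_div]
      exact inv_anti₀ (den_pos hδ hy0.le) (by linarith)
    have e4 : 1 ≤ y ^ (-2 / 3 : ℝ) := Real.one_le_rpow_of_pos_of_le_one_of_nonpos hy0 hy1 (by norm_num)
    have e5 : 26 / 100 ≤ (lamLSW - δ) / 3 := by linarith [lamLSW_bounds.1]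
    have e6 := (aCoef_pos hδ hy0.le).le
    unfold qDens
    calc 1 / (50 * δ) ≤ 1 / (11 * δ) * (26 / 100 * 1) := by
          rw [div_mul_eq_mul_div, div_le_div_iff₀ (by positivity) (by positivity)]
          nlinarith
      _ ≤ _ := by gcongr
  rw [intervalIntegral.integral_const, smul_eq_mul] at h
  refine le_trans (le_of_eq ?_) h
  rw [add_sub_cancel_left]
  generalize √δ = s at *
  subst hss
  field_simp
  norm_num

theorem exists_exp_le_pow (k : ℕ) : ∃ C : ℝ, 0 < C ∧ ∀ δ : ℝ, 0 < δ →
    Real.exp (-(1 / (500 * √δ))) ≤ C * δ ^ k := by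
  refine ⟨(2 * k).factorial * 500 ^ (2 * k), by positivity, fun δ hδ => ?_⟩
  have hs : 0 < √δ := Real.sqrt_pos.2 hδ
  have h := Real.pow_div_factorial_le_exp (1 / (500 * √δ)) (by positivity) (2 * k)
  rw [Real.exp_neg]
  have e : (√δ) ^ (2 * k) = δ ^ k := by rw [pow_mul, Real.sq_sqrt hδ.le]
  calc _ ≤ ((1 / (500 * √δ)) ^ (2 * k) / (2 * k).factorial)⁻¹ := inv_anti₀ (by positivity) h
    _ = _ := by rw [div_pow, mul_pow, e, one_pow]; field_simp

/-- The exponent `Q` jumps by more than any multiple of `log δ` on either side of `1/2`. -/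
theorem exists_exp_Q_le (k : ℕ) : ∃ C : ℝ, 0 < C ∧ ∀ δ : ℝ, 0 < δ → δ ≤ 1 →
    Real.exp (-Q δ (1 / 2)) ≤ C * δ ^ k ∧
    Real.exp (Q δ (1 / 2) - Q δ (3 / 5)) ≤ C * δ ^ k ∧ Real.exp (-Q δ (3 / 5)) ≤ C * δ ^ k := by
  obtain ⟨C, hC, h⟩ := exists_exp_le_pow k
  refine ⟨C, hC, fun δ hδ hδ1 => ?_⟩
  have hs : 0 < √δ := Real.sqrt_pos.2 hδ
  have hs1 : √δ ≤ 1 := Real.sqrt_le_one.2 hδ1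
  have h1 := Q_sub_ge (z := 1 / 2 - √δ / 10) hδ hδ1 le_rfl (by linarith)
  have h2 := Q_sub_ge (z := 1 / 2) hδ hδ1 (by linarith) le_rfl
  rw [sub_add_cancel] at h1
  have h3 := Q_mono (z := 0) (ξ := 1 / 2 - √δ / 10) hδ hδ1 le_rfl (by linarith)
  have h4 := Q_mono (z := 1 / 2 + √δ / 10) (ξ := 3 / 5) hδ hδ1 (by linarith) (by linarith)
  have h5 := Q_mono (z := 1 / 2) (ξ := 3 / 5) hδ hδ1 (by linarith) (by linarith)
  rw [Q_zero] at h3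
  refine ⟨le_trans (Real.exp_le_exp.2 ?_) (h δ hδ), le_trans (Real.exp_le_exp.2 ?_) (h δ hδ),
    le_trans (Real.exp_le_exp.2 ?_) (h δ hδ)⟩ <;> linarith

/-- The admissible range of the couplings. -/
def Adm (δ : ℝ) (p : ℝ × ℝ) : Prop := (0 ≤ p.1 ∧ p.1 ≤ √δ) ∧ (0 ≤ p.2 ∧ p.2 ≤ √δ)

theorem P_mono {δ z ξ : ℝ} {p : ℝ × ℝ} (hp : Adm δ p) (hδ : 0 < δ) (hz : 0 ≤ z) (hzξ : z ≤ ξ) :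
    P δ p z ≤ P δ p ξ := by
  have h := P_sub p hδ hz (hz.trans hzξ)
  have : 0 ≤ ∫ y in z..ξ, aCoef δ y * (p.2 * y + p.1) := by
    refine intervalIntegral.integral_nonneg hzξ fun y hy => ?_
    have hy0 : 0 ≤ y := hz.trans hy.1
    have h1 := (aCoef_pos hδ hy0).le
    have h2 := hp.1.1
    have h3 := hp.2.1
    positivity
  linarith

/-- Couplings of size √δ are the borderline: the integrand is at most 40 √δ / ((y - 1/2)^2 + δ), the
derivative of 40 arctan((y - 1/2)/√δ), whose total increase is at most 40π ≤ 160 for every δ. -/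
theorem P_le {δ z : ℝ} {p : ℝ × ℝ} (hp : Adm δ p) (hδ : 0 < δ) (hδ1 : δ ≤ 1) (hz : 0 ≤ z)
    (hz1 : z ≤ 1) : P δ p z ≤ 160 := by
  refine (P_mono hp hδ hz hz1).trans ?_
  have hs : 0 < √δ := Real.sqrt_pos.2 hδ
  have hss : √δ ^ 2 = δ := Real.sq_sqrt hδ.le
  have hder : ∀ y : ℝ, HasDerivAt (fun y => 40 * Real.arctan ((y - 1 / 2) / √δ))
      (40 * √δ / ((y - 1 / 2) ^ 2 + δ)) y := by
    intro y
    have h := ((((hasDerivAt_id y).sub_const (1 / 2)).div_const √δ).arctan).const_mul 40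
    refine h.congr_deriv ?_
    have : 0 < (y - 1 / 2) ^ 2 + δ := by positivity
    simp only [id]
    generalize √δ = s at *
    subst hss
    field_simp
    ring
  have hcont : Continuous fun y : ℝ => 40 * √δ / ((y - 1 / 2) ^ 2 + δ) :=
    Continuous.div (by fun_prop) (by fun_prop) fun _ => by positivity
  have hI := intervalIntegral.integral_eq_sub_of_hasDerivAt (a := 0) (b := 1) (fun y _ => hder y)
    (hcont.intervalIntegrable _ _)
  have h : P δ p 1 ≤ ∫ y in (0:ℝ)..1, 40 * √δ / ((y - 1 / 2) ^ 2 + δ) := by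
    refine intervalIntegral.integral_mono_on (by norm_num)
      (intervalIntegrable_pDens p hδ le_rfl (by norm_num)) (hcont.intervalIntegrable _ _)
      fun y hy => ?_
    have e1 : aCoef δ y ≤ 20 / ((y - 1 / 2) ^ 2 + δ) := by
      rw [aCoef_eq]
      refine (inv_anti₀ (by positivity) (den_ge_sq hδ.le hδ1 hy.1 hy.2)).trans (le_of_eq ?_)
      rw [inv_div]
    have e2 : p.2 * y + p.1 ≤ 2 * √δ := by nlinarith [hp.1.2, hp.2.2, hp.2.1, hy.1, hy.2]
    have e3 : 0 ≤ p.2 * y + p.1 := by nlinarith [hp.1.1, hp.2.1, hy.1, mul_nonneg hp.2.1 hy.1]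
    calc _ ≤ 20 / ((y - 1 / 2) ^ 2 + δ) * (2 * √δ) := by gcongr
      _ = _ := by ring
  rw [hI] at h
  have h1 := Real.arctan_lt_pi_div_two ((1 - 1 / 2) / √δ)
  have h2 := Real.neg_pi_div_two_lt_arctan ((0 - 1 / 2) / √δ)
  have := Real.pi_le_four
  linarith

/-- The crude bound `den_ge_delta` costs a factor 1/δ, which is harmless: every later use is
compensated by a high power of δ. -/
theorem abs_P_sub_le {δ z ξ : ℝ} (p q : ℝ × ℝ) (hδ : 0 < δ) (hδ1 : δ ≤ 1) (hz : 0 ≤ z)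
    (hzξ : z ≤ ξ) :
    |(P δ p z - P δ p ξ) - (P δ q z - P δ q ξ)| ≤ 4000 / δ * ‖p - q‖ * (ξ - z) := by
  have hξ := hz.trans hzξ
  have e : (P δ p z - P δ p ξ) - (P δ q z - P δ q ξ)
      = -∫ y in z..ξ, (aCoef δ y * (p.2 * y + p.1) - aCoef δ y * (q.2 * y + q.1)) := by
    rw [intervalIntegral.integral_sub (intervalIntegrable_pDens p hδ hz hξ)
      (intervalIntegrable_pDens q hδ hz hξ), ← P_sub p hδ hz hξ, ← P_sub q hδ hz hξ]
    ring
  rw [e, abs_neg, ← Real.norm_eq_abs]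
  have h := intervalIntegral.norm_integral_le_of_norm_le_const (a := z) (b := ξ)
    (C := 4000 / δ * ‖p - q‖)
    (f := fun y => aCoef δ y * (p.2 * y + p.1) - aCoef δ y * (q.2 * y + q.1)) (fun y hy => by
      rw [uIoc_of_le hzξ] at hy
      have hy0 : 0 ≤ y := hz.trans hy.1.le
      have h1 : |p.1 - q.1| ≤ ‖p - q‖ := norm_fst_le (p - q)
      have h2 : |p.2 - q.2| ≤ ‖p - q‖ := norm_snd_le (p - q)
      have h3 : |(p.2 - q.2) * y + (p.1 - q.1)| ≤ ‖p - q‖ * (1 + y) := by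
        refine (abs_add_le _ _).trans ?_
        rw [abs_mul, abs_of_nonneg hy0]
        nlinarith
      have h4 : aCoef δ y * (1 + y) ≤ 4000 / δ := by
        rw [aCoef_eq, inv_mul_le_iff₀ (den_pos hδ hy0)]
        have := den_ge_delta hδ.le hδ1 hy0
        rw [mul_div_assoc', le_div_iff₀ hδ]
        linarith
      rw [← mul_sub, Real.norm_eq_abs, abs_mul, abs_of_pos (aCoef_pos hδ hy0)]
      have e2 : p.2 * y + p.1 - (q.2 * y + q.1) = (p.2 - q.2) * y + (p.1 - q.1) := by ring
      rw [e2]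
      have h5 := (aCoef_pos hδ hy0).le
      calc _ ≤ aCoef δ y * (‖p - q‖ * (1 + y)) := by gcongr
        _ = (aCoef δ y * (1 + y)) * ‖p - q‖ := by ring
        _ ≤ _ := by gcongr)
  rwa [abs_of_nonneg (by linarith : 0 ≤ ξ - z)] at h

/-! ### Closed form of the homogeneous solution. -/

theorem continuousOn_primitive_Ici {f : ℝ → ℝ}
    (hf : ∀ z, 0 ≤ z → IntervalIntegrable f volume 0 z) :
    ContinuousOn (fun z => ∫ y in (0 : ℝ)..z, f y) (Ici 0) := by
  intro z hz
  have hz0 : (0:ℝ) ≤ z := hz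
  have h := intervalIntegral.continuousOn_primitive_interval' (hf (z + 1) (by linarith))
    (left_mem_uIcc)
  rw [uIcc_of_le (by linarith)] at h
  refine (h z ⟨hz0, by linarith⟩).mono_of_mem_nhdsWithin ?_
  have : Ici (0:ℝ) ∩ Iio (z + 1) ∈ 𝓝[Ici 0] z :=
    inter_mem_nhdsWithin _ (Iio_mem_nhds (by linarith))
  exact mem_of_superset this fun y hy => ⟨hy.1, hy.2.le⟩

theorem intervalIntegrable_bCoef (δ z ξ : ℝ) : IntervalIntegrable (bCoef δ) volume z ξ := by
  unfold bCoef
  exact intervalIntegrable_const.sub ((intervalIntegrable_rpow_two_thirds z ξ).const_mul _)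

/-- The integrand is the logarithmic derivative of `den`, and `den δ 0 = 1`. -/
theorem integral_aCoef_mul_deriv_den {δ z : ℝ} (hδ : 0 < δ) (hz : 0 ≤ z) :
    IntervalIntegrable (fun y => aCoef δ y * (1 - (lamLSW - δ) / 3 * y ^ (-2 / 3 : ℝ))) volume 0 z ∧
    ∫ y in (0:ℝ)..z, aCoef δ y * (1 - (lamLSW - δ) / 3 * y ^ (-2 / 3 : ℝ))
      = Real.log (den δ z) := by
  have h1 : IntervalIntegrable (fun _ : ℝ => (1:ℝ)) volume 0 z := intervalIntegrable_const
  have hi := intervalIntegrable_aCoef_mul hδ le_rfl hz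
    (h1.sub ((intervalIntegrable_rpow_two_thirds 0 z).const_mul ((lamLSW - δ) / 3)))
  refine ⟨hi, ?_⟩
  rw [intervalIntegral.integral_eq_sub_of_hasDerivAt_of_le (f := fun y => Real.log (den δ y)) hz
    ?_ ?_ hi]
  · simp [den_zero]
  · exact (continuous_den δ).continuousOn.log fun y hy => (den_pos hδ hy.1).ne'
  · intro y hy
    refine ((hasDerivAt_den δ hy.1).log (den_pos hδ hy.1.le).ne').congr_deriv ?_
    rw [aCoef_eq, inv_mul_eq_div]

/-- Split `bCoef` as twice the derivative of `den` plus (λ_LSW - δ)/3 y^(-2/3): the first part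
integrates to 2 log `den`, the second to `Q`, and the couplings contribute -`P`. -/
theorem psiRaw_eq {δ z : ℝ} (p : ℝ × ℝ) (hδ : 0 < δ) (hz : 0 ≤ z) :
    psiRaw δ p.1 p.2 z = ((den δ z) ^ 2)⁻¹ * Real.exp (-Q δ z) * Real.exp (P δ p z) := by
  obtain ⟨hi, hI⟩ := integral_aCoef_mul_deriv_den hδ hz
  have hq := intervalIntegrable_qDens hδ le_rfl hz
  have hp := intervalIntegrable_pDens p hδ le_rfl hz
  have e : ∫ y in (0:ℝ)..z, aCoef δ y * (bCoef δ y - p.2 * y - p.1)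
      = 2 * Real.log (den δ z) + Q δ z - P δ p z := by
    unfold Q P
    rw [← hI, ← intervalIntegral.integral_const_mul, ← intervalIntegral.integral_add
      (hi.const_mul 2) hq, ← intervalIntegral.integral_sub ((hi.const_mul 2).add hq) hp]
    refine intervalIntegral.integral_congr fun y _ => ?_
    simp only [qDens, bCoef]
    ring
  unfold psiRaw
  have hd := den_pos hδ hz
  rw [e, show -(2 * Real.log (den δ z) + Q δ z - P δ p z)
    = -(2 * Real.log (den δ z)) + -Q δ z + P δ p z by ring, Real.exp_add, Real.exp_add,
    Real.exp_neg (2 * _), two_mul, Real.exp_add, Real.exp_log hd, sq]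

theorem continuousOn_psiRaw {δ : ℝ} (p : ℝ × ℝ) (hδ : 0 < δ) :
    ContinuousOn (psiRaw δ p.1 p.2) (Ici 0) := by
  refine (continuousOn_primitive_Ici fun z hz => ?_).neg.rexp
  refine intervalIntegrable_aCoef_mul hδ le_rfl hz ?_
  exact ((intervalIntegrable_bCoef δ 0 z).sub (Continuous.intervalIntegrable (by fun_prop) _ _)).sub
    intervalIntegrable_const

theorem psiRaw_pos (δ ε ε' z : ℝ) : 0 < psiRaw δ ε ε' z := Real.exp_pos _

theorem psi_normalizer_pos {δ : ℝ} (p : ℝ × ℝ) (hδ : 0 < δ) :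
    0 < ∫ y in (0 : ℝ)..1, y * psiRaw δ p.1 p.2 y := by
  refine intervalIntegral.intervalIntegral_pos_of_pos_on ?_ (fun y hy => ?_) (by norm_num)
  · refine ContinuousOn.intervalIntegrable ?_
    rw [uIcc_of_le (by norm_num)]
    exact continuousOn_id.mul ((continuousOn_psiRaw p hδ).mono Icc_subset_Ici_self)
  · exact mul_pos hy.1 (psiRaw_pos _ _ _ _)

theorem psi_pos {δ : ℝ} (p : ℝ × ℝ) (hδ : 0 < δ) (z : ℝ) : 0 < psi δ p.1 p.2 z :=
  div_pos (psiRaw_pos _ _ _ _) (psi_normalizer_pos p hδ)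

theorem continuousOn_psi {δ : ℝ} (p : ℝ × ℝ) (hδ : 0 < δ) :
    ContinuousOn (psi δ p.1 p.2) (Ici 0) :=
  (continuousOn_psiRaw p hδ).div_const _

/-! ### The kernel: size, Lipschitz dependence on the couplings, gain off the crossing region. -/

/-- The kernel of the variation of constants formula. -/
def ker (δ : ℝ) (p : ℝ × ℝ) (z ξ : ℝ) : ℝ :=
  ξ * aCoef δ ξ * (psi δ p.1 p.2 z / psi δ p.1 p.2 ξ)

theorem psi_div_psi {δ : ℝ} (p : ℝ × ℝ) (hδ : 0 < δ) (z ξ : ℝ) :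
    psi δ p.1 p.2 z / psi δ p.1 p.2 ξ = psiRaw δ p.1 p.2 z / psiRaw δ p.1 p.2 ξ :=
  div_div_div_cancel_right₀ (psi_normalizer_pos p hδ).ne' _ _

theorem ker_eq {δ z ξ : ℝ} (p : ℝ × ℝ) (hδ : 0 < δ) (hz : 0 ≤ z) (hξ : 0 ≤ ξ) :
    ker δ p z ξ = ξ * den δ ξ / den δ z ^ 2 * Real.exp (Q δ ξ - Q δ z) *
      Real.exp (P δ p z - P δ p ξ) := by
  unfold ker
  rw [psi_div_psi p hδ, psiRaw_eq p hδ hz, psiRaw_eq p hδ hξ, aCoef_eq]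
  have h1 := (den_pos hδ hz).ne'
  have h2 := (den_pos hδ hξ).ne'
  have e1 : Real.exp (Q δ ξ - Q δ z) = Real.exp (-Q δ z) / Real.exp (-Q δ ξ) := by
    rw [← Real.exp_sub]; ring_nf
  have e2 : Real.exp (P δ p z - P δ p ξ) = Real.exp (P δ p z) / Real.exp (P δ p ξ) :=
    Real.exp_sub _ _
  rw [e1, e2]
  field_simp

theorem psiRaw_zero_eq_one (δ ε ε' : ℝ) : psiRaw δ ε ε' 0 = 1 := by simp [psiRaw]

/-- The rank-one structure: the z-dependence separates from the ξ-dependence, so the only coupling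
between z and ξ in the integral is its lower limit. -/
theorem ker_factor {δ : ℝ} (p : ℝ × ℝ) (hδ : 0 < δ) (z ξ : ℝ) :
    ker δ p z ξ = psiRaw δ p.1 p.2 z * ker δ p 0 ξ := by
  unfold ker
  rw [psi_div_psi p hδ, psi_div_psi p hδ, psiRaw_zero_eq_one]
  ring

theorem ker_nonneg {δ z ξ : ℝ} (p : ℝ × ℝ) (hδ : 0 < δ) (hξ : 0 ≤ ξ) : 0 ≤ ker δ p z ξ := by
  unfold ker
  have h1 := (aCoef_pos hδ hξ).le
  have h2 := (psi_pos p hδ z).le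
  have h3 := (psi_pos p hδ ξ).le
  positivity

theorem continuousOn_ker {δ : ℝ} (p : ℝ × ℝ) (hδ : 0 < δ) (z : ℝ) :
    ContinuousOn (ker δ p z) (Ici 0) :=
  (continuousOn_id.mul (continuousOn_aCoef hδ)).mul
    (continuousOn_const.div (continuousOn_psi p hδ) fun ξ _ => (psi_pos p hδ ξ).ne')

theorem aestronglyMeasurable_ker {δ z w : ℝ} (p : ℝ × ℝ) (hδ : 0 < δ) (hw : 0 ≤ w) :
    AEStronglyMeasurable (ker δ p z) (volume.restrict (Ioi w)) :=
  ((continuousOn_ker p hδ z).mono (fun _ hξ => hw.trans (le_of_lt hξ))).aestronglyMeasurable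
    measurableSet_Ioi

/-- The majorant of the kernel at vanishing couplings. -/
def kerMaj (δ z ξ : ℝ) : ℝ := ξ * den δ ξ / den δ z ^ 2 * Real.exp (Q δ ξ - Q δ z)

theorem kerMaj_nonneg {δ z ξ : ℝ} (hδ : 0 < δ) (hξ : 0 ≤ ξ) : 0 ≤ kerMaj δ z ξ := by
  unfold kerMaj
  have h1 := (den_pos hδ hξ).le
  positivity

theorem ker_le_kerMaj {δ z ξ : ℝ} {p : ℝ × ℝ} (hp : Adm δ p) (hδ : 0 < δ) (hz : 0 ≤ z)
    (hzξ : z ≤ ξ) : ker δ p z ξ ≤ kerMaj δ z ξ := by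
  rw [ker_eq p hδ hz (hz.trans hzξ)]
  refine mul_le_of_le_one_right (kerMaj_nonneg hδ (hz.trans hzξ)) (Real.exp_le_one_iff.2 ?_)
  linarith [P_mono hp hδ hz hzξ]

theorem abs_exp_sub_exp_le {x y : ℝ} {M : ℝ} (hx : x ≤ M) (hy : y ≤ M) :
    |Real.exp x - Real.exp y| ≤ Real.exp M * |x - y| := by
  wlog h : y ≤ x generalizing x y
  · rw [abs_sub_comm, abs_sub_comm x]
    exact this hy hx (le_of_not_ge h)
  rw [abs_of_nonneg (sub_nonneg.2 (Real.exp_le_exp.2 h)), abs_of_nonneg (sub_nonneg.2 h)]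
  have h1 : 1 - (x - y) ≤ Real.exp (-(x - y)) := by linarith [Real.add_one_le_exp (-(x - y))]
  have h2 : Real.exp y = Real.exp x * Real.exp (-(x - y)) := by rw [← Real.exp_add]; ring_nf
  have h3 : Real.exp x - Real.exp y ≤ Real.exp x * (x - y) := by
    rw [h2]; nlinarith [Real.exp_pos x]
  exact h3.trans (mul_le_mul_of_nonneg_right (Real.exp_le_exp.2 hx) (sub_nonneg.2 h))

theorem abs_ker_sub_le {δ z ξ : ℝ} {p q : ℝ × ℝ} (hp : Adm δ p) (hq : Adm δ q) (hδ : 0 < δ)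
    (hδ1 : δ ≤ 1) (hz : 0 ≤ z) (hzξ : z ≤ ξ) :
    |ker δ p z ξ - ker δ q z ξ| ≤ kerMaj δ z ξ * (4000 / δ * ‖p - q‖ * (ξ - z)) := by
  rw [ker_eq p hδ hz (hz.trans hzξ), ker_eq q hδ hz (hz.trans hzξ), ← mul_sub, abs_mul]
  have hk := kerMaj_nonneg (z := z) hδ (hz.trans hzξ)
  change |kerMaj δ z ξ| * _ ≤ _
  rw [abs_of_nonneg hk]
  refine mul_le_mul_of_nonneg_left ?_ hk
  have h := abs_exp_sub_exp_le (M := 0)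
    (by linarith [P_mono hp hδ hz hzξ] : P δ p z - P δ p ξ ≤ 0)
    (by linarith [P_mono hq hδ hz hzξ] : P δ q z - P δ q ξ ≤ 0)
  rw [Real.exp_zero, one_mul] at h
  exact h.trans (abs_P_sub_le p q hδ hδ1 hz hzξ)

/-- The size of the kernel. -/
def kerSize (δ : ℝ) : ℝ := Real.exp (Q δ (3 / 5))

theorem kerSize_pos (δ : ℝ) : 0 < kerSize δ := Real.exp_pos _

theorem kerMaj_le_of_exp {δ z ξ B : ℝ} (hδ : 0 < δ) (hδ1 : δ ≤ 1) (hz : 0 ≤ z)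
    (hzξ : z ≤ ξ) (hB : Real.exp (Q δ ξ - Q δ z) ≤ B) :
    kerMaj δ z ξ ≤ 4000 ^ 2 / δ ^ 2 * B * (1 + (ξ - z)) ^ 2 := by
  have hξ := hz.trans hzξ
  have h1 : ξ * den δ ξ ≤ (1 + ξ) ^ 2 := by
    have := den_le hδ1 hξ
    have := (den_pos hδ hξ).le
    nlinarith
  have h2 := den_ge_delta hδ.le hδ1 hz
  have h3 : ξ * den δ ξ / den δ z ^ 2 ≤ 4000 ^ 2 / δ ^ 2 * (1 + (ξ - z)) ^ 2 := by
    calc ξ * den δ ξ / den δ z ^ 2 ≤ (1 + ξ) ^ 2 / (δ * (1 + z) / 4000) ^ 2 := by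
          gcongr
      _ ≤ ((1 + z) * (1 + (ξ - z))) ^ 2 / (δ * (1 + z) / 4000) ^ 2 := by
          gcongr
          nlinarith
      _ = _ := by
          have : 1 + z ≠ 0 := by linarith
          field_simp
  have h4 : 0 ≤ ξ * den δ ξ / den δ z ^ 2 := by
    have := (den_pos hδ hξ).le
    positivity
  unfold kerMaj
  calc _ ≤ (4000 ^ 2 / δ ^ 2 * (1 + (ξ - z)) ^ 2) * B :=
        mul_le_mul h3 hB (Real.exp_pos _).le (by positivity)
    _ = _ := by ring

/-- `Q δ z` is nonnegative and `Q δ ξ` is at most `Q δ (3 / 5)` plus a constant; the prefactor loses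
δ^(-2) through `den δ z`. -/
theorem exists_kerMaj_le : ∃ C : ℝ, 0 < C ∧ ∀ δ z ξ : ℝ, 0 < δ → δ ≤ 1 → 0 ≤ z → z ≤ ξ →
    kerMaj δ z ξ ≤ C / δ ^ 2 * kerSize δ * (1 + (ξ - z)) ^ 2 := by
  refine ⟨4000 ^ 2 * Real.exp 10000, by positivity, fun δ z ξ hδ hδ1 hz hzξ => ?_⟩
  have h : Real.exp (Q δ ξ - Q δ z) ≤ Real.exp 10000 * kerSize δ := by
    unfold kerSize
    rw [← Real.exp_add, Real.exp_le_exp]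
    have h1 := Q_le_add hδ hδ1 (hz.trans hzξ)
    have h2 := Q_mono hδ hδ1 le_rfl hz
    rw [Q_zero] at h2
    linarith
  refine (kerMaj_le_of_exp hδ hδ1 hz hzξ h).trans (le_of_eq ?_)
  ring

/-- If z ≥ 1/2 the difference `Q δ ξ - Q δ z` misses the jump to the left of 1/2; if ξ ≤ 1/2 it
misses the one to the right. Either jump beats any power of δ, including the δ^(-2) of the
prefactor. -/
theorem exists_kerMaj_le_pow (k : ℕ) : ∃ C : ℝ, 0 < C ∧ ∀ δ z ξ : ℝ, 0 < δ → δ ≤ 1 → 0 ≤ z →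
    z ≤ ξ → (1 / 2 ≤ z ∨ ξ ≤ 1 / 2) →
    kerMaj δ z ξ ≤ C * δ ^ k * kerSize δ * (1 + (ξ - z)) ^ 2 := by
  obtain ⟨C, hC, h⟩ := exists_exp_Q_le (k + 2)
  refine ⟨4000 ^ 2 * Real.exp 10000 * C, by positivity, fun δ z ξ hδ hδ1 hz hzξ hor => ?_⟩
  obtain ⟨h1, h2, -⟩ := h δ hδ hδ1
  have h0 := Q_mono hδ hδ1 le_rfl hz
  rw [Q_zero] at h0
  have hQ : Real.exp (Q δ ξ - Q δ z) ≤ Real.exp 10000 * kerSize δ * (C * δ ^ (k + 2)) := by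
    rcases hor with hz2 | hξ2
    · have h3 := Q_le_add hδ hδ1 (hz.trans hzξ)
      have h4 := Q_mono hδ hδ1 (by norm_num) hz2
      calc Real.exp (Q δ ξ - Q δ z)
          ≤ Real.exp (10000 + Q δ (3 / 5) + -Q δ (1 / 2)) := Real.exp_le_exp.2 (by linarith)
        _ = Real.exp 10000 * kerSize δ * Real.exp (-Q δ (1 / 2)) := by
            rw [Real.exp_add, Real.exp_add, kerSize]
        _ ≤ _ := by
            have := kerSize_pos δ
            gcongr
    · have h4 := Q_mono hδ hδ1 (hz.trans hzξ) hξ2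
      calc Real.exp (Q δ ξ - Q δ z)
          ≤ Real.exp (10000 + Q δ (3 / 5) + (Q δ (1 / 2) - Q δ (3 / 5))) :=
            Real.exp_le_exp.2 (by linarith)
        _ = Real.exp 10000 * kerSize δ * Real.exp (Q δ (1 / 2) - Q δ (3 / 5)) := by
            rw [Real.exp_add, Real.exp_add, kerSize]
        _ ≤ _ := by
            have := kerSize_pos δ
            gcongr
  refine (kerMaj_le_of_exp hδ hδ1 hz hzξ hQ).trans (le_of_eq ?_)
  rw [pow_add]
  field_simp

/-- At z = 0 the denominator is 1, so no power of δ is lost. The amplitude bound `exists_gInt_lower`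
needs this sharpness, since its error term must be compared with `kerSize δ` itself. -/
theorem exists_ker_zero_le : ∃ C : ℝ, 0 < C ∧ ∀ (δ ξ : ℝ) (p : ℝ × ℝ), Adm δ p → 0 < δ → δ ≤ 1 →
    0 ≤ ξ → ker δ p 0 ξ ≤ C * kerSize δ * (1 + ξ) ^ 2 := by
  refine ⟨Real.exp 10000, by positivity, fun δ ξ p hp hδ hδ1 hξ => ?_⟩
  refine (ker_le_kerMaj hp hδ le_rfl hξ).trans ?_
  unfold kerMaj
  rw [den_zero, Q_zero, one_pow, div_one, sub_zero]
  have h1 : ξ * den δ ξ ≤ (1 + ξ) ^ 2 := by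
    have := den_le hδ1 hξ
    have := (den_pos hδ hξ).le
    nlinarith
  have h2 : Real.exp (Q δ ξ) ≤ Real.exp 10000 * kerSize δ := by
    unfold kerSize
    rw [← Real.exp_add, Real.exp_le_exp]
    linarith [Q_le_add hδ hδ1 hξ]
  calc _ ≤ (1 + ξ) ^ 2 * (Real.exp 10000 * kerSize δ) :=
        mul_le_mul h1 h2 (Real.exp_pos _).le (by positivity)
    _ = _ := by ring

/-- Just beyond 1/2 the kernel has full size: `Q` has already made its jump, and the couplings cost
at most the factor exp(-160) from `P_le`. -/
theorem exists_le_ker_zero : ∃ c : ℝ, 0 < c ∧ ∀ (δ ξ : ℝ) (p : ℝ × ℝ), Adm δ p → 0 < δ → δ ≤ 1 →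
    3 / 5 ≤ ξ → ξ ≤ 7 / 10 → c * kerSize δ ≤ ker δ p 0 ξ := by
  refine ⟨1 / 8000 * Real.exp (-160), by positivity, fun δ ξ p hp hδ hδ1 hξ hξ2 => ?_⟩
  rw [ker_eq p hδ le_rfl (by linarith), den_zero, Q_zero, P_zero, one_pow, div_one, sub_zero]
  have h1 : 1 / 8000 ≤ ξ * den δ ξ := by
    have := den_ge_lin hδ.le hξ
    nlinarith
  have h2 : kerSize δ ≤ Real.exp (Q δ ξ) := Real.exp_le_exp.2 (Q_mono hδ hδ1 (by norm_num) hξ)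
  have h3 : Real.exp (-160) ≤ Real.exp (0 - P δ p ξ) := Real.exp_le_exp.2 (by
    linarith [P_le hp hδ hδ1 (by linarith : (0:ℝ) ≤ ξ) (by linarith)])
  calc 1 / 8000 * Real.exp (-160) * kerSize δ = 1 / 8000 * kerSize δ * Real.exp (-160) := by ring
    _ ≤ _ := by
      have := (kerSize_pos δ).le
      gcongr

theorem exists_inv_kerSize_le (k : ℕ) : ∃ C : ℝ, 0 < C ∧ ∀ δ : ℝ, 0 < δ → δ ≤ 1 →
    1 / kerSize δ ≤ C * δ ^ k := by
  obtain ⟨C, hC, h⟩ := exists_exp_Q_le k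
  refine ⟨C, hC, fun δ hδ hδ1 => ?_⟩
  rw [kerSize, one_div, ← Real.exp_neg]
  exact (h δ hδ hδ1).2.2

theorem exists_psiRaw_le : ∃ C : ℝ, 0 < C ∧ ∀ (δ z : ℝ) (p : ℝ × ℝ), Adm δ p → 0 < δ → δ ≤ 1 →
    0 ≤ z → z ≤ 1 → psiRaw δ p.1 p.2 z ≤ C / δ ^ 2 := by
  refine ⟨4000 ^ 2 * Real.exp 160, by positivity, fun δ z p hp hδ hδ1 hz hz1 => ?_⟩
  rw [psiRaw_eq p hδ hz]
  have h1 : (den δ z ^ 2)⁻¹ ≤ 4000 ^ 2 / δ ^ 2 := by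
    have h2 : δ / 4000 ≤ den δ z := le_trans (by nlinarith) (den_ge_delta hδ.le hδ1 hz)
    calc (den δ z ^ 2)⁻¹ ≤ ((δ / 4000) ^ 2)⁻¹ := by gcongr
      _ = _ := by rw [div_pow, inv_div]
  have h2 : Real.exp (-Q δ z) ≤ 1 := Real.exp_le_one_iff.2 (by
    have := Q_mono hδ hδ1 le_rfl hz
    rw [Q_zero] at this; linarith)
  have h3 : Real.exp (P δ p z) ≤ Real.exp 160 := Real.exp_le_exp.2 (P_le hp hδ hδ1 hz hz1)
  calc _ ≤ 4000 ^ 2 / δ ^ 2 * 1 * Real.exp 160 := by gcongr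
    _ = _ := by ring

theorem exists_psiRaw_sub_le : ∃ C : ℝ, 0 < C ∧ ∀ (δ z : ℝ) (p q : ℝ × ℝ), Adm δ p → Adm δ q →
    0 < δ → δ ≤ 1 → 0 ≤ z → z ≤ 1 →
    |psiRaw δ p.1 p.2 z - psiRaw δ q.1 q.2 z| ≤ C / δ ^ 3 * ‖p - q‖ := by
  refine ⟨4000 ^ 2 * Real.exp 160 * 4000, by positivity, fun δ z p q hp hq hδ hδ1 hz hz1 => ?_⟩
  rw [psiRaw_eq p hδ hz, psiRaw_eq q hδ hz, ← mul_sub, abs_mul]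
  have h1 : (den δ z ^ 2)⁻¹ ≤ 4000 ^ 2 / δ ^ 2 := by
    have h2 : δ / 4000 ≤ den δ z := le_trans (by nlinarith) (den_ge_delta hδ.le hδ1 hz)
    calc (den δ z ^ 2)⁻¹ ≤ ((δ / 4000) ^ 2)⁻¹ := by gcongr
      _ = _ := by rw [div_pow, inv_div]
  have h2 : Real.exp (-Q δ z) ≤ 1 := Real.exp_le_one_iff.2 (by
    have := Q_mono hδ hδ1 le_rfl hz
    rw [Q_zero] at this; linarith)
  have h3 : |(den δ z ^ 2)⁻¹ * Real.exp (-Q δ z)| ≤ 4000 ^ 2 / δ ^ 2 * 1 := by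
    rw [abs_of_nonneg (by positivity)]
    gcongr
  have h4 := abs_exp_sub_exp_le (P_le hp hδ hδ1 hz hz1) (P_le hq hδ hδ1 hz hz1)
  have h5 := abs_P_sub_le p q hδ hδ1 le_rfl hz
  rw [P_zero, P_zero, show (0 - P δ p z) - (0 - P δ q z) = -(P δ p z - P δ q z) by ring, abs_neg,
    sub_zero] at h5
  have h6 : |P δ p z - P δ q z| ≤ 4000 / δ * ‖p - q‖ * 1 := h5.trans (by gcongr)
  calc _ ≤ 4000 ^ 2 / δ ^ 2 * 1 * (Real.exp 160 * (4000 / δ * ‖p - q‖ * 1)) := by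
        refine mul_le_mul h3 (h4.trans ?_) (abs_nonneg _) (by positivity)
        gcongr
    _ = _ := by field_simp

/-! ### Integration against the kernel and splitting at 1/2. -/

/-- Bounds for integrals of weighted functions against kernels of polynomial growth. -/
theorem exists_kernel_bound {β₁ β₂ : ℝ} (hβ₁ : 0 < β₁) (hβ₂ : 0 ≤ β₂) :
    ∃ C : ℝ, 0 < C ∧ ∀ (z M D H X : ℝ) (K K' h h' : ℝ → ℝ), 0 ≤ z → 0 ≤ D → 0 ≤ X →
      MemW β₁ β₂ H h → MemW β₁ β₂ H h' → (∀ ξ, 0 ≤ ξ → |h ξ - h' ξ| ≤ X * wt β₁ β₂ ξ) →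
      AEStronglyMeasurable K (volume.restrict (Ioi z)) →
      AEStronglyMeasurable K' (volume.restrict (Ioi z)) →
      (∀ ξ, z < ξ → |K ξ| ≤ M * (1 + (ξ - z)) ^ 2) →
      (∀ ξ, z < ξ → |K' ξ| ≤ M * (1 + (ξ - z)) ^ 2) →
      (∀ ξ, z < ξ → |K ξ - K' ξ| ≤ M * (1 + (ξ - z)) ^ 2 * (D * (ξ - z))) →
      IntegrableOn (fun ξ => K ξ * h ξ) (Ioi z) ∧
      |∫ ξ in Ioi z, K ξ * h ξ| ≤ C * M * H * wt β₁ β₂ z ∧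
      |(∫ ξ in Ioi z, K ξ * h ξ) - ∫ ξ in Ioi z, K' ξ * h' ξ|
        ≤ C * M * (D * H + X) * wt β₁ β₂ z := by
  -- Exponent 3: two powers from the kernel and one from the factor ξ - z in its Lipschitz bound.
  obtain ⟨C, hC, hb⟩ := exists_tail_bound hβ₁ hβ₂ 3
  refine ⟨C, hC, fun z M D H X K K' h h' hz hD hX hh hh' hd hK hK' hKb hKb' hKd => ?_⟩
  have hH := hh.nonneg
  have hM : 0 ≤ M := by
    have := (abs_nonneg _).trans (hKb (z + 1) (by linarith))
    exact nonneg_of_mul_nonneg_left this (by rw [add_sub_cancel_left]; norm_num)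
  have key : ∀ (L : ℝ → ℝ) (k : ℝ → ℝ), MemW β₁ β₂ H k →
      AEStronglyMeasurable L (volume.restrict (Ioi z)) →
      (∀ ξ, z < ξ → |L ξ| ≤ M * (1 + (ξ - z)) ^ 2) →
      IntegrableOn (fun ξ => L ξ * k ξ) (Ioi z) ∧
      |∫ ξ in Ioi z, L ξ * k ξ| ≤ C * (M * H) * wt β₁ β₂ z := by
    intro L k hk hL hLb
    refine hb z (M * H) _ hz (by positivity) (hL.mul (hk.aestronglyMeasurable_Ioi hz))
      fun ξ hξ => ?_
    have hu : 0 ≤ ξ - z := by linarith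
    have hw := (wt_pos β₁ β₂ (hz.trans hξ.le)).le
    rw [abs_mul]
    calc |L ξ| * |k ξ| ≤ (M * (1 + (ξ - z)) ^ 2) * (H * wt β₁ β₂ ξ) :=
          mul_le_mul (hLb ξ hξ) (hk.bound ξ (hz.trans hξ.le)) (abs_nonneg _) (by positivity)
      _ ≤ (M * (1 + (ξ - z)) ^ 3) * (H * wt β₁ β₂ ξ) := by
          gcongr
          · linarith
          · norm_num
      _ = _ := by ring
  obtain ⟨i1, b1⟩ := key K h hh hK hKb
  obtain ⟨i2, -⟩ := key K' h' hh' hK' hKb'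
  refine ⟨i1, b1.trans (le_of_eq (by ring)), ?_⟩
  rw [← integral_sub i1 i2]
  refine (hb z (M * (D * H + X)) _ hz (by positivity) (i1.sub i2).aestronglyMeasurable
    fun ξ hξ => ?_).2.trans (le_of_eq (by ring))
  have hu : 0 ≤ ξ - z := by linarith
  have hξ0 := hz.trans hξ.le
  have hw := (wt_pos β₁ β₂ hξ0).le
  have e : K ξ * h ξ - K' ξ * h' ξ = K ξ * (h ξ - h' ξ) + (K ξ - K' ξ) * h' ξ := by ring
  simp only [Pi.sub_apply]
  rw [e]
  refine (abs_add_le _ _).trans ?_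
  rw [abs_mul, abs_mul]
  have t1 : |K ξ| * |h ξ - h' ξ| ≤ (M * (1 + (ξ - z)) ^ 2) * (X * wt β₁ β₂ ξ) :=
    mul_le_mul (hKb ξ hξ) (hd ξ hξ0) (abs_nonneg _) (by positivity)
  have t2 : |K ξ - K' ξ| * |h' ξ| ≤ (M * (1 + (ξ - z)) ^ 2 * (D * (ξ - z))) * (H * wt β₁ β₂ ξ) :=
    mul_le_mul (hKd ξ hξ) (hh'.bound ξ hξ0) (abs_nonneg _) (by positivity)
  refine (add_le_add t1 t2).trans ?_
  have : M * (D * H + X) * (1 + (ξ - z)) ^ 3 * wt β₁ β₂ ξ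
      = (M * (1 + (ξ - z)) ^ 2) * (X * wt β₁ β₂ ξ) +
        (M * (1 + (ξ - z)) ^ 2 * (D * (ξ - z))) * (H * wt β₁ β₂ ξ) +
        M * (1 + (ξ - z)) ^ 2 * wt β₁ β₂ ξ * (X * (ξ - z) + D * H) := by ring
  rw [this]
  have : 0 ≤ M * (1 + (ξ - z)) ^ 2 * wt β₁ β₂ ξ * (X * (ξ - z) + D * H) := by positivity
  linarith

/-- The integral in the definition of `varConst`. -/
def jInt (δ : ℝ) (p : ℝ × ℝ) (h : ℝ → ℝ) (z : ℝ) : ℝ := ∫ ξ in Ioi z, ker δ p z ξ * h ξ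

theorem varConst_eq (δ : ℝ) (p : ℝ × ℝ) (h : ℝ → ℝ) (z : ℝ) :
    varConst δ p.1 p.2 h z = p.1 * jInt δ p h z := rfl

/-- The kernel beyond the near-singularity. -/
def kerG (δ : ℝ) (p : ℝ × ℝ) : ℝ → ℝ := indicator (Ioi (1 / 2)) (ker δ p 0)

/-- The kernel without the part that crosses the near-singularity. -/
def kerR (δ : ℝ) (p : ℝ × ℝ) (z : ℝ) : ℝ → ℝ :=
  indicator (if z < 1 / 2 then Iic (1 / 2) else univ) (ker δ p z)

/-- The amplitude of the solution on `[0, 1/2)`. -/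
def gInt (δ : ℝ) (p : ℝ × ℝ) (h : ℝ → ℝ) : ℝ := ∫ ξ in Ioi 0, kerG δ p ξ * h ξ

/-- The remainder of the solution. -/
def rInt (δ : ℝ) (p : ℝ × ℝ) (h : ℝ → ℝ) (z : ℝ) : ℝ := ∫ ξ in Ioi z, kerR δ p z ξ * h ξ

/-- The leading order profile. -/
def lead (δ : ℝ) (p : ℝ × ℝ) (z : ℝ) : ℝ := if z < 1 / 2 then psiRaw δ p.1 p.2 z else 0

theorem measurableSet_region (z : ℝ) :
    MeasurableSet (if z < 1 / 2 then Iic (1 / 2 : ℝ) else univ) := by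
  split_ifs
  · exact measurableSet_Iic
  · exact MeasurableSet.univ

theorem abs_indicator_le {S : Set ℝ} {f : ℝ → ℝ} {ξ B : ℝ} (hB : 0 ≤ B) (h : ξ ∈ S → |f ξ| ≤ B) :
    |indicator S f ξ| ≤ B := by
  by_cases hs : ξ ∈ S
  · rw [indicator_of_mem hs]; exact h hs
  · rw [indicator_of_notMem hs, abs_zero]; exact hB

section Bounds

variable {β₁ β₂ : ℝ}

theorem abs_kernel_sub_indicator_le {S : Set ℝ} {f g : ℝ → ℝ} {ξ B : ℝ} (hB : 0 ≤ B)
    (h : ξ ∈ S → |f ξ - g ξ| ≤ B) : |indicator S f ξ - indicator S g ξ| ≤ B := by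
  by_cases hs : ξ ∈ S
  · rw [indicator_of_mem hs, indicator_of_mem hs]; exact h hs
  · rw [indicator_of_notMem hs, indicator_of_notMem hs, sub_zero, abs_zero]; exact hB

/-- Bounds for kernels restricted to a region on which the majorant is controlled. -/
theorem exists_region_bound (hβ₁ : 0 < β₁) (hβ₂ : 0 ≤ β₂) :
    ∃ C : ℝ, 0 < C ∧ ∀ (δ z M H X : ℝ) (p q : ℝ × ℝ) (S : Set ℝ) (h h' : ℝ → ℝ),
      0 < δ → δ ≤ 1 → 0 ≤ z → 0 ≤ M → 0 ≤ X → Adm δ p → Adm δ q → MeasurableSet S →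
      MemW β₁ β₂ H h → MemW β₁ β₂ H h' → (∀ ξ, 0 ≤ ξ → |h ξ - h' ξ| ≤ X * wt β₁ β₂ ξ) →
      (∀ ξ, z < ξ → ξ ∈ S → kerMaj δ z ξ ≤ M * (1 + (ξ - z)) ^ 2) →
      IntegrableOn (fun ξ => indicator S (ker δ p z) ξ * h ξ) (Ioi z) ∧
      |∫ ξ in Ioi z, indicator S (ker δ p z) ξ * h ξ| ≤ C * M * H * wt β₁ β₂ z ∧
      |(∫ ξ in Ioi z, indicator S (ker δ p z) ξ * h ξ)
          - ∫ ξ in Ioi z, indicator S (ker δ q z) ξ * h' ξ|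
        ≤ C * M * (‖p - q‖ / δ * H + X) * wt β₁ β₂ z := by
  obtain ⟨C, hC, hb⟩ := exists_kernel_bound hβ₁ hβ₂
  refine ⟨C * 4000, by positivity, fun δ z M H X p q S h h' hδ hδ1 hz hM hX hp hq hS hh hh' hd hk
    => ?_⟩
  have hbd : ∀ p, Adm δ p → ∀ ξ, z < ξ →
      |indicator S (ker δ p z) ξ| ≤ M * (1 + (ξ - z)) ^ 2 := fun p hp ξ hξ => by
    refine abs_indicator_le (by positivity) fun hs => ?_
    rw [abs_of_nonneg (ker_nonneg p hδ (hz.trans hξ.le))]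
    exact (ker_le_kerMaj hp hδ hz hξ.le).trans (hk ξ hξ hs)
  obtain ⟨h1, h2, h3⟩ := hb z M (4000 / δ * ‖p - q‖) H X _ _ h h' hz (by positivity) hX hh hh' hd
    ((aestronglyMeasurable_ker (z := z) p hδ hz).indicator hS)
    ((aestronglyMeasurable_ker (z := z) q hδ hz).indicator hS) (hbd p hp) (hbd q hq)
    (fun ξ hξ => by
      have : 0 ≤ ξ - z := by linarith
      refine abs_kernel_sub_indicator_le (by positivity) fun hs => ?_
      refine (abs_ker_sub_le hp hq hδ hδ1 hz hξ.le).trans ?_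
      exact mul_le_mul_of_nonneg_right (hk ξ hξ hs) (by positivity))
  have hw := (wt_pos β₁ β₂ hz).le
  have hH := hh.nonneg
  refine ⟨h1, h2.trans ?_, h3.trans ?_⟩
  · have : 0 ≤ C * M * H * wt β₁ β₂ z := by positivity
    linarith
  · have : 0 ≤ C * M * X * wt β₁ β₂ z := by positivity
    have e : C * 4000 * M * (‖p - q‖ / δ * H + X) * wt β₁ β₂ z
      = C * M * (4000 / δ * ‖p - q‖ * H + X) * wt β₁ β₂ z
        + 3999 * (C * M * X * wt β₁ β₂ z) := by ring
    linarith

/-- `kerR` is supported where z and ξ lie on the same side of 1/2, so `exists_kerMaj_le_pow`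
applies. -/
theorem exists_rInt_bound (hβ₁ : 0 < β₁) (hβ₂ : 0 ≤ β₂) (k : ℕ) :
    ∃ C : ℝ, 0 < C ∧ ∀ (δ z H X : ℝ) (p q : ℝ × ℝ) (h h' : ℝ → ℝ),
      0 < δ → δ ≤ 1 → 0 ≤ z → 0 ≤ X → Adm δ p → Adm δ q →
      MemW β₁ β₂ H h → MemW β₁ β₂ H h' → (∀ ξ, 0 ≤ ξ → |h ξ - h' ξ| ≤ X * wt β₁ β₂ ξ) →
      IntegrableOn (fun ξ => kerR δ p z ξ * h ξ) (Ioi z) ∧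
      |rInt δ p h z| ≤ C * δ ^ k * kerSize δ * H * wt β₁ β₂ z ∧
      |rInt δ p h z - rInt δ q h' z|
        ≤ C * δ ^ k * kerSize δ * (‖p - q‖ / δ * H + X) * wt β₁ β₂ z := by
  obtain ⟨C, hC, hb⟩ := exists_region_bound hβ₁ hβ₂
  obtain ⟨C', hC', hk⟩ := exists_kerMaj_le_pow k
  refine ⟨C * C', by positivity, fun δ z H X p q h h' hδ hδ1 hz hX hp hq hh hh' hd => ?_⟩
  have hN := kerSize_pos δ
  obtain ⟨h1, h2, h3⟩ := hb δ z (C' * δ ^ k * kerSize δ) H X p q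
    (if z < 1 / 2 then Iic (1 / 2) else univ) h h' hδ hδ1 hz (by positivity) hX hp hq
    (measurableSet_region z) hh hh' hd (fun ξ hξ hs => by
      refine hk δ z ξ hδ hδ1 hz hξ.le ?_
      split_ifs at hs with hlt
      · exact Or.inr hs
      · exact Or.inl (not_lt.1 hlt))
  exact ⟨h1, h2.trans (le_of_eq (by ring)), h3.trans (le_of_eq (by ring))⟩

theorem exists_gInt_bound (hβ₁ : 0 < β₁) (hβ₂ : 0 ≤ β₂) :
    ∃ C : ℝ, 0 < C ∧ ∀ (δ H X : ℝ) (p q : ℝ × ℝ) (h h' : ℝ → ℝ),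
      0 < δ → δ ≤ 1 → 0 ≤ X → Adm δ p → Adm δ q →
      MemW β₁ β₂ H h → MemW β₁ β₂ H h' → (∀ ξ, 0 ≤ ξ → |h ξ - h' ξ| ≤ X * wt β₁ β₂ ξ) →
      IntegrableOn (fun ξ => kerG δ p ξ * h ξ) (Ioi 0) ∧
      |gInt δ p h - gInt δ q h'| ≤ C / δ ^ 2 * kerSize δ * (‖p - q‖ / δ * H + X) := by
  obtain ⟨C, hC, hb⟩ := exists_region_bound hβ₁ hβ₂
  obtain ⟨C', hC', hk⟩ := exists_kerMaj_le
  refine ⟨C * C', by positivity, fun δ H X p q h h' hδ hδ1 hX hp hq hh hh' hd => ?_⟩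
  have hN := kerSize_pos δ
  obtain ⟨h1, -, h3⟩ := hb δ 0 (C' / δ ^ 2 * kerSize δ) H X p q (Ioi (1 / 2)) h h' hδ hδ1 le_rfl
    (by positivity) hX hp hq measurableSet_Ioi hh hh' hd
    (fun ξ hξ _ => hk δ 0 ξ hδ hδ1 le_rfl hξ.le)
  refine ⟨h1, h3.trans ?_⟩
  have hH := hh.nonneg
  refine (mul_le_of_le_one_right (by positivity) (wt_le_one hβ₁.le hβ₂ le_rfl)).trans
    (le_of_eq (by ring))

theorem integrableOn_ker_mul (hβ₁ : 0 < β₁) (hβ₂ : 0 ≤ β₂) {δ z H : ℝ} {p : ℝ × ℝ} {h : ℝ → ℝ}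
    (hδ : 0 < δ) (hδ1 : δ ≤ 1) (hz : 0 ≤ z) (hp : Adm δ p) (hh : MemW β₁ β₂ H h) :
    IntegrableOn (fun ξ => ker δ p z ξ * h ξ) (Ioi z) := by
  obtain ⟨C, hC, hb⟩ := exists_region_bound hβ₁ hβ₂
  obtain ⟨C', hC', hk⟩ := exists_kerMaj_le
  have hN := kerSize_pos δ
  have := (hb δ z (C' / δ ^ 2 * kerSize δ) H 0 p p univ h h hδ hδ1 hz (by positivity) le_rfl hp hp
    MeasurableSet.univ hh hh (fun ξ _ => by simp) (fun ξ hξ _ => hk δ z ξ hδ hδ1 hz hξ.le)).1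
  simpa using this

/-- For z < 1/2 split the integral at 1/2; beyond 1/2 the kernel is `psiRaw` at z times the kernel
from 0, which produces `gInt`. For z ≥ 1/2 nothing crosses, `lead` vanishes, and all of the integral
is remainder. -/
theorem jInt_eq_add (hβ₁ : 0 < β₁) (hβ₂ : 0 ≤ β₂) {δ z H : ℝ} {p : ℝ × ℝ} {h : ℝ → ℝ}
    (hδ : 0 < δ) (hδ1 : δ ≤ 1) (hz : 0 ≤ z) (hp : Adm δ p) (hh : MemW β₁ β₂ H h) :
    jInt δ p h z = gInt δ p h * lead δ p z + rInt δ p h z := by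
  unfold jInt gInt rInt lead kerR
  by_cases hlt : z < 1 / 2
  · simp only [if_pos hlt]
    have hi := integrableOn_ker_mul hβ₁ hβ₂ hδ hδ1 hz hp hh
    have e1 : ∫ ξ in Ioi z, ker δ p z ξ * h ξ
        = (∫ ξ in Ioc z (1 / 2), ker δ p z ξ * h ξ) + ∫ ξ in Ioi (1 / 2), ker δ p z ξ * h ξ := by
      rw [← setIntegral_union (Ioc_disjoint_Ioi le_rfl) measurableSet_Ioi
        (hi.mono_set Ioc_subset_Ioi_self) (hi.mono_set (Ioi_subset_Ioi hlt.le)),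
        Ioc_union_Ioi_eq_Ioi hlt.le]
    have e2 : ∫ ξ in Ioi z, indicator (Iic (1 / 2)) (ker δ p z) ξ * h ξ
        = ∫ ξ in Ioc z (1 / 2), ker δ p z ξ * h ξ := by
      have : ∀ ξ, indicator (Iic (1 / 2)) (ker δ p z) ξ * h ξ
          = indicator (Iic (1 / 2)) (fun ξ => ker δ p z ξ * h ξ) ξ := fun ξ => by
        rw [indicator_mul_left]
      simp_rw [this]
      rw [setIntegral_indicator measurableSet_Iic]
      rfl
    have e3 : ∫ ξ in Ioi 0, kerG δ p ξ * h ξ = ∫ ξ in Ioi (1 / 2), ker δ p 0 ξ * h ξ := by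
      have : ∀ ξ, kerG δ p ξ * h ξ
          = indicator (Ioi (1 / 2)) (fun ξ => ker δ p 0 ξ * h ξ) ξ := fun ξ => by
        rw [indicator_mul_left]; rfl
      simp_rw [this]
      rw [setIntegral_indicator measurableSet_Ioi,
        inter_eq_self_of_subset_right (Ioi_subset_Ioi (by norm_num))]
    rw [e1, e2, e3, add_comm, mul_comm, ← integral_const_mul]
    congr 2
    ext ξ
    rw [ker_factor p hδ z ξ]
    ring
  · simp only [if_neg hlt, indicator_univ, mul_zero, zero_add]

theorem jInt_eq_mul {δ : ℝ} (hδ : 0 < δ) (p : ℝ × ℝ) (h : ℝ → ℝ) (z : ℝ) :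
    jInt δ p h z = psiRaw δ p.1 p.2 z * ∫ ξ in Ioi z, ker δ p 0 ξ * h ξ := by
  unfold jInt
  rw [← integral_const_mul]
  congr 1
  ext ξ
  rw [ker_factor p hδ z ξ]
  ring

/-- By rank one, `jInt` is `psiRaw` times a constant minus a primitive. -/
theorem continuousOn_jInt (hβ₁ : 0 < β₁) (hβ₂ : 0 ≤ β₂) {δ H : ℝ} {p : ℝ × ℝ} {h : ℝ → ℝ}
    (hδ : 0 < δ) (hδ1 : δ ≤ 1) (hp : Adm δ p) (hh : MemW β₁ β₂ H h) :
    ContinuousOn (jInt δ p h) (Ici 0) := by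
  have hi := integrableOn_ker_mul hβ₁ hβ₂ hδ hδ1 le_rfl hp hh
  have hprim : ContinuousOn (fun z => ∫ ξ in (0:ℝ)..z, ker δ p 0 ξ * h ξ) (Ici 0) := by
    refine continuousOn_primitive_Ici fun z hz => ?_
    rw [intervalIntegrable_iff_integrableOn_Ioc_of_le hz]
    exact hi.mono_set Ioc_subset_Ioi_self
  refine ((continuousOn_psiRaw p hδ).mul ((continuousOn_const
    (c := ∫ ξ in Ioi 0, ker δ p 0 ξ * h ξ)).sub hprim)).congr fun z hz => ?_
  rw [jInt_eq_mul hδ]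
  have hz0 : (0:ℝ) ≤ z := hz
  have := intervalIntegral.integral_interval_add_Ioi (a := 0) (b := z) hi
    (hi.mono_set (Ioi_subset_Ioi hz0))
  simp only [Pi.mul_apply, Pi.sub_apply]
  rw [← this]
  ring

end Bounds

/-! ### The solution divided by its amplitude. -/

theorem abs_div_sub_div_le {a a' g g' m : ℝ} (hm : 0 < m) (hg : m ≤ g) (hg' : m ≤ g') :
    |a / g - a' / g'| ≤ |a - a'| / m + |a'| * |g - g'| / m ^ 2 := by
  have h1 : 0 < g := hm.trans_le hg
  have h2 : 0 < g' := hm.trans_le hg'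
  have e : a / g - a' / g' = (a - a') / g - a' * (g - g') / (g * g') := by
    field_simp
    ring
  rw [e]
  refine (abs_sub _ _).trans ?_
  rw [abs_div, abs_div, abs_mul, abs_of_pos h1, abs_of_pos (mul_pos h1 h2), sq]
  gcongr

theorem abs_div_le_div {a g m B : ℝ} (hm : 0 < m) (hg : m ≤ g) (hB : |a| ≤ B) :
    |a / g| ≤ B / m := by
  rw [abs_div, abs_of_pos (hm.trans_le hg)]
  have : 0 ≤ B := (abs_nonneg _).trans hB
  gcongr

/-- Sources for which the amplitude is bounded below. -/
structure GoodH (β₁ β₂ H c δ : ℝ) (h : ℝ → ℝ) : Prop where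
  memW : MemW β₁ β₂ H h
  lower : ∀ p, Adm δ p → c * kerSize δ ≤ gInt δ p h

/-- The solution normalised by its amplitude. -/
def uFun (δ : ℝ) (p : ℝ × ℝ) (h : ℝ → ℝ) (z : ℝ) : ℝ := jInt δ p h z / gInt δ p h

theorem exists_abs_lead_le {β₁ β₂ : ℝ} (hβ₁ : 0 ≤ β₁) (hβ₂ : 0 ≤ β₂) : ∃ C : ℝ, 0 < C ∧
    ∀ (δ z : ℝ) (p q : ℝ × ℝ), Adm δ p → Adm δ q → 0 < δ → δ ≤ 1 → 0 ≤ z →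
    |lead δ p z| ≤ C / δ ^ 2 * wt β₁ β₂ z ∧
    |lead δ p z - lead δ q z| ≤ C / δ ^ 3 * ‖p - q‖ * wt β₁ β₂ z := by
  obtain ⟨C₁, hC₁, h₁⟩ := exists_psiRaw_le
  obtain ⟨C₂, hC₂, h₂⟩ := exists_psiRaw_sub_le
  have hw0 := wt_pos β₁ β₂ (by norm_num : (0:ℝ) ≤ 1 / 2)
  refine ⟨(C₁ + C₂) / wt β₁ β₂ (1 / 2), by positivity, fun δ z p q hp hq hδ hδ1 hz => ?_⟩
  have hwz := (wt_pos β₁ β₂ hz).le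
  unfold lead
  split_ifs with hlt
  · have hw : 1 ≤ wt β₁ β₂ z / wt β₁ β₂ (1 / 2) := by
      rw [one_le_div hw0]; exact wt_anti hβ₁ hβ₂ hz hlt.le
    constructor
    · rw [abs_of_pos (psiRaw_pos _ _ _ _)]
      calc psiRaw δ p.1 p.2 z ≤ C₁ / δ ^ 2 := h₁ δ z p hp hδ hδ1 hz (by linarith)
        _ ≤ (C₁ + C₂) / δ ^ 2 := by gcongr; linarith
        _ ≤ (C₁ + C₂) / δ ^ 2 * (wt β₁ β₂ z / wt β₁ β₂ (1 / 2)) :=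
            le_mul_of_one_le_right (by positivity) hw
        _ = _ := by ring
    · calc _ ≤ C₂ / δ ^ 3 * ‖p - q‖ := h₂ δ z p q hp hq hδ hδ1 hz (by linarith)
        _ ≤ (C₁ + C₂) / δ ^ 3 * ‖p - q‖ := by gcongr; linarith
        _ ≤ (C₁ + C₂) / δ ^ 3 * ‖p - q‖ * (wt β₁ β₂ z / wt β₁ β₂ (1 / 2)) :=
            le_mul_of_one_le_right (by positivity) hw
        _ = _ := by ring
  · simp only [abs_zero, sub_zero]
    exact ⟨by positivity, by positivity⟩

/-- The quotient is `lead + rInt / gInt`, with `gInt` of order at least `kerSize δ` and `rInt` at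
most δ^k `kerSize δ`. The leading term does not see the source at all, hence the factor δ^k in front
of X; the couplings enter through `lead`, at the price δ^(-3). -/
theorem exists_uFun_bound {β₁ β₂ H c : ℝ} (hβ₁ : 0 < β₁) (hβ₂ : 0 ≤ β₂) (hH : 0 ≤ H) (hc : 0 < c)
    (k : ℕ) : ∃ C : ℝ, 0 < C ∧ ∀ (δ z X : ℝ) (p q : ℝ × ℝ) (h h' : ℝ → ℝ), 0 < δ → δ ≤ 1 →
      0 ≤ z → 0 ≤ X → Adm δ p → Adm δ q → GoodH β₁ β₂ H c δ h → GoodH β₁ β₂ H c δ h' →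
      (∀ ξ, 0 ≤ ξ → |h ξ - h' ξ| ≤ X * wt β₁ β₂ ξ) →
      |uFun δ p h z - lead δ p z| ≤ C * δ ^ k * wt β₁ β₂ z ∧
      |uFun δ p h z| ≤ C / δ ^ 2 * wt β₁ β₂ z ∧
      |uFun δ p h z - uFun δ q h' z| ≤ C * (‖p - q‖ / δ ^ 3 + δ ^ k * X) * wt β₁ β₂ z := by
  obtain ⟨Cl, hCl, hl⟩ := exists_abs_lead_le (β₁ := β₁) (β₂ := β₂) hβ₁.le hβ₂
  -- Two extra powers of δ pay for the δ^(-2) in the variation of `gInt`.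
  obtain ⟨Cr, hCr, hr⟩ := exists_rInt_bound (β₁ := β₁) (β₂ := β₂) hβ₁ hβ₂ (k + 2)
  obtain ⟨Cg, hCg, hg⟩ := exists_gInt_bound (β₁ := β₁) (β₂ := β₂) hβ₁ hβ₂
  set A : ℝ := Cr * H / c with hA
  set B : ℝ := (Cr / c + Cr * H * Cg / c ^ 2) * (H + 1) with hB
  have hA0 : 0 ≤ A := by positivity
  have hB0 : 0 ≤ B := by positivity
  refine ⟨A + B + Cl, by positivity, fun δ z X p q h h' hδ hδ1 hz hX hp hq hh hh' hd => ?_⟩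
  have hN := kerSize_pos δ
  have hw := (wt_pos β₁ β₂ hz).le
  have hm : 0 < c * kerSize δ := by positivity
  have g1 := hh.lower p hp
  have g2 := hh'.lower q hq
  have hΔ := norm_nonneg (p - q)
  obtain ⟨-, r1, r2⟩ := hr δ z H X p q h h' hδ hδ1 hz hX hp hq hh.memW hh'.memW hd
  have r3 := (hr δ z H 0 q q h' h' hδ hδ1 hz le_rfl hq hq hh'.memW hh'.memW (by simp)).2.1
  have g3 := (hg δ H X p q h h' hδ hδ1 hX hp hq hh.memW hh'.memW hd).2
  obtain ⟨l1, l2⟩ := hl δ z p q hp hq hδ hδ1 hz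
  have hδk : δ ^ (k + 2) ≤ δ ^ k := pow_le_pow_of_le_one hδ.le hδ1 (by omega)
  have hδk1 : δ ^ k ≤ 1 := pow_le_one₀ hδ.le hδ1
  have hu : ∀ (p) (h : ℝ → ℝ), Adm δ p → GoodH β₁ β₂ H c δ h →
      uFun δ p h z = lead δ p z + rInt δ p h z / gInt δ p h := fun p h hp hh => by
    have : gInt δ p h ≠ 0 := (hm.trans_le (hh.lower p hp)).ne'
    unfold uFun
    rw [jInt_eq_add hβ₁ hβ₂ hδ hδ1 hz hp hh.memW]
    field_simp
  have f1 : |rInt δ p h z / gInt δ p h| ≤ A * δ ^ k * wt β₁ β₂ z := by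
    refine (abs_div_le_div hm g1 r1).trans ?_
    calc _ = A * δ ^ (k + 2) * wt β₁ β₂ z := by rw [hA]; field_simp
      _ ≤ _ := by gcongr
  have f2 : |rInt δ p h z / gInt δ p h - rInt δ q h' z / gInt δ q h'|
      ≤ B * (δ ^ k * (‖p - q‖ / δ + X)) * wt β₁ β₂ z := by
    refine (abs_div_sub_div_le hm g1 g2).trans ?_
    have t0 : ‖p - q‖ / δ * H + X ≤ (H + 1) * (‖p - q‖ / δ + X) := by
      have : 0 ≤ ‖p - q‖ / δ := by positivity
      nlinarith
    have t1 : |rInt δ p h z - rInt δ q h' z| / (c * kerSize δ)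
        ≤ Cr / c * (δ ^ k * ((H + 1) * (‖p - q‖ / δ + X))) * wt β₁ β₂ z := by
      calc _ ≤ (Cr * δ ^ (k + 2) * kerSize δ * (‖p - q‖ / δ * H + X) * wt β₁ β₂ z)
            / (c * kerSize δ) := by gcongr
        _ = Cr / c * (δ ^ (k + 2) * (‖p - q‖ / δ * H + X)) * wt β₁ β₂ z := by field_simp
        _ ≤ _ := by gcongr
    have t2 : |rInt δ q h' z| * |gInt δ p h - gInt δ q h'| / (c * kerSize δ) ^ 2
        ≤ Cr * H * Cg / c ^ 2 * (δ ^ k * ((H + 1) * (‖p - q‖ / δ + X))) * wt β₁ β₂ z := by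
      calc _ ≤ (Cr * δ ^ (k + 2) * kerSize δ * H * wt β₁ β₂ z) *
            (Cg / δ ^ 2 * kerSize δ * (‖p - q‖ / δ * H + X)) / (c * kerSize δ) ^ 2 := by gcongr
        _ = Cr * H * Cg / c ^ 2 * (δ ^ k * (‖p - q‖ / δ * H + X)) * wt β₁ β₂ z := by
            rw [pow_add]; field_simp
        _ ≤ _ := by gcongr
    refine (add_le_add t1 t2).trans (le_of_eq ?_)
    rw [hB]; ring
  rw [hu p h hp hh, hu q h' hq hh']
  refine ⟨?_, ?_, ?_⟩
  · rw [add_sub_cancel_left]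
    refine f1.trans ?_
    gcongr
    linarith
  · refine (abs_add_le _ _).trans ((add_le_add l1 f1).trans ?_)
    have : A * δ ^ k * wt β₁ β₂ z ≤ A / δ ^ 2 * wt β₁ β₂ z := by
      gcongr
      rw [le_div_iff₀ (by positivity)]
      have : δ ^ k * δ ^ 2 ≤ 1 := mul_le_one₀ hδk1 (by positivity) (pow_le_one₀ hδ.le hδ1)
      nlinarith
    have : 0 ≤ B / δ ^ 2 * wt β₁ β₂ z := by positivity
    have e : (A + B + Cl) / δ ^ 2 * wt β₁ β₂ z
      = A / δ ^ 2 * wt β₁ β₂ z + B / δ ^ 2 * wt β₁ β₂ z + Cl / δ ^ 2 * wt β₁ β₂ z := by ring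
    linarith
  · have e : lead δ p z + rInt δ p h z / gInt δ p h - (lead δ q z + rInt δ q h' z / gInt δ q h')
      = (lead δ p z - lead δ q z) + (rInt δ p h z / gInt δ p h - rInt δ q h' z / gInt δ q h') := by
      ring
    rw [e]
    refine (abs_add_le _ _).trans ((add_le_add l2 f2).trans ?_)
    have e1 : δ ^ k * (‖p - q‖ / δ) ≤ ‖p - q‖ / δ ^ 3 := by
      rw [mul_div_assoc', div_le_div_iff₀ hδ (by positivity)]
      have : δ ^ k * δ ^ 2 ≤ 1 := mul_le_one₀ hδk1 (by positivity) (pow_le_one₀ hδ.le hδ1)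
      calc δ ^ k * ‖p - q‖ * δ ^ 3 = (δ ^ k * δ ^ 2) * (‖p - q‖ * δ) := by ring
        _ ≤ 1 * (‖p - q‖ * δ) := by gcongr
        _ = _ := one_mul _
    have e2 : B * (δ ^ k * (‖p - q‖ / δ + X)) ≤ B * (‖p - q‖ / δ ^ 3 + δ ^ k * X) := by
      gcongr
      rw [mul_add]
      linarith
    have e3 : B * (δ ^ k * (‖p - q‖ / δ + X)) * wt β₁ β₂ z
        ≤ B * (‖p - q‖ / δ ^ 3 + δ ^ k * X) * wt β₁ β₂ z := by gcongr
    have e4 : 0 ≤ A * (‖p - q‖ / δ ^ 3 + δ ^ k * X) * wt β₁ β₂ z := by positivity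
    have e5 : 0 ≤ Cl * (δ ^ k * X) * wt β₁ β₂ z := by positivity
    have e6 : (A + B + Cl) * (‖p - q‖ / δ ^ 3 + δ ^ k * X) * wt β₁ β₂ z
      = A * (‖p - q‖ / δ ^ 3 + δ ^ k * X) * wt β₁ β₂ z
        + B * (‖p - q‖ / δ ^ 3 + δ ^ k * X) * wt β₁ β₂ z
        + Cl / δ ^ 3 * ‖p - q‖ * wt β₁ β₂ z + Cl * (δ ^ k * X) * wt β₁ β₂ z := by ring
    linarith

theorem uFun_meas {β₁ β₂ H c δ : ℝ} {p : ℝ × ℝ} {h : ℝ → ℝ} (hβ₁ : 0 < β₁) (hβ₂ : 0 ≤ β₂)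
    (hδ : 0 < δ) (hδ1 : δ ≤ 1) (hp : Adm δ p) (hh : GoodH β₁ β₂ H c δ h) :
    AEStronglyMeasurable (uFun δ p h) (volume.restrict (Ioi 0)) :=
  (((continuousOn_jInt hβ₁ hβ₂ hδ hδ1 hp hh.memW).div_const _).mono
    Ioi_subset_Ici_self).aestronglyMeasurable measurableSet_Ioi

/-! ### Moments of the normalised solution. -/

/-- Moments of `uFun`. -/
def mom (δ : ℝ) (p : ℝ × ℝ) (h m : ℝ → ℝ) : ℝ := ∫ z in Ioi (0 : ℝ), m z * uFun δ p h z

/-- On [0, 2/5] the denominator is bounded below uniformly in δ and y^(-2/3) is integrable at 0, so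
`Q` is bounded; the coupling exponent can only help. -/
theorem exists_le_psiRaw : ∃ c : ℝ, 0 < c ∧ ∀ (δ z : ℝ) (p : ℝ × ℝ), Adm δ p → 0 < δ → δ ≤ 1 →
    0 ≤ z → z ≤ 2 / 5 → c ≤ psiRaw δ p.1 p.2 z := by
  refine ⟨(2 ^ 2)⁻¹ * Real.exp (-6000), by positivity, fun δ z p hp hδ hδ1 hz hz2 => ?_⟩
  rw [psiRaw_eq p hδ hz]
  have h1 : den δ z ≤ 2 := (den_le hδ1 hz).trans (by linarith)
  have h0 := den_pos hδ hz
  have h2 : 1 ≤ Real.exp (P δ p z) := Real.one_le_exp (by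
    have := P_mono hp hδ le_rfl hz
    rwa [P_zero] at this)
  have h3 : Q δ z ≤ 6000 := by
    have hle : Q δ z ≤ ∫ y in (0:ℝ)..z, 2000 * y ^ (-2 / 3 : ℝ) := by
      refine intervalIntegral.integral_mono_on hz (intervalIntegrable_qDens hδ le_rfl hz)
        ((intervalIntegrable_rpow_two_thirds 0 z).const_mul _) fun y hy => ?_
      have e1 : aCoef δ y ≤ 2000 := by
        rw [aCoef_eq]
        have := den_ge_sq hδ.le hδ1 hy.1 (by linarith [hy.2])
        have h4 : 1 / 2000 ≤ den δ y := by nlinarith [hy.1, hy.2]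
        calc (den δ y)⁻¹ ≤ (1 / 2000)⁻¹ := inv_anti₀ (by norm_num) h4
          _ = 2000 := by norm_num
      have e2 : 0 ≤ y ^ (-2 / 3 : ℝ) := Real.rpow_nonneg hy.1 _
      have e3 : 0 ≤ (lamLSW - δ) / 3 := by linarith [lamLSW_bounds.1]
      have e4 : (lamLSW - δ) / 3 ≤ 1 := by linarith [lamLSW_bounds.2]
      unfold qDens
      calc _ ≤ 2000 * (1 * y ^ (-2 / 3 : ℝ)) := by gcongr
        _ = _ := by ring
    rw [intervalIntegral.integral_const_mul, integral_rpow (Or.inl (by norm_num))] at hle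
    have e5 : z ^ (-2 / 3 + 1 : ℝ) ≤ 1 := Real.rpow_le_one hz (by linarith) (by norm_num)
    rw [Real.zero_rpow (by norm_num)] at hle
    have : 2000 * ((z ^ (-2 / 3 + 1 : ℝ) - 0) / (-2 / 3 + 1)) ≤ 6000 := by
      norm_num at e5 ⊢
      linarith
    linarith
  calc (2 ^ 2)⁻¹ * Real.exp (-6000) = (2 ^ 2)⁻¹ * Real.exp (-6000) * 1 := (mul_one _).symm
    _ ≤ _ := by gcongr

/-- Admissible moment weights. -/
structure MomWeight (m : ℝ → ℝ) : Prop where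
  meas : AEStronglyMeasurable m (volume.restrict (Ioi 0))
  nonneg : ∀ z, 0 < z → 0 ≤ m z
  le : ∀ z, 0 < z → m z ≤ (1 + z) ^ 2
  lower : ∀ z, 1 / 10 ≤ z → z ≤ 2 / 5 → 1 / 10 ≤ m z

theorem momWeight_one : MomWeight (fun _ => 1) :=
  ⟨aestronglyMeasurable_const, fun _ _ => zero_le_one, fun z hz => by nlinarith,
    fun _ _ _ => by norm_num⟩

theorem momWeight_id : MomWeight (fun z => z) :=
  ⟨aestronglyMeasurable_id, fun _ hz => hz.le, fun z hz => by nlinarith, fun _ h _ => h⟩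

theorem exists_mom_bound {β₁ β₂ H c : ℝ} (hβ₁ : 0 < β₁) (hβ₂ : 0 ≤ β₂) (hH : 0 ≤ H) (hc : 0 < c)
    (k : ℕ) : ∃ C : ℝ, 0 < C ∧ ∃ c₀ : ℝ, 0 < c₀ ∧ ∃ δ₁ : ℝ, 0 < δ₁ ∧ δ₁ ≤ 1 ∧
      ∀ (δ X : ℝ) (p q : ℝ × ℝ) (h h' m : ℝ → ℝ), 0 < δ → δ < δ₁ →
      0 ≤ X → Adm δ p → Adm δ q → GoodH β₁ β₂ H c δ h → GoodH β₁ β₂ H c δ h' →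
      (∀ ξ, 0 ≤ ξ → |h ξ - h' ξ| ≤ X * wt β₁ β₂ ξ) → MomWeight m →
      IntegrableOn (fun z => m z * uFun δ p h z) (Ioi 0) ∧
      c₀ ≤ mom δ p h m ∧ |mom δ p h m| ≤ C / δ ^ 2 ∧
      |mom δ p h m - mom δ q h' m| ≤ C * (‖p - q‖ / δ ^ 3 + δ ^ k * X) := by
  obtain ⟨Cu, hCu, hu⟩ := exists_uFun_bound (β₁ := β₁) (β₂ := β₂) hβ₁ hβ₂ hH hc (k + 1)
  obtain ⟨Cm, hCm, hm⟩ := exists_moment_bound (β₁ := β₁) (β₂ := β₂) hβ₁ hβ₂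
  obtain ⟨cψ, hcψ, hψ⟩ := exists_le_psiRaw
  -- On [1/10, 2/5] both the weight m (≥ 1/10) and `lead` (≥ cψ) are bounded below, which gives
  -- 3cψ/100 for the moment; the threshold on δ keeps the remainder below cψ/100.
  refine ⟨Cm * Cu, by positivity, cψ / 100, by positivity,
    min 1 (cψ / 100 / (Cm * Cu)), by positivity, min_le_left _ _,
    fun δ X p q h h' m hδ hδ' hX hp hq hh hh' hd hw => ?_⟩
  have hδ1 : δ ≤ 1 := (hδ'.trans_le (min_le_left _ _)).le
  have hδ2 : δ < cψ / 100 / (Cm * Cu) := hδ'.trans_le (min_le_right _ _)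
  have hmem : ∀ (p) (h : ℝ → ℝ), Adm δ p → GoodH β₁ β₂ H c δ h →
      MemW β₁ β₂ (Cu / δ ^ 2) (uFun δ p h) := fun p h hp hh =>
    ⟨uFun_meas hβ₁ hβ₂ hδ hδ1 hp hh, fun z hz =>
      (hu δ z 0 p p h h hδ hδ1 hz le_rfl hp hp hh hh (by simp)).2.1⟩
  have hmb : ∀ z, 0 < z → |m z| ≤ (1 + z) ^ 2 := fun z hz => by
    rw [abs_of_nonneg (hw.nonneg z hz)]; exact hw.le z hz
  have hwt : MemW β₁ β₂ 1 (wt β₁ β₂) :=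
    ⟨((continuousOn_wt β₁ β₂).mono Ioi_subset_Ici_self).aestronglyMeasurable measurableSet_Ioi,
      fun z hz => by rw [abs_of_pos (wt_pos _ _ hz), one_mul]⟩
  obtain ⟨i1, b1⟩ := hm _ _ _ (hmem p h hp hh) hw.meas hmb
  obtain ⟨i2, -⟩ := hm _ _ _ (hmem q h' hq hh') hw.meas hmb
  obtain ⟨i3, b3⟩ := hm _ _ _ hwt hw.meas hmb
  refine ⟨i1, ?_, b1.trans (le_of_eq (by ring)), ?_⟩
  · have hind : IntegrableOn (indicator (Icc (1 / 10 : ℝ) (2 / 5)) fun _ => cψ / 10) (Ioi 0) := by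
      refine Integrable.integrableOn ?_
      rw [integrable_indicator_iff measurableSet_Icc]
      exact continuousOn_const.integrableOn_Icc
    have hlow : ∫ z in Ioi (0:ℝ), (indicator (Icc (1 / 10) (2 / 5)) (fun _ => cψ / 10) z
        - Cu * δ ^ (k + 1) * (m z * wt β₁ β₂ z)) ≤ mom δ p h m := by
      refine setIntegral_mono_on ?_ i1 measurableSet_Ioi fun z hz => ?_
      · exact Integrable.sub hind (i3.const_mul _)
      · have hz0 : (0:ℝ) < z := hz
        have h1 := (hu δ z 0 p p h h hδ hδ1 hz0.le le_rfl hp hp hh hh (by simp)).1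
        rw [abs_le] at h1
        have h2 : indicator (Icc (1 / 10) (2 / 5)) (fun _ => cψ / 10) z ≤ m z * lead δ p z := by
          by_cases hmem : z ∈ Icc (1 / 10 : ℝ) (2 / 5)
          · rw [indicator_of_mem hmem]
            have h3 := hw.lower z hmem.1 hmem.2
            have h4 := hψ δ z p hp hδ hδ1 hz0.le hmem.2
            unfold lead
            rw [if_pos (by linarith [hmem.2])]
            nlinarith
          · rw [indicator_of_notMem hmem]
            refine mul_nonneg (hw.nonneg z hz0) ?_
            unfold lead
            split_ifs
            · exact (psiRaw_pos _ _ _ _).le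
            · exact le_rfl
        have h5 := mul_le_mul_of_nonneg_left h1.1 (hw.nonneg z hz0)
        linarith
    refine le_trans ?_ hlow
    have hsub : Icc (1 / 10 : ℝ) (2 / 5) ⊆ Ioi 0 := fun z hz => lt_of_lt_of_le (by norm_num) hz.1
    rw [integral_sub hind (i3.const_mul _), integral_const_mul,
      setIntegral_indicator measurableSet_Icc, inter_eq_self_of_subset_right hsub,
      setIntegral_const, measureReal_def,
      Real.volume_Icc, ENNReal.toReal_ofReal (by norm_num), smul_eq_mul]
    have h7 : ∫ z in Ioi (0:ℝ), m z * wt β₁ β₂ z ≤ Cm := by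
      have := (le_abs_self _).trans b3
      linarith
    have h8 : δ ^ (k + 1) ≤ δ := by
      rw [pow_succ]
      exact mul_le_of_le_one_left hδ.le (pow_le_one₀ hδ.le hδ1)
    have h9 : Cu * δ ^ (k + 1) * ∫ z in Ioi (0:ℝ), m z * wt β₁ β₂ z ≤ Cu * δ * Cm := by
      have h10 : Cu * δ ^ (k + 1) * ∫ z in Ioi (0:ℝ), m z * wt β₁ β₂ z
          ≤ Cu * δ ^ (k + 1) * Cm := by gcongr
      exact h10.trans (by gcongr)
    rw [lt_div_iff₀ (by positivity)] at hδ2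
    linarith
  · unfold mom
    rw [← integral_sub i1 i2]
    have hdiff : MemW β₁ β₂ (Cu * (‖p - q‖ / δ ^ 3 + δ ^ k * X)) (uFun δ p h - uFun δ q h') := by
      refine ⟨(uFun_meas hβ₁ hβ₂ hδ hδ1 hp hh).sub (uFun_meas hβ₁ hβ₂ hδ hδ1 hq hh'),
        fun z hz => ((hu δ z X p q h h' hδ hδ1 hz hX hp hq hh hh' hd).2.2).trans ?_⟩
      have := (wt_pos β₁ β₂ hz).le
      have : δ ^ (k + 1) ≤ δ ^ k := pow_le_pow_of_le_one hδ.le hδ1 (by omega)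
      gcongr
    have h6 := (hm _ _ _ hdiff hw.meas hmb).2
    simp only [Pi.sub_apply, mul_sub] at h6
    exact h6.trans (le_of_eq (by ring))

/-! ### The compatibility conditions as a fixed point problem; the couplings. -/

/-- The solution with unit volume. -/
def tFun (δ : ℝ) (p : ℝ × ℝ) (h : ℝ → ℝ) (z : ℝ) : ℝ := uFun δ p h z / mom δ p h fun z => z

/-- The compatibility conditions as a fixed point problem. -/
def fMap (δ : ℝ) (h : ℝ → ℝ) (p : ℝ × ℝ) : ℝ × ℝ :=
  (1 / mom δ p h (fun z => z) / gInt δ p h,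
    mom δ p h (fun _ => 1) / mom δ p h (fun z => z) / mom δ p h (fun z => z) / gInt δ p h)

theorem exists_tFun_sub_le {β₁ β₂ H c : ℝ} (hβ₁ : 0 < β₁) (hβ₂ : 0 ≤ β₂) (hH : 0 ≤ H) (hc : 0 < c)
    (k : ℕ) : ∃ C : ℝ, 0 < C ∧ ∃ δ₁ : ℝ, 0 < δ₁ ∧ δ₁ ≤ 1 ∧
      ∀ (δ z X : ℝ) (p q : ℝ × ℝ) (h h' : ℝ → ℝ), 0 < δ → δ < δ₁ →
      0 ≤ z → 0 ≤ X → Adm δ p → Adm δ q → GoodH β₁ β₂ H c δ h → GoodH β₁ β₂ H c δ h' →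
      (∀ ξ, 0 ≤ ξ → |h ξ - h' ξ| ≤ X * wt β₁ β₂ ξ) →
      |tFun δ p h z - tFun δ q h' z| ≤ C * (‖p - q‖ / δ ^ 5 + δ ^ k * X) * wt β₁ β₂ z := by
  -- The extra δ^2 offsets the bound δ^(-2) on `uFun` that multiplies the variation of the volume;
  -- the same shift turns δ^(-3) into δ^(-5) in the coupling term.
  obtain ⟨Cu, hCu, hu⟩ := exists_uFun_bound (β₁ := β₁) (β₂ := β₂) hβ₁ hβ₂ hH hc (k + 2)
  obtain ⟨Cm, hCm, c₀, hc₀, δ₁, hδ₁, hδ₁', hm⟩ :=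
    exists_mom_bound (β₁ := β₁) (β₂ := β₂) hβ₁ hβ₂ hH hc (k + 2)
  refine ⟨Cu / c₀ + Cu * Cm / c₀ ^ 2, by positivity, δ₁, hδ₁, hδ₁',
    fun δ z X p q h h' hδ hδ' hz hX hp hq hh hh' hd => ?_⟩
  have hδ1 : δ ≤ 1 := hδ'.le.trans hδ₁'
  have hΔ := norm_nonneg (p - q)
  obtain ⟨-, -, u3⟩ := hu δ z X p q h h' hδ hδ1 hz hX hp hq hh hh' hd
  have u2 := (hu δ z 0 q q h' h' hδ hδ1 hz le_rfl hq hq hh' hh' (by simp)).2.1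
  obtain ⟨-, m1, -, m2⟩ := hm δ X p q h h' _ hδ hδ' hX hp hq hh hh' hd momWeight_id
  have m3 := (hm δ 0 q q h' h' _ hδ hδ' le_rfl hq hq hh' hh' (by simp) momWeight_id).2.1
  have hw := (wt_pos β₁ β₂ hz).le
  refine (abs_div_sub_div_le hc₀ m1 m3).trans ?_
  have e0 : ‖p - q‖ / δ ^ 3 + δ ^ (k + 2) * X = δ ^ 2 * (‖p - q‖ / δ ^ 5 + δ ^ k * X) := by
    rw [pow_add]; field_simp
  rw [e0] at u3 m2
  have hδ2 : δ ^ 2 ≤ 1 := pow_le_one₀ hδ.le hδ1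
  have hY : 0 ≤ ‖p - q‖ / δ ^ 5 + δ ^ k * X := by positivity
  generalize ‖p - q‖ / δ ^ 5 + δ ^ k * X = Y at *
  calc _ ≤ Cu * (δ ^ 2 * Y) * wt β₁ β₂ z / c₀
        + (Cu / δ ^ 2 * wt β₁ β₂ z) * (Cm * (δ ^ 2 * Y)) / c₀ ^ 2 := by gcongr
    _ = Cu * (δ ^ 2 * Y) * wt β₁ β₂ z / c₀ + Cu * Cm / c₀ ^ 2 * Y * wt β₁ β₂ z := by
        field_simp
    _ ≤ Cu * (1 * Y) * wt β₁ β₂ z / c₀ + Cu * Cm / c₀ ^ 2 * Y * wt β₁ β₂ z := by gcongr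
    _ = _ := by ring

/-- U, V are moments, g is an amplitude of order at least N. All losses are collected in D, which
will be polynomial in 1/δ, while N will be `kerSize δ`; everything then comes with D^2/N, smaller
than any power of δ. -/
theorem quotient_bounds {U U' V V' g g' N D Y c c₀ : ℝ} (hc : 0 < c) (hc₀ : 0 < c₀) (hN : 0 < N)
    (hD : 1 ≤ D) (hY : 0 ≤ Y) (u1 : c₀ ≤ U) (u2 : c₀ ≤ U') (v1 : |V| ≤ D) (v2 : |V'| ≤ D)
    (u3 : |U - U'| ≤ D * Y) (v3 : |V - V'| ≤ D * Y) (g1 : c * N ≤ g) (g2 : c * N ≤ g')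
    (g3 : |g - g'| ≤ D * N * Y) :
    |1 / U / g - 1 / U' / g'| ≤ (1 / c₀ ^ 2 / c + 1 / c₀ / c ^ 2) * (D ^ 2 / N) * Y ∧
    |V / U / U / g - V' / U' / U' / g'| ≤ (((1 / c₀ + 1 / c₀ ^ 2) / c₀ + 1 / c₀ / c₀ ^ 2) / c
      + 1 / c₀ / c₀ / c ^ 2) * (D ^ 2 / N) * Y ∧
    1 / U / g ≤ 1 / c₀ / c * (D ^ 2 / N) ∧ V / U / U / g ≤ 1 / c₀ / c₀ / c * (D ^ 2 / N) := by
  have hm0 : 0 < c * N := by positivity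
  have pU : 0 < U := hc₀.trans_le u1
  have pg : 0 < g := hm0.trans_le g1
  have hDD : D ≤ D ^ 2 := le_self_pow₀ hD (by norm_num)
  have hD1 : 1 ≤ D ^ 2 := hD.trans hDD
  have hD0 : 0 ≤ D := zero_le_one.trans hD
  have a1 : ∀ U, c₀ ≤ U → |1 / U| ≤ 1 / c₀ := fun U hU =>
    abs_div_le_div hc₀ hU (by norm_num)
  have a2 : |1 / U - 1 / U'| ≤ D * Y / c₀ ^ 2 := by
    refine (abs_div_sub_div_le hc₀ u1 u2).trans ?_
    rw [sub_self, abs_zero, zero_div, zero_add, abs_one, one_mul]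
    gcongr
  have b1 : ∀ U V, c₀ ≤ U → |V| ≤ D → |V / U| ≤ D / c₀ := fun U V hU hV => abs_div_le_div hc₀ hU hV
  have b2 : |V / U - V' / U'| ≤ D ^ 2 * Y * (1 / c₀ + 1 / c₀ ^ 2) := by
    refine (abs_div_sub_div_le hc₀ u1 u2).trans ?_
    calc _ ≤ D * Y / c₀ + D * (D * Y) / c₀ ^ 2 := by gcongr
      _ ≤ D ^ 2 * Y / c₀ + D * (D * Y) / c₀ ^ 2 := by gcongr
      _ = _ := by ring
  have b3 : |V / U / U - V' / U' / U'|
      ≤ D ^ 2 * Y * ((1 / c₀ + 1 / c₀ ^ 2) / c₀ + 1 / c₀ / c₀ ^ 2) := by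
    refine (abs_div_sub_div_le hc₀ u1 u2).trans ?_
    calc _ ≤ D ^ 2 * Y * (1 / c₀ + 1 / c₀ ^ 2) / c₀ + (D / c₀) * (D * Y) / c₀ ^ 2 := by
          gcongr
          exact b1 U' V' u2 v2
      _ = _ := by ring
  have b4 : |V' / U' / U'| ≤ D / c₀ / c₀ := abs_div_le_div hc₀ u2 (b1 U' V' u2 v2)
  refine ⟨?_, ?_, ?_, ?_⟩
  · refine (abs_div_sub_div_le hm0 g1 g2).trans ?_
    calc _ ≤ (D * Y / c₀ ^ 2) / (c * N) + (1 / c₀) * (D * N * Y) / (c * N) ^ 2 := by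
          gcongr
          exact a1 U' u2
      _ = (1 / c₀ ^ 2 / c + 1 / c₀ / c ^ 2) * (D / N) * Y := by field_simp
      _ ≤ _ := by gcongr
  · refine (abs_div_sub_div_le hm0 g1 g2).trans ?_
    calc _ ≤ (D ^ 2 * Y * ((1 / c₀ + 1 / c₀ ^ 2) / c₀ + 1 / c₀ / c₀ ^ 2)) / (c * N)
          + (D / c₀ / c₀) * (D * N * Y) / (c * N) ^ 2 := by gcongr
      _ = _ := by field_simp
  · calc 1 / U / g ≤ 1 / c₀ / (c * N) * 1 := by rw [mul_one]; gcongr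
      _ ≤ 1 / c₀ / (c * N) * D ^ 2 := by gcongr
      _ = _ := by field_simp
  · calc V / U / U / g ≤ D / c₀ / c₀ / (c * N) := by
          gcongr
          exact (le_abs_self _).trans v1
      _ ≤ D ^ 2 / c₀ / c₀ / (c * N) := by gcongr
      _ = _ := by field_simp

theorem exists_fMap_bound {β₁ β₂ H c : ℝ} (hβ₁ : 0 < β₁) (hβ₂ : 0 ≤ β₂) (hH : 0 ≤ H) (hc : 0 < c)
    (k : ℕ) : ∃ C : ℝ, 0 < C ∧ ∃ δ₁ : ℝ, 0 < δ₁ ∧ δ₁ ≤ 1 ∧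
      ∀ (δ X : ℝ) (p q : ℝ × ℝ) (h h' : ℝ → ℝ), 0 < δ → δ < δ₁ →
      0 ≤ X → Adm δ p → Adm δ q → GoodH β₁ β₂ H c δ h → GoodH β₁ β₂ H c δ h' →
      (∀ ξ, 0 ≤ ξ → |h ξ - h' ξ| ≤ X * wt β₁ β₂ ξ) →
      ((0 < (fMap δ h p).1 ∧ (fMap δ h p).1 ≤ C * δ ^ k) ∧
        (0 < (fMap δ h p).2 ∧ (fMap δ h p).2 ≤ C * δ ^ k)) ∧
      ‖fMap δ h p - fMap δ h' q‖ ≤ C * δ ^ k * (‖p - q‖ + X) := by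
  obtain ⟨Cm, hCm, c₀, hc₀, δ₁, hδ₁, hδ₁', hm⟩ :=
    exists_mom_bound (β₁ := β₁) (β₂ := β₂) hβ₁ hβ₂ hH hc 0
  obtain ⟨Cg, hCg, hg⟩ := exists_gInt_bound (β₁ := β₁) (β₂ := β₂) hβ₁ hβ₂
  -- D will be C₀/δ^3 and enters squared, hence six extra powers.
  obtain ⟨CN, hCN, hN'⟩ := exists_inv_kerSize_le (k + 6)
  set C₀ : ℝ := 1 + Cm + Cg * (H + 1) with hC₀
  have hC₀1 : 1 ≤ C₀ := by
    have : 0 ≤ Cm + Cg * (H + 1) := by positivity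
    linarith
  set E₁ : ℝ := 1 / c₀ ^ 2 / c + 1 / c₀ / c ^ 2 with hE₁
  set E₂ : ℝ := ((1 / c₀ + 1 / c₀ ^ 2) / c₀ + 1 / c₀ / c₀ ^ 2) / c + 1 / c₀ / c₀ / c ^ 2 with hE₂
  set E₃ : ℝ := 1 / c₀ / c + 1 / c₀ / c₀ / c with hE₃
  refine ⟨(E₁ + E₂ + E₃) * C₀ ^ 2 * CN, by positivity, δ₁, hδ₁, hδ₁',
    fun δ X p q h h' hδ hδ' hX hp hq hh hh' hd => ?_⟩
  have hδ1 : δ ≤ 1 := hδ'.le.trans hδ₁'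
  have hΔ := norm_nonneg (p - q)
  have hN := kerSize_pos δ
  have g1 := hh.lower p hp
  have g2 := hh'.lower q hq
  have g3 := (hg δ H X p q h h' hδ hδ1 hX hp hq hh.memW hh'.memW hd).2
  obtain ⟨-, u1, -, u3⟩ := hm δ X p q h h' _ hδ hδ' hX hp hq hh hh' hd momWeight_id
  have u2 := (hm δ 0 q q h' h' _ hδ hδ' le_rfl hq hq hh' hh' (by simp) momWeight_id).2.1
  obtain ⟨-, v0, v1, v3⟩ := hm δ X p q h h' _ hδ hδ' hX hp hq hh hh' hd momWeight_one
  have v2 := (hm δ 0 q q h' h' _ hδ hδ' le_rfl hq hq hh' hh' (by simp) momWeight_one).2.2.1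
  have hNk := hN' δ hδ hδ1
  have hm0 : 0 < c * kerSize δ := by positivity
  have hY : 0 ≤ ‖p - q‖ + X := by positivity
  set D : ℝ := C₀ / δ ^ 3 with hD
  have hδ3 : δ ^ 3 ≤ 1 := pow_le_one₀ hδ.le hδ1
  have hD1 : 1 ≤ D := by
    rw [hD, le_div_iff₀ (by positivity), one_mul]; exact hδ3.trans hC₀1
  have hV : Cm / δ ^ 2 ≤ D := by
    rw [hD, div_le_div_iff₀ (by positivity) (by positivity)]
    have h1 : Cm ≤ C₀ := by
      have : 0 ≤ Cg * (H + 1) := by positivity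
      linarith only [this, hC₀]
    have h2 : δ ^ 3 ≤ δ ^ 2 := pow_le_pow_of_le_one hδ.le hδ1 (by omega)
    gcongr
  have hdU : Cm * (‖p - q‖ / δ ^ 3 + δ ^ 0 * X) ≤ D * (‖p - q‖ + X) := by
    have h1 : Cm ≤ C₀ := by
      have : 0 ≤ Cg * (H + 1) := by positivity
      linarith only [this, hC₀]
    have h2 : ‖p - q‖ / δ ^ 3 + δ ^ 0 * X ≤ (‖p - q‖ + X) / δ ^ 3 := by
      rw [add_div, pow_zero, one_mul]
      gcongr
      rw [le_div_iff₀ (by positivity)]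
      exact mul_le_of_le_one_right hX hδ3
    calc _ ≤ C₀ * ((‖p - q‖ + X) / δ ^ 3) := by gcongr
      _ = _ := by rw [hD]; ring
  have hdg : Cg / δ ^ 2 * kerSize δ * (‖p - q‖ / δ * H + X) ≤ D * kerSize δ * (‖p - q‖ + X) := by
    have h1 : Cg * (H + 1) ≤ C₀ := by linarith only [hC₀, hCm]
    have h2 : ‖p - q‖ / δ * H + X ≤ (H + 1) * ((‖p - q‖ + X) / δ) := by
      have h3 : X ≤ X / δ := by
        rw [le_div_iff₀ hδ]; exact mul_le_of_le_one_right hX hδ1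
      have h4 : 0 ≤ ‖p - q‖ / δ := by positivity
      have h5 : 0 ≤ X / δ := by positivity
      rw [add_div]
      nlinarith only [h3, mul_nonneg hH h5, h4]
    calc _ ≤ Cg / δ ^ 2 * kerSize δ * ((H + 1) * ((‖p - q‖ + X) / δ)) := by gcongr
      _ = (Cg * (H + 1)) / δ ^ 3 * kerSize δ * (‖p - q‖ + X) := by field_simp
      _ ≤ _ := by rw [hD]; gcongr
  have hfin : D ^ 2 / kerSize δ ≤ C₀ ^ 2 * CN * δ ^ k := by
    calc D ^ 2 / kerSize δ = C₀ ^ 2 / δ ^ 6 * (1 / kerSize δ) := by rw [hD]; field_simp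
      _ ≤ C₀ ^ 2 / δ ^ 6 * (CN * δ ^ (k + 6)) := by gcongr
      _ = _ := by rw [pow_add]; field_simp
  obtain ⟨e1, e2, f1, f2⟩ := quotient_bounds hc hc₀ hN hD1 hY u1 u2 (v1.trans hV) (v2.trans hV)
    (u3.trans hdU) (v3.trans hdU) g1 g2 (g3.trans hdg)
  have hcoef : ∀ e, 0 ≤ e → e ≤ E₁ + E₂ + E₃ →
      e * (D ^ 2 / kerSize δ) ≤ (E₁ + E₂ + E₃) * C₀ ^ 2 * CN * δ ^ k := fun e he hle => by
    calc e * (D ^ 2 / kerSize δ) ≤ (E₁ + E₂ + E₃) * (C₀ ^ 2 * CN * δ ^ k) := by gcongr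
      _ = _ := by ring
  have hE₁0 : 0 ≤ E₁ := by positivity
  have hE₂0 : 0 ≤ E₂ := by positivity
  have hE₃1 : 0 ≤ 1 / c₀ / c := by positivity
  have hE₃2 : 0 ≤ 1 / c₀ / c₀ / c := by positivity
  have pU := hc₀.trans_le u1
  have pV := hc₀.trans_le v0
  have pg := hm0.trans_le g1
  refine ⟨⟨⟨div_pos (div_pos one_pos pU) pg, f1.trans (hcoef _ hE₃1 ?_)⟩,
    div_pos (div_pos (div_pos pV pU) pU) pg, f2.trans (hcoef _ hE₃2 ?_)⟩, ?_⟩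
  · rw [hE₃]; linarith only [hE₁0, hE₂0, hE₃2]
  · rw [hE₃]; linarith only [hE₁0, hE₂0, hE₃1]
  rw [Prod.norm_def]
  refine max_le ?_ ?_
  · exact e1.trans (mul_le_mul_of_nonneg_right (hcoef _ hE₁0
      (by rw [hE₃]; linarith only [hE₂0, hE₃1, hE₃2])) hY)
  · exact e2.trans (mul_le_mul_of_nonneg_right (hcoef _ hE₂0
      (by rw [hE₃]; linarith only [hE₁0, hE₃1, hE₃2])) hY)

theorem integral_mul_varConst {β₁ β₂ H c δ : ℝ} {p : ℝ × ℝ} {h : ℝ → ℝ} (hc : 0 < c)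
    (hp : Adm δ p) (hh : GoodH β₁ β₂ H c δ h) (m : ℝ → ℝ) :
    ∫ z in Ioi (0:ℝ), m z * varConst δ p.1 p.2 h z = p.1 * gInt δ p h * mom δ p h m := by
  have hg : gInt δ p h ≠ 0 := ((mul_pos hc (kerSize_pos δ)).trans_le (hh.lower p hp)).ne'
  unfold mom
  rw [← integral_const_mul]
  congr 1
  ext z
  rw [varConst_eq, uFun]
  field_simp

/-- The conditions read ε^2 g U = ε and ε^2 g V = ε'. For ε > 0 the first gives ε = 1/(U g), and
inserting this in the second gives ε' = V/(U^2 g). Positivity removes the trivial solution (0, 0),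
which is not a fixed point of `fMap`. -/
theorem compatible_iff {β₁ β₂ H c δ : ℝ} {p : ℝ × ℝ} {h : ℝ → ℝ} (hc : 0 < c)
    (hp : Adm δ p) (hp0 : 0 < p.1) (hh : GoodH β₁ β₂ H c δ h) (hU : 0 < mom δ p h fun z => z) :
    Compatible δ h p.1 p.2 ↔ fMap δ h p = p := by
  have hg : 0 < gInt δ p h := (mul_pos hc (kerSize_pos δ)).trans_le (hh.lower p hp)
  have h1 := integral_mul_varConst hc hp hh fun z => z
  have h2 := integral_mul_varConst hc hp hh fun _ => 1
  simp only [one_mul] at h2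
  unfold Compatible fMap
  rw [h1, h2, Prod.ext_iff]
  simp only
  generalize (mom δ p h fun z => z) = U at *
  generalize (mom δ p h fun _ => 1) = V at *
  generalize gInt δ p h = g at *
  have k1 : p.1 * (p.1 * g * U) = p.1 ↔ 1 / U / g = p.1 := by
    rw [div_div, div_eq_iff (mul_pos hU hg).ne']
    constructor
    · intro h
      have : p.1 * (p.1 * g * U) = p.1 * 1 := by rw [h, mul_one]
      have := mul_left_cancel₀ hp0.ne' this
      linarith
    · intro h
      linear_combination (-p.1) * h
  rw [k1]
  refine and_congr_right fun h => ?_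
  have e : V / U / U / g = p.1 * (p.1 * g * V) := by
    rw [← h]; field_simp
  rw [e]

theorem tFun_eq_opI {β₁ β₂ H c δ : ℝ} {p : ℝ × ℝ} {h : ℝ → ℝ} (hc : 0 < c)
    (hp : Adm δ p) (hh : GoodH β₁ β₂ H c δ h)
    (hfix : fMap δ h p = p) (z : ℝ) : varConst δ p.1 p.2 h z = tFun δ p h z := by
  have hg : gInt δ p h ≠ 0 := ((mul_pos hc (kerSize_pos δ)).trans_le (hh.lower p hp)).ne'
  rw [varConst_eq, tFun, uFun]
  have h1 : p.1 = 1 / (mom δ p h fun z => z) / gInt δ p h := (congrArg Prod.fst hfix).symm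
  generalize jInt δ p h z = J
  rw [h1]
  field_simp

theorem sqrt_mem_adm {η δ : ℝ} {h : ℝ → ℝ} {p : ℝ × ℝ} (hη : η ≤ 1)
    (hp : IsCoupling η δ h p) : Adm δ p := by
  have h1 : η * √δ ≤ √δ := mul_le_of_le_one_left (Real.sqrt_nonneg _) hη
  exact ⟨⟨hp.1.1.le, hp.1.2.trans h1⟩, hp.2.1.1.le, hp.2.1.2.trans h1⟩

/-- Existence, uniqueness and regularity of the couplings. -/
theorem exists_coupling {β₁ β₂ H c : ℝ} (hβ₁ : 0 < β₁) (hβ₂ : 0 ≤ β₂) (hH : 0 ≤ H) (hc : 0 < c)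
    (k : ℕ) {η : ℝ} (hη : 0 < η) (hη1 : η ≤ 1) :
    ∃ C : ℝ, 0 < C ∧ ∃ δ₁ : ℝ, 0 < δ₁ ∧ δ₁ ≤ 1 ∧
      ∀ δ : ℝ, 0 < δ → δ < δ₁ →
      (∀ h, GoodH β₁ β₂ H c δ h → ∃! p, IsCoupling η δ h p) ∧
      (∀ h, GoodH β₁ β₂ H c δ h → Adm δ (coupling η δ h) ∧
        IsCoupling η δ h (coupling η δ h) ∧ ‖coupling η δ h‖ ≤ C * δ ^ k ∧
        (∀ z, varConst δ (coupling η δ h).1 (coupling η δ h).2 h z = tFun δ (coupling η δ h) h z)) ∧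
      ∀ (X : ℝ) (h h' : ℝ → ℝ), 0 ≤ X → GoodH β₁ β₂ H c δ h → GoodH β₁ β₂ H c δ h' →
        (∀ ξ, 0 ≤ ξ → |h ξ - h' ξ| ≤ X * wt β₁ β₂ ξ) →
        ‖coupling η δ h - coupling η δ h'‖ ≤ C * δ ^ k * X := by
  obtain ⟨C, hC, δ₁, hδ₁, hδ₁', hF⟩ :=
    exists_fMap_bound (β₁ := β₁) (β₂ := β₂) hβ₁ hβ₂ hH hc (k + 1)
  obtain ⟨Cm, -, c₀, hc₀, δ₂, hδ₂, hδ₂', hm⟩ :=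
    exists_mom_bound (β₁ := β₁) (β₂ := β₂) hβ₁ hβ₂ hH hc 0
  -- The last two thresholds give C δ ≤ 1/2, so `fMap` contracts by 1/2, and C δ ≤ η √δ, so it
  -- preserves the square.
  refine ⟨2 * C, by positivity, min (min δ₁ δ₂) (min (1 / (2 * C)) ((η / C) ^ 2)), by positivity,
    (min_le_left _ _).trans ((min_le_left _ _).trans hδ₁'), fun δ hδ hδ' => ?_⟩
  have l1 : δ < δ₁ := hδ'.trans_le ((min_le_left _ _).trans (min_le_left _ _))
  have l2 : δ < δ₂ := hδ'.trans_le ((min_le_left _ _).trans (min_le_right _ _))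
  have l3 : δ < 1 / (2 * C) := hδ'.trans_le ((min_le_right _ _).trans (min_le_left _ _))
  have l4 : δ < (η / C) ^ 2 := hδ'.trans_le ((min_le_right _ _).trans (min_le_right _ _))
  have hδ1 : δ ≤ 1 := l1.le.trans hδ₁'
  rw [lt_div_iff₀ (by positivity)] at l3
  have hδk : δ ^ (k + 1) ≤ δ := by
    rw [pow_succ]; exact mul_le_of_le_one_left hδ.le (pow_le_one₀ hδ.le hδ1)
  have hδk' : δ ^ (k + 1) ≤ δ ^ k := pow_le_pow_of_le_one hδ.le hδ1 (by omega)
  have hhalf : C * δ ^ (k + 1) ≤ 1 / 2 := by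
    have : C * δ ^ (k + 1) ≤ C * δ := by gcongr
    linarith
  have hηδ : C * δ ^ (k + 1) ≤ η * √δ := by
    have h1 : √δ ≤ η / C := Real.sqrt_le_iff.2 ⟨by positivity, l4.le⟩
    rw [le_div_iff₀ hC] at h1
    calc C * δ ^ (k + 1) ≤ C * δ := by gcongr
      _ = (√δ * C) * √δ := by nth_rewrite 1 [← Real.mul_self_sqrt hδ.le]; ring
      _ ≤ η * √δ := by gcongr
  have hmomU : ∀ p h, Adm δ p → GoodH β₁ β₂ H c δ h → 0 < mom δ p h fun z => z := fun p h hp hh =>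
    hc₀.trans_le
      (hm δ 0 p p h h _ hδ l2 le_rfl hp hp hh hh (by simp) momWeight_id).2.1
  have hfix : ∀ h p, GoodH β₁ β₂ H c δ h → IsCoupling η δ h p → fMap δ h p = p := fun h p hh hp =>
    (compatible_iff hc (sqrt_mem_adm hη1 hp) hp.1.1 hh (hmomU p h (sqrt_mem_adm hη1 hp) hh)).1
      hp.2.2
  have hlip : ∀ (X : ℝ) (h h' : ℝ → ℝ) p q, 0 ≤ X → GoodH β₁ β₂ H c δ h → GoodH β₁ β₂ H c δ h' →
      (∀ ξ, 0 ≤ ξ → |h ξ - h' ξ| ≤ X * wt β₁ β₂ ξ) → IsCoupling η δ h p → IsCoupling η δ h' q →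
      ‖p - q‖ ≤ 2 * C * δ ^ k * X := by
    intro X h h' p q hX hh hh' hd hp hq
    have h1 := (hF δ X p q h h' hδ l1 hX (sqrt_mem_adm hη1 hp) (sqrt_mem_adm hη1 hq) hh hh' hd).2
    rw [hfix h p hh hp, hfix h' q hh' hq] at h1
    -- Half of the distance is absorbed in the left side, which gives the factor 2C.
    have h2 : C * δ ^ (k + 1) * (‖p - q‖ + X) ≤ 1 / 2 * ‖p - q‖ + C * δ ^ k * X := by
      rw [mul_add]
      gcongr
    linarith
  have hex : ∀ h, GoodH β₁ β₂ H c δ h → ∃! p, IsCoupling η δ h p := by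
    intro h hh
    -- The closed square is complete but contains points with vanishing components; strict
    -- positivity of the fixed point is recovered from the values of `fMap`.
    set S : Set (ℝ × ℝ) := Icc 0 (η * √δ) ×ˢ Icc 0 (η * √δ) with hS
    have hSadm : ∀ p ∈ S, Adm δ p := fun p hp => by
      have h1 : η * √δ ≤ √δ := mul_le_of_le_one_left (Real.sqrt_nonneg _) hη1
      exact ⟨⟨hp.1.1, hp.1.2.trans h1⟩, hp.2.1, hp.2.2.trans h1⟩
    have hmaps : MapsTo (fMap δ h) S S := fun p hp => by
      obtain ⟨⟨⟨f1, f2⟩, f3, f4⟩, -⟩ := hF δ 0 p p h h hδ l1 le_rfl (hSadm p hp) (hSadm p hp) hh hh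
        (by simp)
      exact ⟨⟨f1.le, f2.trans hηδ⟩, f3.le, f4.trans hηδ⟩
    have hcontr : ContractingWith (1 / 2) (hmaps.restrict (fMap δ h) S S) := by
      refine ⟨by rw [← NNReal.coe_lt_coe]; norm_num, LipschitzWith.of_dist_le_mul fun p q => ?_⟩
      have h1 := (hF δ 0 p q h h hδ l1 le_rfl (hSadm p p.2) (hSadm q q.2) hh hh (by simp)).2
      rw [Subtype.dist_eq, Subtype.dist_eq, dist_eq_norm, dist_eq_norm]
      refine h1.trans ?_
      rw [add_zero]
      push_cast
      gcongr
    have hcomplete : IsComplete S := (isClosed_Icc.prod isClosed_Icc).isComplete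
    have h0 : (0 : ℝ × ℝ) ∈ S := by
      have : 0 ≤ η * √δ := by positivity
      exact ⟨⟨le_rfl, this⟩, le_rfl, this⟩
    obtain ⟨p, hpS, hpfix, -⟩ := hcontr.exists_fixedPoint' hcomplete hmaps h0 (edist_ne_top _ _)
    have hpc : IsCoupling η δ h p := by
      obtain ⟨⟨⟨f1, -⟩, f3, -⟩, -⟩ := hF δ 0 p p h h hδ l1 le_rfl (hSadm p hpS) (hSadm p hpS) hh hh
        (by simp)
      have hpf : fMap δ h p = p := hpfix
      rw [hpf] at f1 f3
      exact ⟨⟨f1, hpS.1.2⟩, ⟨f3, hpS.2.2⟩,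
        (compatible_iff hc (hSadm p hpS) f1 hh (hmomU p h (hSadm p hpS) hh)).2 hpf⟩
    refine ⟨p, hpc, fun q hq => ?_⟩
    have := hlip 0 h h q p le_rfl hh hh (by simp) hq hpc
    rw [mul_zero] at this
    exact sub_eq_zero.1 (norm_le_zero_iff.1 this)
  have hspec : ∀ h, GoodH β₁ β₂ H c δ h → IsCoupling η δ h (coupling η δ h) := fun h hh =>
    Classical.epsilon_spec (hex h hh).exists
  refine ⟨hex, fun h hh => ?_, fun X h h' hX hh hh' hd =>
    hlip X h h' _ _ hX hh hh' hd (hspec h hh) (hspec h' hh')⟩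
  have hp := hspec h hh
  have hadm := sqrt_mem_adm hη1 hp
  refine ⟨hadm, hp, ?_, tFun_eq_opI hc hadm hh (hfix h _ hh hp)⟩
  obtain ⟨⟨⟨f1, f2⟩, f3, f4⟩, -⟩ := hF δ 0 _ _ h h hδ l1 le_rfl hadm hadm hh hh (by simp)
  rw [hfix h _ hh hp] at f1 f2 f3 f4
  have h1 : C * δ ^ (k + 1) ≤ 2 * C * δ ^ k := by nlinarith [pow_pos hδ k]
  rw [Prod.norm_def, Real.norm_of_nonneg f1.le, Real.norm_of_nonneg f3.le]
  exact max_le (f2.trans h1) (f4.trans h1)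

/-! ### Convergence of the homogeneous solution to the LSW profile. -/

/-- The exponent of `psiRaw` at vanishing couplings, and of `phiRaw` at `δ = 0`. -/
def expo (δ z : ℝ) : ℝ := ∫ y in (0 : ℝ)..z, aCoef δ y * bCoef δ y

theorem psiRaw_zero_eq (δ z : ℝ) : psiRaw δ 0 0 z = Real.exp (-expo δ z) := by
  simp [psiRaw, expo]

theorem phiRaw_eq {z : ℝ} (hz : z < 1 / 2) : phiRaw z = Real.exp (-expo 0 z) := by
  unfold phiRaw expo
  rw [if_pos hz]
  congr 2
  refine intervalIntegral.integral_congr fun y _ => ?_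
  simp only [aCoef, bCoef, sub_zero]
  rw [add_comm y 1]
  ring

theorem phiRaw_of_le {z : ℝ} (hz : 1 / 2 ≤ z) : phiRaw z = 0 := if_neg (not_lt.2 hz)

theorem aCoef_le_of_le {δ y τ : ℝ} (hδ : 0 ≤ δ) (hδ1 : δ ≤ 1) (hτ : 0 < τ) (hy : 0 ≤ y)
    (hyτ : y ≤ 1 / 2 - τ) : 0 < aCoef δ y ∧ aCoef δ y ≤ 20 / τ ^ 2 := by
  have h1 := den_ge_sq hδ hδ1 hy (by linarith)
  have h2 : τ ^ 2 ≤ (y - 1 / 2) ^ 2 := by nlinarith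
  have h3 : τ ^ 2 / 20 ≤ den δ y := by linarith
  have h4 : 0 < τ ^ 2 / 20 := by positivity
  rw [aCoef_eq]
  refine ⟨inv_pos.2 (h4.trans_le h3), (inv_anti₀ h4 h3).trans (le_of_eq (inv_div _ _))⟩

theorem intervalIntegrable_expo {δ z ξ : ℝ} (hδ : 0 ≤ δ) (hδ1 : δ ≤ 1) (hz : 0 ≤ z)
    (hzξ : z ≤ ξ) (hξ : ξ < 1 / 2) :
    IntervalIntegrable (fun y => aCoef δ y * bCoef δ y) volume z ξ := by
  refine (intervalIntegrable_bCoef δ z ξ).continuousOn_mul ?_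
  rw [uIcc_of_le hzξ]
  refine ContinuousOn.div continuousOn_const (continuous_den δ).continuousOn fun y hy => ?_
  have h1 := den_ge_sq hδ hδ1 (hz.trans hy.1) (by linarith [hy.2])
  have h2 : 0 < (y - 1 / 2) ^ 2 := by
    have : y - 1 / 2 < 0 := by linarith [hy.2]
    exact sq_pos_of_neg this
  exact (lt_of_lt_of_le (by linarith) h1).ne'

theorem expo_sub {δ z ξ : ℝ} (hδ : 0 ≤ δ) (hδ1 : δ ≤ 1) (hz : 0 ≤ z) (hzξ : z ≤ ξ)
    (hξ : ξ < 1 / 2) : expo δ ξ - expo δ z = ∫ y in z..ξ, aCoef δ y * bCoef δ y :=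
  intervalIntegral.integral_interval_sub_left
    (intervalIntegrable_expo hδ hδ1 le_rfl (hz.trans hzξ) hξ)
    (intervalIntegrable_expo hδ hδ1 le_rfl hz (hzξ.trans_lt hξ))

/-- From 1/4 on the coefficient is positive, so `psiRaw` without couplings and `phiRaw` both
decrease up to 1/2. Numerically, (1/4)^(-2/3) = 16^(1/3) < 2.6 and 2 - (2/3) · 2.6 > 1/4. -/
theorem bCoef_ge {δ y : ℝ} (hδ : 0 ≤ δ) (hy : 1 / 4 ≤ y) : 1 / 4 ≤ bCoef δ y := by
  have h1 : y ^ (-2 / 3 : ℝ) ≤ (1 / 4 : ℝ) ^ (-2 / 3 : ℝ) :=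
    Real.rpow_le_rpow_of_nonpos (by norm_num) hy (by norm_num)
  have h2 : (1 / 4 : ℝ) ^ (-2 / 3 : ℝ) ≤ 26 / 10 := by
    have e : ((1 / 4 : ℝ) ^ (-2 / 3 : ℝ)) ^ 3 = 16 := by
      rw [← Real.rpow_natCast, ← Real.rpow_mul (by norm_num)]
      rw [show (-2 / 3 : ℝ) * ((3 : ℕ) : ℝ) = ((-2 : ℤ) : ℝ) by norm_num, Real.rpow_intCast]
      norm_num
    by_contra! h
    have h3 := pow_lt_pow_left₀ h (by norm_num) (by norm_num : 3 ≠ 0)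
    rw [e] at h3
    norm_num at h3
  have h4 : 0 ≤ y ^ (-2 / 3 : ℝ) := Real.rpow_nonneg (by linarith) _
  have h5 : (lamLSW - δ) / 3 ≤ 2 / 3 := by linarith [lamLSW_bounds.2]
  unfold bCoef
  nlinarith

theorem expo_mono {δ z ξ : ℝ} (hδ : 0 ≤ δ) (hδ1 : δ ≤ 1) (hz : 1 / 4 ≤ z) (hzξ : z ≤ ξ)
    (hξ : ξ < 1 / 2) : expo δ z ≤ expo δ ξ := by
  have h := expo_sub hδ hδ1 (by linarith) hzξ hξ
  have : 0 ≤ ∫ y in z..ξ, aCoef δ y * bCoef δ y := by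
    refine intervalIntegral.integral_nonneg hzξ fun y hy => ?_
    have h1 := (aCoef_le_of_le (δ := δ) (y := y) (τ := 1 / 2 - ξ) hδ hδ1 (by linarith) (by linarith [hy.1])
      (by linarith [hy.2])).1.le
    have h2 := bCoef_ge hδ (hz.trans hy.1)
    exact mul_nonneg h1 (by linarith)
  linarith

theorem integral_rpow_two_thirds_le {z : ℝ} (hz : 0 ≤ z) (hz1 : z ≤ 1) :
    ∫ y in (0:ℝ)..z, y ^ (-2 / 3 : ℝ) ≤ 3 := by
  rw [integral_rpow (Or.inl (by norm_num))]
  have e5 : z ^ (-2 / 3 + 1 : ℝ) ≤ 1 := Real.rpow_le_one hz hz1 (by norm_num)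
  rw [Real.zero_rpow (by norm_num)]
  norm_num at e5 ⊢
  linarith

theorem expo_ge_of_le_quarter {δ z : ℝ} (hδ : 0 ≤ δ) (hδ1 : δ ≤ 1) (hz : 0 ≤ z) (hz4 : z ≤ 1 / 4) :
    -960 ≤ expo δ z := by
  have hle : ∫ y in (0:ℝ)..z, (-320) * y ^ (-2 / 3 : ℝ) ≤ expo δ z := by
    refine intervalIntegral.integral_mono_on hz
      ((intervalIntegrable_rpow_two_thirds 0 z).const_mul _)
      (intervalIntegrable_expo hδ hδ1 le_rfl hz (by linarith)) fun y hy => ?_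
    obtain ⟨h1, h2⟩ := aCoef_le_of_le (δ := δ) (y := y) (τ := 1 / 4) hδ hδ1 (by norm_num) hy.1
      (by linarith [hy.2])
    have h3 : 0 ≤ y ^ (-2 / 3 : ℝ) := Real.rpow_nonneg hy.1 _
    have h4 : -y ^ (-2 / 3 : ℝ) ≤ bCoef δ y := by
      unfold bCoef
      have : (lamLSW - δ) / 3 ≤ 1 := by linarith [lamLSW_bounds.2]
      nlinarith
    norm_num at h2
    calc (-320) * y ^ (-2 / 3 : ℝ) ≤ aCoef δ y * (-y ^ (-2 / 3 : ℝ)) := by nlinarith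
      _ ≤ _ := by gcongr
  rw [intervalIntegral.integral_const_mul] at hle
  have := integral_rpow_two_thirds_le hz (by linarith)
  linarith

/-- Near 0 the coefficient `bCoef` is negative but integrable, which costs at most 320 · 3 = 960 on
[0, 1/4]; afterwards the exponent increases. -/
theorem expo_ge {δ z : ℝ} (hδ : 0 ≤ δ) (hδ1 : δ ≤ 1) (hz : 0 ≤ z) (hz2 : z < 1 / 2) :
    -960 ≤ expo δ z := by
  rcases le_total z (1 / 4) with h | h
  · exact expo_ge_of_le_quarter hδ hδ1 hz h
  · exact (expo_ge_of_le_quarter hδ hδ1 (by norm_num) le_rfl).trans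
      (expo_mono hδ hδ1 le_rfl h hz2)

theorem expo_le {δ z τ : ℝ} (hδ : 0 ≤ δ) (hδ1 : δ ≤ 1) (hτ : 0 < τ) (hz : 0 ≤ z)
    (hz2 : z ≤ 1 / 2 - τ) : expo δ z ≤ 20 / τ ^ 2 := by
  have hle : expo δ z ≤ ∫ _ in (0:ℝ)..z, 40 / τ ^ 2 := by
    refine intervalIntegral.integral_mono_on hz
      (intervalIntegrable_expo hδ hδ1 le_rfl hz (by linarith)) (by simp) fun y hy => ?_
    obtain ⟨h1, h2⟩ := aCoef_le_of_le (δ := δ) (y := y) hδ hδ1 hτ hy.1 (by linarith [hy.2])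
    have h3 : 0 ≤ y ^ (-2 / 3 : ℝ) := Real.rpow_nonneg hy.1 _
    have h4 : bCoef δ y ≤ 2 := by
      unfold bCoef
      have : 0 ≤ (lamLSW - δ) / 3 := by linarith [lamLSW_bounds.1]
      nlinarith
    calc aCoef δ y * bCoef δ y ≤ aCoef δ y * 2 := by gcongr
      _ ≤ 20 / τ ^ 2 * 2 := by gcongr
      _ = _ := by ring
  rw [intervalIntegral.integral_const, smul_eq_mul, sub_zero] at hle
  refine hle.trans ?_
  have : z ≤ 1 / 2 := by linarith
  calc z * (40 / τ ^ 2) ≤ 1 / 2 * (40 / τ ^ 2) := by gcongr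
    _ = _ := by ring

/-- At distance τ from the singularity the coefficients are Lipschitz in δ up to the integrable
factor 2 + y^(-2/3); two factors `aCoef` ≤ 20/τ^2 give τ^(-4). -/
theorem abs_expo_sub_le {δ z τ : ℝ} (hδ : 0 ≤ δ) (hδ1 : δ ≤ 1) (hτ : 0 < τ) (hτ1 : τ ≤ 1)
    (hz : 0 ≤ z) (hz2 : z ≤ 1 / 2 - τ) : |expo δ z - expo 0 z| ≤ 2000 / τ ^ 4 * δ := by
  unfold expo
  rw [← intervalIntegral.integral_sub (intervalIntegrable_expo hδ hδ1 le_rfl hz (by linarith))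
    (intervalIntegrable_expo le_rfl zero_le_one le_rfl hz (by linarith)), ← Real.norm_eq_abs]
  have hg : IntervalIntegrable (fun y : ℝ => 420 / τ ^ 4 * δ * (2 + y ^ (-2 / 3 : ℝ))) volume 0 z :=
    (intervalIntegrable_const.add (intervalIntegrable_rpow_two_thirds 0 z)).const_mul _
  have h := intervalIntegral.norm_integral_le_of_norm_le hz
    (f := fun y => aCoef δ y * bCoef δ y - aCoef 0 y * bCoef 0 y)
    (Eventually.of_forall fun y hy => by
      obtain ⟨h1, h2⟩ := aCoef_le_of_le (δ := δ) (y := y) hδ hδ1 hτ hy.1.le (by linarith [hy.2])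
      obtain ⟨h3, h4⟩ := aCoef_le_of_le (δ := 0) (y := y) le_rfl zero_le_one hτ hy.1.le
        (by linarith [hy.2])
      have h5 : 0 ≤ y ^ (-2 / 3 : ℝ) := Real.rpow_nonneg hy.1.le _
      have e1 : aCoef δ y - aCoef 0 y = -(δ * y ^ (1 / 3 : ℝ) * (aCoef δ y * aCoef 0 y)) := by
        rw [aCoef_eq, inv_pos] at h1 h3
        rw [aCoef_eq, aCoef_eq]
        field_simp
        unfold den
        ring
      have e2 : bCoef δ y - bCoef 0 y = δ / 3 * y ^ (-2 / 3 : ℝ) := by unfold bCoef; ring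
      have e3 : |bCoef δ y| ≤ 2 + y ^ (-2 / 3 : ℝ) := by
        unfold bCoef
        have l1 : (lamLSW - δ) / 3 ≤ 1 := by linarith [lamLSW_bounds.2]
        have l2 : 0 ≤ (lamLSW - δ) / 3 := by linarith [lamLSW_bounds.1]
        rw [abs_le]
        constructor <;> nlinarith
      have e4 : 0 ≤ y ^ (1 / 3 : ℝ) := Real.rpow_nonneg hy.1.le _
      have e5 : y ^ (1 / 3 : ℝ) ≤ 1 := Real.rpow_le_one hy.1.le (by linarith [hy.2]) (by norm_num)
      have t1 : |aCoef δ y - aCoef 0 y| ≤ δ * (400 / τ ^ 4) := by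
        rw [e1, abs_neg, abs_of_nonneg (by positivity)]
        calc _ ≤ δ * 1 * (20 / τ ^ 2 * (20 / τ ^ 2)) := by gcongr
          _ = _ := by field_simp; norm_num
      have t2 : aCoef 0 y * |bCoef δ y - bCoef 0 y| ≤ 20 / τ ^ 4 * (δ * (2 + y ^ (-2 / 3 : ℝ))) := by
        rw [e2, abs_of_nonneg (by positivity)]
        have hτ4 : τ ^ 4 ≤ τ ^ 2 := pow_le_pow_of_le_one hτ.le hτ1 (by norm_num)
        have : 20 / τ ^ 2 ≤ 20 / τ ^ 4 := by gcongr
        calc _ ≤ 20 / τ ^ 4 * (δ / 3 * y ^ (-2 / 3 : ℝ)) := by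
              gcongr
              exact h4.trans this
          _ ≤ _ := by
              refine mul_le_mul_of_nonneg_left ?_ (by positivity)
              exact mul_le_mul (by linarith) (by linarith) h5 hδ
      have e6 : aCoef δ y * bCoef δ y - aCoef 0 y * bCoef 0 y
          = (aCoef δ y - aCoef 0 y) * bCoef δ y + aCoef 0 y * (bCoef δ y - bCoef 0 y) := by ring
      rw [e6, Real.norm_eq_abs]
      refine (abs_add_le _ _).trans ?_
      rw [abs_mul, abs_mul, abs_of_pos h3]
      calc _ ≤ δ * (400 / τ ^ 4) * (2 + y ^ (-2 / 3 : ℝ))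
            + 20 / τ ^ 4 * (δ * (2 + y ^ (-2 / 3 : ℝ))) := by gcongr
        _ = _ := by ring) hg
  refine h.trans ?_
  rw [intervalIntegral.integral_const_mul, intervalIntegral.integral_add intervalIntegrable_const
    (intervalIntegrable_rpow_two_thirds 0 z), intervalIntegral.integral_const, smul_eq_mul]
  have h1 := integral_rpow_two_thirds_le hz (by linarith)
  calc _ ≤ 420 / τ ^ 4 * δ * (1 + 3) := by
        gcongr
        linarith
    _ ≤ _ := by
        have : 0 ≤ δ / τ ^ 4 := by positivity
        have e : 420 / τ ^ 4 * δ * (1 + 3) = 1680 * (δ / τ ^ 4) := by ring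
        have e' : 2000 / τ ^ 4 * δ = 2000 * (δ / τ ^ 4) := by ring
        linarith

/-- At δ = 0 the integrand is at least (1/40)(1/2 - y)^(-2) on [1/4, 1/2), so the exponent diverges
at 1/2 and `phiRaw` tends to 0 there from the left. -/
theorem expo_zero_ge {τ : ℝ} (hτ : 0 < τ) (hτ4 : τ ≤ 1 / 4) :
    1 / (40 * τ) - 961 ≤ expo 0 (1 / 2 - τ) := by
  have h0 := expo_ge_of_le_quarter (δ := 0) (z := 1 / 4) le_rfl zero_le_one (by norm_num) le_rfl
  have hs := expo_sub (δ := 0) (z := 1 / 4) (ξ := 1 / 2 - τ) le_rfl zero_le_one (by norm_num)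
    (by linarith) (by linarith)
  have hcont : ContinuousOn (fun y : ℝ => 1 / 40 * ((1 / 2 - y) ^ 2)⁻¹)
      (uIcc (1 / 4) (1 / 2 - τ)) := by
    rw [uIcc_of_le (by linarith)]
    refine continuousOn_const.mul (ContinuousOn.inv₀ (by fun_prop) fun y hy => ?_)
    have : 0 < 1 / 2 - y := by linarith [hy.2]
    positivity
  have hI : ∫ y in (1 / 4 : ℝ)..(1 / 2 - τ), 1 / 40 * ((1 / 2 - y) ^ 2)⁻¹
      = 1 / 40 * (1 / 2 - (1 / 2 - τ))⁻¹ - 1 / 40 * (1 / 2 - 1 / 4 : ℝ)⁻¹ := by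
    refine intervalIntegral.integral_eq_sub_of_hasDerivAt
      (f := fun y : ℝ => 1 / 40 * (1 / 2 - y)⁻¹) (fun y hy => ?_) hcont.intervalIntegrable
    rw [uIcc_of_le (by linarith)] at hy
    have hne : 1 / 2 - y ≠ 0 := by linarith [hy.2]
    refine ((((hasDerivAt_id y).const_sub (1 / 2)).inv hne).const_mul (1 / 40)).congr_deriv ?_
    simp only [id]
    field_simp
  have hle : ∫ y in (1 / 4 : ℝ)..(1 / 2 - τ), 1 / 40 * ((1 / 2 - y) ^ 2)⁻¹
      ≤ ∫ y in (1 / 4 : ℝ)..(1 / 2 - τ), aCoef 0 y * bCoef 0 y := by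
    refine intervalIntegral.integral_mono_on (by linarith) hcont.intervalIntegrable
      (intervalIntegrable_expo le_rfl zero_le_one (by norm_num) (by linarith) (by linarith))
      fun y hy => ?_
    have hy2 : 0 < 1 / 2 - y := by linarith [hy.2]
    have h1 := den_le_sq (δ := 0) (z := y) le_rfl (by linarith [hy.1]) (by linarith)
    have h2 := (aCoef_le_of_le (δ := 0) (y := y) le_rfl zero_le_one hτ (by linarith [hy.1]) hy.2).1
    have h3 := bCoef_ge (δ := 0) le_rfl hy.1
    have h4 : 1 / 10 * ((1 / 2 - y) ^ 2)⁻¹ ≤ aCoef 0 y := by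
      rw [aCoef_eq, inv_pos] at h2
      rw [aCoef_eq]
      calc 1 / 10 * ((1 / 2 - y) ^ 2)⁻¹ = (10 * ((y - 1 / 2) ^ 2 + 0))⁻¹ := by
            rw [show (y - 1 / 2) ^ 2 = (1 / 2 - y) ^ 2 by ring, add_zero, mul_inv]; norm_num
        _ ≤ _ := inv_anti₀ h2 h1
    calc 1 / 40 * ((1 / 2 - y) ^ 2)⁻¹ = (1 / 10 * ((1 / 2 - y) ^ 2)⁻¹) * (1 / 4) := by ring
      _ ≤ _ := by gcongr
  rw [hI, sub_sub_cancel] at hle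
  have e : 1 / 40 * τ⁻¹ = 1 / (40 * τ) := by field_simp
  rw [e] at hle
  norm_num at hle h0 hs ⊢
  linarith

theorem phiRaw_nonneg (z : ℝ) : 0 ≤ phiRaw z := by
  unfold phiRaw
  split_ifs
  · exact (Real.exp_pos _).le
  · exact le_rfl

theorem phiRaw_le {z : ℝ} (hz : 0 ≤ z) : phiRaw z ≤ Real.exp 960 := by
  rcases lt_or_ge z (1 / 2) with h | h
  · rw [phiRaw_eq h, Real.exp_le_exp]
    linarith [expo_ge (δ := 0) le_rfl zero_le_one hz h]
  · rw [phiRaw_of_le h]; positivity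

/-- Uniform convergence of the homogeneous solutions to the LSW profile. -/
theorem exists_psiRaw_sub_phiRaw_le {κ : ℝ} (hκ : 0 < κ) : ∃ δ₁ : ℝ, 0 < δ₁ ∧ δ₁ ≤ 1 ∧
    ∀ δ z : ℝ, 0 < δ → δ < δ₁ → 0 ≤ z → z < 1 / 2 → |psiRaw δ 0 0 z - phiRaw z| ≤ κ := by
  set C : ℝ := Real.exp 961 * 40 with hC
  have hC0 : 0 < C := by positivity
  set τ : ℝ := min (1 / 4) (κ / 2 / C) with hτ
  have hτ0 : 0 < τ := by positivity
  have hτ4 : τ ≤ 1 / 4 := min_le_left _ _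
  have hτC : C * τ ≤ κ / 2 := by
    have : τ ≤ κ / 2 / C := min_le_right _ _
    rw [le_div_iff₀ hC0] at this
    linarith
  set K : ℝ := Real.exp 960 * (2000 / τ ^ 4) with hK
  have hK0 : 0 < K := by positivity
  refine ⟨min 1 (κ / 2 / K), by positivity, min_le_left _ _, fun δ z hδ hδ' hz hz2 => ?_⟩
  have hδ1 : δ ≤ 1 := (hδ'.trans_le (min_le_left _ _)).le
  have hδK : K * δ ≤ κ / 2 := by
    have : δ ≤ κ / 2 / K := (hδ'.trans_le (min_le_right _ _)).le
    rw [le_div_iff₀ hK0] at this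
    linarith
  have hin : ∀ z, 0 ≤ z → z ≤ 1 / 2 - τ → |psiRaw δ 0 0 z - phiRaw z| ≤ κ / 2 := by
    intro z hz hzτ
    have hz2 : z < 1 / 2 := by linarith
    rw [psiRaw_zero_eq, phiRaw_eq hz2]
    have h1 := abs_exp_sub_exp_le (M := 960)
      (by linarith [expo_ge hδ.le hδ1 hz hz2] : -expo δ z ≤ 960)
      (by linarith [expo_ge le_rfl zero_le_one hz hz2] : -expo 0 z ≤ 960)
    have h2 := abs_expo_sub_le hδ.le hδ1 hτ0 (by linarith) hz hzτ
    rw [show -expo δ z - -expo 0 z = -(expo δ z - expo 0 z) by ring, abs_neg] at h1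
    calc _ ≤ Real.exp 960 * (2000 / τ ^ 4 * δ) := h1.trans (by gcongr)
      _ = K * δ := by rw [hK]; ring
      _ ≤ _ := hδK
  -- In the layer next to 1/2 the convergence is not Lipschitz in δ, but both functions decrease and
  -- are already small at 1/2 - τ.
  rcases le_total z (1 / 2 - τ) with h | h
  · exact (hin z hz h).trans (by linarith)
  · have h1 := hin (1 / 2 - τ) (by linarith) le_rfl
    have h2 : phiRaw (1 / 2 - τ) ≤ κ / 2 := by
      refine le_trans ?_ hτC
      rw [phiRaw_eq (by linarith)]
      have h3 := expo_zero_ge hτ0 hτ4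
      have h4 : Real.exp (-(1 / (40 * τ))) ≤ 40 * τ := by
        rw [Real.exp_neg]
        have h5 := Real.add_one_le_exp (1 / (40 * τ))
        calc (Real.exp (1 / (40 * τ)))⁻¹ ≤ (1 / (40 * τ))⁻¹ := by
              apply inv_anti₀ (by positivity); linarith
          _ = _ := by rw [one_div, inv_inv]
      calc Real.exp (-expo 0 (1 / 2 - τ)) ≤ Real.exp (961 + -(1 / (40 * τ))) :=
            Real.exp_le_exp.2 (by linarith)
        _ = Real.exp 961 * Real.exp (-(1 / (40 * τ))) := Real.exp_add _ _
        _ ≤ Real.exp 961 * (40 * τ) := by gcongr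
        _ = C * τ := by rw [hC]; ring
    have h3 : phiRaw z ≤ phiRaw (1 / 2 - τ) := by
      rw [phiRaw_eq hz2, phiRaw_eq (by linarith), Real.exp_le_exp, neg_le_neg_iff]
      exact expo_mono le_rfl zero_le_one (by linarith) h hz2
    have h4 : psiRaw δ 0 0 z ≤ psiRaw δ 0 0 (1 / 2 - τ) := by
      rw [psiRaw_zero_eq, psiRaw_zero_eq, Real.exp_le_exp, neg_le_neg_iff]
      exact expo_mono hδ.le hδ1 (by linarith) h hz2
    have h5 := phiRaw_nonneg z
    have h6 := (psiRaw_pos δ 0 0 z).le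
    rw [abs_le] at h1 ⊢
    constructor <;> linarith [h1.2]

/-- The volume of the unnormalised LSW profile. -/
def volLSW : ℝ := ∫ y in (0 : ℝ)..(1 / 2), y * phiRaw y

theorem phiLSW_eq (z : ℝ) : phiLSW z = phiRaw z / volLSW := rfl

theorem continuousOn_phiRaw : ContinuousOn phiRaw (Ico 0 (1 / 2)) := by
  have h : ContinuousOn (fun z => Real.exp (-expo 0 z)) (Ico 0 (1 / 2)) := by
    refine ContinuousOn.rexp (ContinuousOn.neg ?_)
    intro z hz
    have hb : (z + 1 / 2) / 2 < 1 / 2 := by linarith [hz.2]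
    have hzb : z < (z + 1 / 2) / 2 := by linarith [hz.2]
    have hi := intervalIntegrable_expo (δ := 0) (z := 0) (ξ := (z + 1 / 2) / 2) le_rfl zero_le_one
      le_rfl (by linarith [hz.1]) hb
    have hc := intervalIntegral.continuousOn_primitive_interval' hi left_mem_uIcc
    rw [uIcc_of_le (by linarith [hz.1])] at hc
    refine (hc z ⟨hz.1, hzb.le⟩).mono_of_mem_nhdsWithin ?_
    exact mem_of_superset (inter_mem_nhdsWithin _ (Iio_mem_nhds hzb))
      fun y hy => ⟨hy.1.1, (mem_Iio.1 hy.2).le⟩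
  exact h.congr fun z hz => phiRaw_eq hz.2

theorem phiRaw_meas : AEStronglyMeasurable phiRaw (volume.restrict (Ioi 0)) := by
  have e : phiRaw = indicator (Iio (1 / 2)) phiRaw := by
    ext z
    by_cases hz : z < 1 / 2
    · rw [indicator_of_mem (show z ∈ Iio (1 / 2 : ℝ) from hz)]
    · rw [indicator_of_notMem (show z ∉ Iio (1 / 2 : ℝ) from hz), phiRaw_of_le (not_lt.1 hz)]
  rw [e, aestronglyMeasurable_indicator_iff measurableSet_Iio,
    Measure.restrict_restrict measurableSet_Iio]
  refine (continuousOn_phiRaw.mono fun z hz => ⟨le_of_lt hz.2, hz.1⟩).aestronglyMeasurable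
    (measurableSet_Iio.inter measurableSet_Ioi)

theorem exists_phiRaw_memW {β₁ β₂ : ℝ} (hβ₁ : 0 ≤ β₁) (hβ₂ : 0 ≤ β₂) :
    ∃ K : ℝ, 0 < K ∧ MemW β₁ β₂ K phiRaw := by
  have hw0 := wt_pos β₁ β₂ (by norm_num : (0:ℝ) ≤ 1 / 2)
  refine ⟨Real.exp 960 / wt β₁ β₂ (1 / 2), by positivity, phiRaw_meas, fun z hz => ?_⟩
  rw [abs_of_nonneg (phiRaw_nonneg z)]
  rcases lt_or_ge z (1 / 2) with h | h
  · have hw : 1 ≤ wt β₁ β₂ z / wt β₁ β₂ (1 / 2) := by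
      rw [one_le_div hw0]; exact wt_anti hβ₁ hβ₂ hz h.le
    calc phiRaw z ≤ Real.exp 960 := phiRaw_le hz
      _ ≤ Real.exp 960 * (wt β₁ β₂ z / wt β₁ β₂ (1 / 2)) :=
          le_mul_of_one_le_right (by positivity) hw
      _ = _ := by ring
  · rw [phiRaw_of_le h]
    have := wt_pos β₁ β₂ hz
    positivity

theorem integral_Ioi_mul_phiRaw : ∫ z in Ioi (0:ℝ), z * phiRaw z = volLSW := by
  rw [volLSW, intervalIntegral.integral_of_le (by norm_num)]
  refine setIntegral_eq_of_subset_of_forall_sdiff_eq_zero measurableSet_Ioi Ioc_subset_Ioi_self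
    fun z hz => ?_
  have : 1 / 2 ≤ z := by
    by_contra! h
    exact hz.2 ⟨hz.1, h.le⟩
  rw [phiRaw_of_le this, mul_zero]

theorem le_phiRaw {z : ℝ} (hz : 0 ≤ z) (hz2 : z ≤ 12 / 25) : Real.exp (-50000) ≤ phiRaw z := by
  rw [phiRaw_eq (by linarith), Real.exp_le_exp]
  have := expo_le (δ := 0) (z := z) (τ := 1 / 50) le_rfl zero_le_one (by norm_num) hz (by linarith)
  norm_num at this
  linarith

theorem volLSW_pos : 0 < volLSW := by
  have hint : IntervalIntegrable (fun y => y * phiRaw y) volume 0 (1 / 2) := by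
    obtain ⟨K, -, hK⟩ := exists_phiRaw_memW (β₁ := 1) (β₂ := 1) (by norm_num) (by norm_num)
    obtain ⟨C, -, h⟩ := exists_moment_bound (β₁ := 1) (β₂ := 1) (by norm_num) (by norm_num)
    rw [intervalIntegrable_iff_integrableOn_Ioc_of_le (by norm_num)]
    exact (h K phiRaw (fun z => z) hK aestronglyMeasurable_id
      (fun z hz => by rw [abs_of_pos hz]; nlinarith)).1.mono_set Ioc_subset_Ioi_self
  refine intervalIntegral.intervalIntegral_pos_of_pos_on hint (fun y hy => ?_) (by norm_num)
  rw [phiRaw_eq hy.2]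
  exact mul_pos hy.1 (Real.exp_pos _)

theorem exists_phiLSW_memW {β₁ β₂ : ℝ} (hβ₁ : 0 ≤ β₁) (hβ₂ : 0 ≤ β₂) :
    ∃ K : ℝ, 0 < K ∧ MemW β₁ β₂ K phiLSW := by
  obtain ⟨K, hK, h⟩ := exists_phiRaw_memW hβ₁ hβ₂
  have hv := volLSW_pos
  refine ⟨K / volLSW, by positivity, ?_, fun z hz => ?_⟩
  · have : phiLSW = fun z => volLSW⁻¹ * phiRaw z := by
      ext z; rw [phiLSW_eq, div_eq_inv_mul]
    rw [this]
    exact h.meas.const_mul _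
  · rw [phiLSW_eq, abs_div, abs_of_pos hv, div_mul_eq_mul_div]
    exact div_le_div_of_nonneg_right (h.bound z hz) hv.le

theorem phiLSW_nonneg (z : ℝ) : 0 ≤ phiLSW z := div_nonneg (phiRaw_nonneg z) volLSW_pos.le

/-! ### Lower bound on the amplitude near the LSW profile. -/

theorem conv_nonneg {f g : ℝ → ℝ} {z : ℝ} (hz : 0 ≤ z) (hf : ∀ y, 0 ≤ y → 0 ≤ f y)
    (hg : ∀ y, 0 ≤ y → 0 ≤ g y) : 0 ≤ conv f g z := by
  unfold conv
  refine mul_nonneg (by norm_num) (intervalIntegral.integral_nonneg hz fun y hy => ?_)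
  exact mul_nonneg (hf _ (by linarith [hy.2])) (hg _ hy.1)

/-- For ξ in [3/5, 7/10] and y in [21/50, 12/25], an interval of length 3/50, both y and ξ - y stay
in [0, 12/25], where the profile is bounded below. Thus the source is positive beyond 1/2, where it
feeds the amplitude. -/
theorem exists_le_conv_phiLSW : ∃ c : ℝ, 0 < c ∧ ∀ ξ : ℝ, 3 / 5 ≤ ξ → ξ ≤ 7 / 10 →
    c ≤ conv phiLSW phiLSW ξ := by
  have hv := volLSW_pos
  set b : ℝ := Real.exp (-50000) / volLSW with hb
  have hb0 : 0 < b := by positivity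
  obtain ⟨K, -, hK⟩ := exists_phiLSW_memW (β₁ := 1) (β₂ := 2) (by norm_num) (by norm_num)
  refine ⟨1 / 2 * (3 / 50 * b ^ 2), by positivity, fun ξ h1 h2 => ?_⟩
  have hlow : ∀ z, 0 ≤ z → z ≤ 12 / 25 → b ≤ phiLSW z := fun z hz hz2 =>
    div_le_div_of_nonneg_right (le_phiRaw hz hz2) hv.le
  have hint := hK.convIntegrand_integrable (by norm_num) hK (z := ξ) (by linarith)
  unfold conv
  refine mul_le_mul_of_nonneg_left ?_ (by norm_num)
  have hsub : ∫ y in (21 / 50 : ℝ)..(12 / 25), phiLSW (ξ - y) * phiLSW y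
      ≤ ∫ y in (0:ℝ)..ξ, phiLSW (ξ - y) * phiLSW y := by
    refine intervalIntegral.integral_mono_interval (by norm_num) (by norm_num) (by linarith) ?_ hint
    exact Eventually.of_forall fun y => mul_nonneg (phiLSW_nonneg _) (phiLSW_nonneg _)
  refine le_trans ?_ hsub
  have hconst : ∫ _ in (21 / 50 : ℝ)..(12 / 25), b ^ 2 = 3 / 50 * b ^ 2 := by
    rw [intervalIntegral.integral_const, smul_eq_mul]; norm_num
  rw [← hconst]
  refine intervalIntegral.integral_mono_on (by norm_num) (by simp)
    (hint.mono_set ?_) fun y hy => ?_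
  · rw [uIcc_of_le (by norm_num), uIcc_of_le (by linarith)]
    exact Icc_subset_Icc (by norm_num) (by linarith)
  · rw [sq]
    refine mul_le_mul (hlow _ (by linarith [hy.2]) (by linarith [hy.1]))
      (hlow _ (by linarith [hy.1]) hy.2) hb0.le (phiLSW_nonneg _)

/-- Lower bound for the amplitude of sources that are bounded below on `[3/5, 7/10]` up to a small
weighted error. -/
theorem exists_gInt_lower {β₁ β₂ : ℝ} (hβ₁ : 0 < β₁) (hβ₂ : 0 ≤ β₂) {c₁ : ℝ} (hc₁ : 0 < c₁) :
    ∃ θ : ℝ, 0 < θ ∧ ∃ c : ℝ, 0 < c ∧ ∀ (H δ : ℝ) (h h₀ : ℝ → ℝ), 0 < δ → δ ≤ 1 →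
      MemW β₁ β₂ H h → (∀ ξ, 0 ≤ ξ → 0 ≤ h₀ ξ) → (∀ ξ, 3 / 5 ≤ ξ → ξ ≤ 7 / 10 → c₁ ≤ h₀ ξ) →
      (∀ ξ, 0 ≤ ξ → |h ξ - h₀ ξ| ≤ θ * wt β₁ β₂ ξ) → GoodH β₁ β₂ H c δ h := by
  obtain ⟨C, hC, hker⟩ := exists_ker_zero_le
  obtain ⟨a, ha, hlow⟩ := exists_le_ker_zero
  obtain ⟨Cm, hCm, hm⟩ := exists_moment_bound (β₁ := β₁) (β₂ := β₂) hβ₁ hβ₂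
  obtain ⟨_, _, hg⟩ := exists_gInt_bound (β₁ := β₁) (β₂ := β₂) hβ₁ hβ₂
  -- The interval [3/5, 7/10] contributes a c₁/10 times `kerSize δ`; θ is chosen so that the
  -- perturbation removes at most half of it.
  refine ⟨a * c₁ / 20 / (C * Cm), by positivity, a * c₁ / 20, by positivity,
    fun H δ h h₀ hδ hδ1 hh hh₀ hc hd => ⟨hh, fun p hp => ?_⟩⟩
  set θ : ℝ := a * c₁ / 20 / (C * Cm) with hθ
  have hθ0 : 0 < θ := by positivity
  have hN := kerSize_pos δ
  have hint := (hg δ H 0 p p h h hδ hδ1 le_rfl hp hp hh hh (by simp)).1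
  have hwt : MemW β₁ β₂ 1 (wt β₁ β₂) :=
    ⟨((continuousOn_wt β₁ β₂).mono Ioi_subset_Ici_self).aestronglyMeasurable measurableSet_Ioi,
      fun z hz => by rw [abs_of_pos (wt_pos _ _ hz), one_mul]⟩
  obtain ⟨i3, b3⟩ := hm _ _ (fun z => (1 + z) ^ 2) hwt
    (Continuous.aestronglyMeasurable (by fun_prop)) (fun z hz => by rw [abs_of_nonneg (by positivity)])
  have hind : IntegrableOn (indicator (Icc (3 / 5 : ℝ) (7 / 10)) fun _ => a * kerSize δ * c₁)
      (Ioi 0) := by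
    refine Integrable.integrableOn ?_
    rw [integrable_indicator_iff measurableSet_Icc]
    exact continuousOn_const.integrableOn_Icc
  have hle : ∫ z in Ioi (0:ℝ), (indicator (Icc (3 / 5 : ℝ) (7 / 10)) (fun _ => a * kerSize δ * c₁) z
      - C * kerSize δ * θ * ((1 + z) ^ 2 * wt β₁ β₂ z)) ≤ gInt δ p h := by
    refine setIntegral_mono_on (Integrable.sub hind (i3.const_mul _)) hint measurableSet_Ioi
      fun z hz => ?_
    have hz0 : (0:ℝ) < z := hz
    have hw := (wt_pos β₁ β₂ hz0.le).le
    have k0 : 0 ≤ kerG δ p z := indicator_apply_nonneg fun _ => ker_nonneg p hδ hz0.le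
    have k1 : kerG δ p z ≤ C * kerSize δ * (1 + z) ^ 2 := by
      refine (le_abs_self _).trans (abs_indicator_le (by positivity) fun _ => ?_)
      rw [abs_of_nonneg (ker_nonneg p hδ hz0.le)]
      exact hker δ z p hp hδ hδ1 hz0.le
    have h1 : h₀ z - θ * wt β₁ β₂ z ≤ h z := by linarith [(abs_le.1 (hd z hz0.le)).1]
    have h2 : indicator (Icc (3 / 5 : ℝ) (7 / 10)) (fun _ => a * kerSize δ * c₁) z
        ≤ kerG δ p z * h₀ z := by
      by_cases hmem : z ∈ Icc (3 / 5 : ℝ) (7 / 10)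
      · rw [indicator_of_mem hmem]
        have : kerG δ p z = ker δ p 0 z := indicator_of_mem
          (show z ∈ Ioi (1 / 2 : ℝ) from lt_of_lt_of_le (by norm_num) hmem.1) _
        rw [this]
        have := hlow δ z p hp hδ hδ1 hmem.1 hmem.2
        have := hc z hmem.1 hmem.2
        have := ker_nonneg (z := 0) p hδ hz0.le
        gcongr
      · rw [indicator_of_notMem hmem]
        exact mul_nonneg k0 (hh₀ z hz0.le)
    have h3 : kerG δ p z * (θ * wt β₁ β₂ z) ≤ C * kerSize δ * (1 + z) ^ 2 * (θ * wt β₁ β₂ z) := by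
      gcongr
    have h4 := mul_le_mul_of_nonneg_left h1 k0
    linarith
  refine le_trans ?_ hle
  have hsub : Icc (3 / 5 : ℝ) (7 / 10) ⊆ Ioi 0 := fun z hz => lt_of_lt_of_le (by norm_num) hz.1
  rw [integral_sub hind (i3.const_mul _), integral_const_mul,
    setIntegral_indicator measurableSet_Icc, inter_eq_self_of_subset_right hsub,
    setIntegral_const, measureReal_def, Real.volume_Icc, ENNReal.toReal_ofReal (by norm_num),
    smul_eq_mul]
  have h7 : ∫ z in Ioi (0:ℝ), (1 + z) ^ 2 * wt β₁ β₂ z ≤ Cm := by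
    have := (le_abs_self _).trans b3
    linarith
  have h8 : C * kerSize δ * θ * ∫ z in Ioi (0:ℝ), (1 + z) ^ 2 * wt β₁ β₂ z
      ≤ C * kerSize δ * θ * Cm := by gcongr
  have h9 : C * kerSize δ * θ * Cm = a * c₁ / 20 * kerSize δ := by
    rw [hθ]; field_simp
  linarith

/-- Profiles near the LSW profile have good sources. -/
theorem exists_goodH {β₁ β₂ : ℝ} (hβ₁ : 0 < β₁) (hβ₂ : 1 < β₂) :
    ∃ ρ : ℝ, 0 < ρ ∧ ∃ K : ℝ, 0 < K ∧ ∃ H : ℝ, 0 < H ∧ ∃ c : ℝ, 0 < c ∧ ∀ Φ : ℝ → ℝ,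
      AEStronglyMeasurable Φ (volume.restrict (Ioi 0)) →
      (∀ z, 0 ≤ z → |Φ z - phiLSW z| ≤ ρ * wt β₁ β₂ z) →
      MemW β₁ β₂ K Φ ∧ ∀ δ, 0 < δ → δ ≤ 1 → GoodH β₁ β₂ H c δ (conv Φ Φ) := by
  have hβ₂' : 0 ≤ β₂ := by linarith
  obtain ⟨K₀, hK₀, hL⟩ := exists_phiLSW_memW (β₁ := β₁) (β₂ := β₂) hβ₁.le hβ₂'
  obtain ⟨c₁, hc₁, hlow⟩ := exists_le_conv_phiLSW
  obtain ⟨θ, hθ, c, hc, hgood⟩ := exists_gInt_lower (β₁ := β₁) (β₂ := β₂) hβ₁ hβ₂' hc₁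
  obtain ⟨C₁, hC₁, hconv⟩ := exists_conv_memW (β₁ := β₁) (β₂ := β₂) hβ₁ hβ₂
  obtain ⟨C₂, hC₂, hsub⟩ := exists_conv_self_sub_le (β₁ := β₁) (β₂ := β₂) hβ₁ hβ₂
  -- The radius at which the change of Φ * Φ stays below the tolerance θ.
  set ρ : ℝ := min 1 (θ / (C₂ * (K₀ + 1))) with hρ
  have hρ0 : 0 < ρ := by positivity
  refine ⟨ρ, hρ0, K₀ + 1, by positivity, C₁ * ((K₀ + 1) * (K₀ + 1)), by positivity, c, hc,
    fun Φ hΦ hd => ?_⟩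
  have hdiff : MemW β₁ β₂ ρ (Φ - phiLSW) := ⟨hΦ.sub hL.meas, hd⟩
  have hmem : MemW β₁ β₂ (K₀ + 1) Φ := by
    have h1 := (hL.add hdiff).mono (K' := K₀ + 1) (by linarith [min_le_left 1 (θ / (C₂ * (K₀ + 1)))])
    rwa [add_sub_cancel] at h1
  refine ⟨hmem, fun δ hδ hδ1 => hgood _ δ _ (conv phiLSW phiLSW) hδ hδ1 (hconv _ _ _ _ hmem hmem)
    (fun ξ hξ => conv_nonneg hξ (fun y _ => phiLSW_nonneg y) fun y _ => phiLSW_nonneg y) hlow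
    fun ξ hξ => ?_⟩
  refine (hsub (K₀ + 1) ρ Φ phiLSW hmem (hL.mono (by linarith)) hdiff ξ hξ).trans ?_
  have h1 : C₂ * ((K₀ + 1) * ρ) ≤ θ := by
    have : ρ ≤ θ / (C₂ * (K₀ + 1)) := min_le_right _ _
    rw [le_div_iff₀ (by positivity)] at this
    linarith
  have := (wt_pos β₁ β₂ hξ).le
  gcongr

/-! ### Closeness of the normalised solution to the LSW profile. -/

/-- The normalised solutions are close to the LSW profile. -/
theorem exists_tFun_sub_phiLSW_le {β₁ β₂ H c C : ℝ} (hβ₁ : 0 < β₁) (hβ₂ : 0 ≤ β₂) (hH : 0 ≤ H)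
    (hc : 0 < c) (hC : 0 < C) {κ : ℝ} (hκ : 0 < κ) : ∃ δ₁ : ℝ, 0 < δ₁ ∧ δ₁ ≤ 1 ∧
      ∀ (δ z : ℝ) (p : ℝ × ℝ) (h : ℝ → ℝ), 0 < δ → δ < δ₁ → 0 ≤ z → Adm δ p →
      GoodH β₁ β₂ H c δ h → ‖p‖ ≤ C * δ ^ 4 → |tFun δ p h z - phiLSW z| ≤ κ * wt β₁ β₂ z := by
  obtain ⟨Cu, hCu, hu⟩ := exists_uFun_bound (β₁ := β₁) (β₂ := β₂) hβ₁ hβ₂ hH hc 1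
  obtain ⟨Cl, hCl, hl⟩ := exists_abs_lead_le (β₁ := β₁) (β₂ := β₂) hβ₁.le hβ₂
  obtain ⟨Cm, hCm, hm⟩ := exists_moment_bound (β₁ := β₁) (β₂ := β₂) hβ₁ hβ₂
  obtain ⟨C', -, c₀, hc₀, δ₂, hδ₂, hδ₂', hmom⟩ :=
    exists_mom_bound (β₁ := β₁) (β₂ := β₂) hβ₁ hβ₂ hH hc 0
  obtain ⟨K, hK, hphi⟩ := exists_phiRaw_memW (β₁ := β₁) (β₂ := β₂) hβ₁.le hβ₂
  have hv := volLSW_pos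
  have hw0 := wt_pos β₁ β₂ (by norm_num : (0:ℝ) ≤ 1 / 2)
  set m : ℝ := min c₀ volLSW with hm_def
  have hm0 : 0 < m := by positivity
  -- The factor by which the error κ₁ of `uFun` grows under division by the volume, whose own error
  -- is at most Cm κ₁.
  set E : ℝ := 1 / m + K * Cm / m ^ 2 with hE
  have hE0 : 0 < E := by positivity
  set κ₁ : ℝ := κ / E with hκ₁
  have hκ₁0 : 0 < κ₁ := by positivity
  obtain ⟨δ₃, hδ₃, hδ₃', hlim⟩ := exists_psiRaw_sub_phiRaw_le (κ := κ₁ / 2 * wt β₁ β₂ (1 / 2))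
    (by positivity)
  refine ⟨min (min δ₂ δ₃) (κ₁ / 2 / (Cu + Cl * C)), by positivity,
    (min_le_left _ _).trans ((min_le_left _ _).trans hδ₂'), fun δ z p h hδ hδ' hz hp hh hpn => ?_⟩
  have l2 : δ < δ₂ := hδ'.trans_le ((min_le_left _ _).trans (min_le_left _ _))
  have l3 : δ < δ₃ := hδ'.trans_le ((min_le_left _ _).trans (min_le_right _ _))
  have l4 : δ < κ₁ / 2 / (Cu + Cl * C) := hδ'.trans_le (min_le_right _ _)
  rw [lt_div_iff₀ (by positivity)] at l4
  have hδ1 : δ ≤ 1 := l2.le.trans hδ₂'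
  have h0 : Adm δ (0, 0) := ⟨⟨le_rfl, Real.sqrt_nonneg _⟩, le_rfl, Real.sqrt_nonneg _⟩
  have hclose : ∀ z, 0 ≤ z → |uFun δ p h z - phiRaw z| ≤ κ₁ * wt β₁ β₂ z := by
    intro z hz
    have hw := (wt_pos β₁ β₂ hz).le
    have t1 := (hu δ z 0 p p h h hδ hδ1 hz le_rfl hp hp hh hh (by simp)).1
    have t2 := (hl δ z p (0, 0) hp h0 hδ hδ1 hz).2
    have t3 : |lead δ (0, 0) z - phiRaw z| ≤ κ₁ / 2 * wt β₁ β₂ z := by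
      unfold lead
      split_ifs with hlt
      · refine (hlim δ z hδ l3 hz hlt).trans ?_
        have := wt_anti hβ₁.le hβ₂ hz hlt.le
        gcongr
      · rw [phiRaw_of_le (not_lt.1 hlt), sub_zero, abs_zero]
        positivity
    have e : uFun δ p h z - phiRaw z = (uFun δ p h z - lead δ p z)
      + ((lead δ p z - lead δ (0, 0) z) + (lead δ (0, 0) z - phiRaw z)) := by ring
    rw [pow_one] at t1
    -- Couplings of size δ^4 beat the δ^(-3) in the variation of `lead`.
    have t4 : Cl / δ ^ 3 * ‖p - (0, 0)‖ * wt β₁ β₂ z ≤ Cl * C * δ * wt β₁ β₂ z := by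
      have : p - (0, 0) = p := sub_zero p
      rw [this]
      calc _ ≤ Cl / δ ^ 3 * (C * δ ^ 4) * wt β₁ β₂ z := by gcongr
        _ = _ := by field_simp
    rw [e]
    refine (abs_add_le _ _).trans ?_
    have t5 := abs_add_le (lead δ p z - lead δ (0, 0) z) (lead δ (0, 0) z - phiRaw z)
    have t6 : δ * (Cu + Cl * C) * wt β₁ β₂ z ≤ κ₁ / 2 * wt β₁ β₂ z := by gcongr
    linarith
  obtain ⟨i1, m1, -, -⟩ := hmom δ 0 p p h h _ hδ l2 le_rfl hp hp hh hh (by simp) momWeight_id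
  have hdiff : MemW β₁ β₂ κ₁ (uFun δ p h - phiRaw) :=
    ⟨(uFun_meas hβ₁ hβ₂ hδ hδ1 hp hh).sub phiRaw_meas, hclose⟩
  have hid : ∀ z : ℝ, 0 < z → |z| ≤ (1 + z) ^ 2 := fun z hz => by
    rw [abs_of_pos hz]; nlinarith
  have hU : |(mom δ p h fun z => z) - volLSW| ≤ Cm * κ₁ := by
    have h1 := (hm _ _ (fun z => z) hdiff aestronglyMeasurable_id hid).2
    have i2 := (hm _ _ (fun z => z) hphi aestronglyMeasurable_id hid).1
    rw [← integral_Ioi_mul_phiRaw, mom, ← integral_sub i1 i2]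
    simpa only [Pi.sub_apply, mul_sub] using h1
  have hw := (wt_pos β₁ β₂ hz).le
  rw [tFun, phiLSW_eq]
  refine (abs_div_sub_div_le hm0 ((min_le_left _ _).trans m1) (min_le_right _ _)).trans ?_
  calc _ ≤ κ₁ * wt β₁ β₂ z / m + K * wt β₁ β₂ z * (Cm * κ₁) / m ^ 2 := by
        gcongr
        · exact hclose z hz
        · exact hphi.bound z hz
    _ = E * κ₁ * wt β₁ β₂ z := by rw [hE]; ring
    _ = _ := by rw [hκ₁, mul_div_cancel₀ _ hE0.ne']

/-! ### Regularity of fixed points and the stationary equation. -/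

/-- Replacing the arguments by their positive parts makes the integrand jointly continuous without
changing the integral for z ≥ 0. -/
theorem continuousOn_conv {f g : ℝ → ℝ} (hf : ContinuousOn f (Ici 0)) (hg : ContinuousOn g (Ici 0)) :
    ContinuousOn (conv f g) (Ici 0) := by
  have hext : ∀ {f : ℝ → ℝ}, ContinuousOn f (Ici 0) → Continuous fun x => f (max x 0) :=
    fun hf => hf.comp_continuous (by fun_prop) fun x => le_max_right x 0
  have h : Continuous fun z => 1 / 2 * ∫ y in (0:ℝ)..z, f (max (z - y) 0) * g (max y 0) := by
    refine continuous_const.mul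
      (intervalIntegral.continuous_parametric_intervalIntegral_of_continuous (s := fun z => z) ?_
        continuous_id)
    have h1 := (hext hf).comp (continuous_fst.sub continuous_snd : Continuous fun p : ℝ × ℝ => p.1 - p.2)
    have h2 := (hext hg).comp (continuous_snd : Continuous fun p : ℝ × ℝ => p.2)
    exact h1.mul h2
  refine h.continuousOn.congr fun z hz => ?_
  unfold conv
  congr 1
  refine intervalIntegral.integral_congr fun y hy => ?_
  rw [uIcc_of_le hz] at hy
  simp only [max_eq_left hy.1, max_eq_left (sub_nonneg.2 hy.2)]

theorem hasDerivAt_psiRaw {δ : ℝ} (hδ : 0 < δ) (p : ℝ × ℝ) {z : ℝ} (hz : 0 < z) :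
    HasDerivAt (psiRaw δ p.1 p.2)
      (-(aCoef δ z * (bCoef δ z - p.2 * z - p.1)) * psiRaw δ p.1 p.2 z) z := by
  have h0 : ∀ z, psiRaw δ p.1 p.2 z = psi δ p.1 p.2 z / psi δ p.1 p.2 0 := fun z => by
    rw [psi_div_psi p hδ, psiRaw_zero_eq_one, div_one]
  have h := (hasDerivAt_psi hδ p.1 p.2 hz).div_const (psi δ p.1 p.2 0)
  rw [h0 z, ← mul_div_assoc]
  exact h.congr_of_eventuallyEq (Eventually.of_forall h0)

/-- The variation of constants formula solves the inhomogeneous equation. -/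
theorem hasDerivAt_varConst {β₁ β₂ H δ : ℝ} {p : ℝ × ℝ} {h : ℝ → ℝ} (hβ₁ : 0 < β₁) (hβ₂ : 0 ≤ β₂)
    (hδ : 0 < δ) (hδ1 : δ ≤ 1) (hp : Adm δ p) (hh : MemW β₁ β₂ H h)
    (hcont : ContinuousOn h (Ici 0)) {z : ℝ} (hz : 0 < z) :
    HasDerivAt (varConst δ p.1 p.2 h)
      (-(aCoef δ z * (bCoef δ z - p.2 * z - p.1)) * varConst δ p.1 p.2 h z
        - p.1 * (z * aCoef δ z * h z)) z := by
  have hi := integrableOn_ker_mul hβ₁ hβ₂ hδ hδ1 le_rfl hp hh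
  have hii : ∀ z, 0 ≤ z → IntervalIntegrable (fun ξ => ker δ p 0 ξ * h ξ) volume 0 z := fun z hz => by
    rw [intervalIntegrable_iff_integrableOn_Ioc_of_le hz]
    exact hi.mono_set Ioc_subset_Ioi_self
  have hkc : ContinuousOn (fun ξ => ker δ p 0 ξ * h ξ) (Ioi 0) :=
    ((continuousOn_ker p hδ 0).mul hcont).mono Ioi_subset_Ici_self
  have hd := intervalIntegral.integral_hasDerivAt_right (hii z hz.le)
    (hkc.stronglyMeasurableAtFilter isOpen_Ioi z hz) (hkc.continuousAt (Ioi_mem_nhds hz))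
  -- The rank-one form `psiRaw` times (constant minus primitive), ready for the product rule.
  have heq : ∀ y, 0 < y → varConst δ p.1 p.2 h y = p.1 * (psiRaw δ p.1 p.2 y *
      ((∫ ξ in Ioi 0, ker δ p 0 ξ * h ξ) - ∫ ξ in (0:ℝ)..y, ker δ p 0 ξ * h ξ)) := fun y hy => by
    rw [varConst_eq, jInt_eq_mul hδ, ← intervalIntegral.integral_interval_add_Ioi (a := 0) (b := y) hi
      (hi.mono_set (Ioi_subset_Ioi hy.le))]
    ring
  have h2 := ((hasDerivAt_psiRaw hδ p hz).mul
    ((hasDerivAt_const z (∫ ξ in Ioi 0, ker δ p 0 ξ * h ξ)).sub hd)).const_mul p.1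
  have h3 : psiRaw δ p.1 p.2 z * ker δ p 0 z = z * aCoef δ z := by
    rw [← ker_factor p hδ, ker, div_self (psi_pos p hδ z).ne', mul_one]
  refine (h2.congr_of_eventuallyEq ?_).congr_deriv ?_
  · filter_upwards [Ioi_mem_nhds hz] with y hy using heq y hy
  · rw [heq z hz, ← h3]
    simp only [Pi.sub_apply]
    ring

/-- Expand z^2 = (z - t)^2 + 2 t (z - t) + t^2 under the convolution and apply Fubini to each term;
the factor 1/2 in `conv` merges the two outer terms. -/
theorem integral_sq_mul_conv {β₁ β₂ K : ℝ} {Φ : ℝ → ℝ} (hβ₁ : 0 < β₁) (hβ₂ : 0 ≤ β₂)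
    (hΦ : MemW β₁ β₂ K Φ) (hcont : ContinuousOn Φ (Ici 0)) :
    ∫ z in Ioi (0:ℝ), z ^ 2 * conv Φ Φ z =
      (∫ z in Ioi (0:ℝ), z ^ 2 * Φ z) * (∫ z in Ioi (0:ℝ), Φ z)
        + (∫ z in Ioi (0:ℝ), z * Φ z) ^ 2 := by
  obtain ⟨C, -, hm⟩ := exists_moment_bound (β₁ := β₁) (β₂ := β₂) hβ₁ hβ₂
  have i0 : IntegrableOn Φ (Ioi 0) := hΦ.integrableOn hβ₁ hβ₂
  have i1 := (hm K Φ (fun z => z) hΦ aestronglyMeasurable_id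
    (fun z hz => by rw [abs_of_pos hz]; nlinarith)).1
  have i2 := (hm K Φ (fun z => z ^ 2) hΦ (Continuous.aestronglyMeasurable (by fun_prop))
    (fun z hz => by rw [abs_of_nonneg (by positivity)]; nlinarith)).1
  have c02 := integral_posConvolution i0 i2 (ContinuousLinearMap.mul ℝ ℝ)
  have c11 := integral_posConvolution i1 i1 (ContinuousLinearMap.mul ℝ ℝ)
  have c20 := integral_posConvolution i2 i0 (ContinuousLinearMap.mul ℝ ℝ)
  have j : ∀ {f g : ℝ → ℝ}, IntegrableOn f (Ioi 0) → IntegrableOn g (Ioi 0) →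
      IntegrableOn (fun x => ∫ t in (0:ℝ)..x, (ContinuousLinearMap.mul ℝ ℝ) (f t) (g (x - t))) (Ioi 0) :=
    fun hf hg => by
      have := integrable_posConvolution (μ := volume) (ν := volume) hf hg (ContinuousLinearMap.mul ℝ ℝ)
      rwa [posConvolution, integrable_indicator_iff measurableSet_Ioi] at this
  have j02 := j i0 i2
  have j11 := j i1 i1
  have j20 := j i2 i0
  simp only [ContinuousLinearMap.mul_apply'] at c02 c11 c20 j02 j11 j20
  have hpt : ∀ z ∈ Ioi (0:ℝ), z ^ 2 * conv Φ Φ z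
      = 1 / 2 * ((∫ t in (0:ℝ)..z, Φ t * ((z - t) ^ 2 * Φ (z - t)))
        + 2 * (∫ t in (0:ℝ)..z, t * Φ t * ((z - t) * Φ (z - t)))
        + ∫ t in (0:ℝ)..z, t ^ 2 * Φ t * Φ (z - t)) := by
    intro z hz
    have hz0 : (0:ℝ) < z := hz
    have hc1 : ContinuousOn Φ (uIcc 0 z) := hcont.mono (by
      rw [uIcc_of_le hz0.le]; exact Icc_subset_Ici_self)
    have hc2 : ContinuousOn (fun t => Φ (z - t)) (uIcc 0 z) := by
      refine hcont.comp (by fun_prop) fun t ht => ?_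
      rw [uIcc_of_le hz0.le] at ht
      exact sub_nonneg.2 ht.2
    have t02 : ContinuousOn (fun t => Φ t * ((z - t) ^ 2 * Φ (z - t))) (uIcc 0 z) :=
      hc1.mul (ContinuousOn.mul (by fun_prop) hc2)
    have t11 : ContinuousOn (fun t => t * Φ t * ((z - t) * Φ (z - t))) (uIcc 0 z) :=
      (continuousOn_id.mul hc1).mul (ContinuousOn.mul (by fun_prop) hc2)
    have t20 : ContinuousOn (fun t => t ^ 2 * Φ t * Φ (z - t)) (uIcc 0 z) :=
      ((continuousOn_pow 2).mul hc1).mul hc2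
    rw [← intervalIntegral.integral_const_mul 2, ← intervalIntegral.integral_add,
      ← intervalIntegral.integral_add, conv, ← mul_assoc, mul_comm (z ^ 2) (1 / 2), mul_assoc,
      ← intervalIntegral.integral_const_mul]
    · congr 1
      refine intervalIntegral.integral_congr fun t _ => ?_
      ring
    · exact (t02.add (continuousOn_const.mul t11)).intervalIntegrable
    · exact t20.intervalIntegrable
    · exact t02.intervalIntegrable
    · exact (continuousOn_const.mul t11).intervalIntegrable
  have k : IntegrableOn (fun x => (∫ t in (0:ℝ)..x, Φ t * ((x - t) ^ 2 * Φ (x - t)))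
      + 2 * ∫ t in (0:ℝ)..x, t * Φ t * ((x - t) * Φ (x - t))) (Ioi 0) :=
    j02.add (j11.const_mul 2)
  rw [setIntegral_congr_fun measurableSet_Ioi hpt, integral_const_mul,
    integral_add k j20, integral_add j02 (j11.const_mul 2),
    integral_const_mul, c02, c11, c20]
  ring

/-- Fixed points with compatible couplings are stationary solutions. -/
theorem isStationarySolution_of_fixed {β₁ β₂ K η δ : ℝ} {p : ℝ × ℝ} {Φ : ℝ → ℝ} (hβ₁ : 0 < β₁)
    (hβ₂ : 1 < β₂) (hδ : 0 < δ) (hδ1 : δ ≤ 1) (hp : Adm δ p) (hpc : IsCoupling η δ (conv Φ Φ) p)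
    (hΦ : MemW β₁ β₂ K Φ) (hnn : ∀ z, 0 ≤ z → 0 ≤ Φ z)
    (hfix : EqOn Φ (varConst δ p.1 p.2 (conv Φ Φ)) (Ici 0)) :
    IsStationarySolution p.1 (lamLSW - δ) Φ := by
  have hβ₂' : 0 ≤ β₂ := by linarith
  obtain ⟨C, -, hm⟩ := exists_moment_bound (β₁ := β₁) (β₂ := β₂) hβ₁ hβ₂'
  obtain ⟨C₂, -, hconv⟩ := exists_conv_memW (β₁ := β₁) (β₂ := β₂) hβ₁ hβ₂
  have hh := hconv _ _ _ _ hΦ hΦ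
  have hε := hpc.1.1
  have hcont : ContinuousOn Φ (Ici 0) :=
    (continuousOn_const.mul (continuousOn_jInt hβ₁ hβ₂' hδ hδ1 hp hh)).congr hfix
  have hhcont := continuousOn_conv hcont hcont
  have hpow1 : ∀ z : ℝ, 0 < z → |z| ≤ (1 + z) ^ 2 := fun z hz => by
    rw [abs_of_pos hz]; nlinarith
  have hpow2 : ∀ z : ℝ, 0 < z → |z ^ 2| ≤ (1 + z) ^ 2 := fun z hz => by
    rw [abs_of_nonneg (by positivity)]; nlinarith
  have hpow3 : ∀ z : ℝ, 0 < z → |z ^ (1 / 3 : ℝ)| ≤ (1 + z) ^ 2 := fun z hz => by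
    rw [abs_of_nonneg (Real.rpow_nonneg hz.le _)]
    calc z ^ (1 / 3 : ℝ) ≤ (1 + z) ^ (1 / 3 : ℝ) :=
          Real.rpow_le_rpow hz.le (by linarith) (by norm_num)
      _ ≤ (1 + z) ^ ((2 : ℕ) : ℝ) :=
          Real.rpow_le_rpow_of_exponent_le (by linarith) (by norm_num)
      _ = _ := Real.rpow_natCast _ _
  have msq : AEStronglyMeasurable (fun z : ℝ => z ^ 2) (volume.restrict (Ioi 0)) :=
    Continuous.aestronglyMeasurable (by fun_prop)
  have mth : AEStronglyMeasurable (fun z : ℝ => z ^ (1 / 3 : ℝ)) (volume.restrict (Ioi 0)) :=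
    (Real.continuous_rpow_const (by norm_num)).aestronglyMeasurable
  have i0 : IntegrableOn Φ (Ioi 0) := hΦ.integrableOn hβ₁ hβ₂'
  have i1 := (hm K Φ (fun z => z) hΦ aestronglyMeasurable_id hpow1).1
  have i2 := (hm K Φ (fun z => z ^ 2) hΦ msq hpow2).1
  have i3 := (hm K Φ (fun z => z ^ (1 / 3 : ℝ)) hΦ mth hpow3).1
  have i4 := (hm _ _ (fun z => z ^ 2) hh msq hpow2).1
  have hcompat := hpc.2.2
  -- The first compatibility condition is the volume constraint multiplied by ε > 0.
  have hM1 : ∫ z in Ioi (0:ℝ), z * Φ z = 1 := by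
    have h1 : ∫ z in Ioi (0:ℝ), z * Φ z
        = ∫ z in Ioi (0:ℝ), z * varConst δ p.1 p.2 (conv Φ Φ) z :=
      setIntegral_congr_fun measurableSet_Ioi fun z hz => by
        simp only [hfix (Ioi_subset_Ici_self hz)]
    have h2 := hcompat.1
    rw [← h1] at h2
    have h3 : p.1 * ∫ z in Ioi (0:ℝ), z * Φ z = p.1 * 1 := by rw [h2, mul_one]
    exact mul_left_cancel₀ hε.ne' h3
  have hM0 : p.1 * ∫ z in Ioi (0:ℝ), Φ z = p.2 := by
    have h1 : ∫ z in Ioi (0:ℝ), Φ z = ∫ z in Ioi (0:ℝ), varConst δ p.1 p.2 (conv Φ Φ) z :=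
      setIntegral_congr_fun measurableSet_Ioi fun z hz => hfix (Ioi_subset_Ici_self hz)
    rw [h1]
    exact hcompat.2
  have hder : ∀ z, 0 < z → HasDerivAt Φ
      (-(aCoef δ z * (bCoef δ z - p.2 * z - p.1)) * Φ z - p.1 * (z * aCoef δ z * conv Φ Φ z)) z := by
    intro z hz
    have h := hasDerivAt_varConst hβ₁ hβ₂' hδ hδ1 hp hh hhcont hz
    rw [← hfix hz.le] at h
    refine h.congr_of_eventuallyEq ?_
    filter_upwards [Ioi_mem_nhds hz] with y hy using hfix (Ioi_subset_Ici_self hy)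
  have hden : ∀ z, 0 < z → den δ z * (-(aCoef δ z * (bCoef δ z - p.2 * z - p.1)) * Φ z
      - p.1 * (z * aCoef δ z * conv Φ Φ z))
      = -(bCoef δ z - p.2 * z - p.1) * Φ z - p.1 * z * conv Φ Φ z := by
    intro z hz
    have := (den_pos hδ hz.le).ne'
    rw [aCoef_eq]
    field_simp
  -- Integrate the derivative of z `den` Φ, which vanishes at 0 and at infinity. The equation leaves
  -- M₀ - λ M_{1/3} + ε' M₂ + ε M₁ - ε ∫ z^2 (Φ * Φ) = 0, and the last three terms cancel since ε' =
  -- ε M₀, M₁ = 1 and ∫ z^2 (Φ * Φ) = M₂ M₀ + M₁^2.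
  have hmean : ∫ z in Ioi (0:ℝ), Φ z = (lamLSW - δ) * ∫ z in Ioi (0:ℝ), z ^ (1 / 3 : ℝ) * Φ z := by
    have hF : ∀ z ∈ Ioi (0:ℝ), HasDerivAt (fun z => z * (den δ z * Φ z))
        (Φ z - (lamLSW - δ) * (z ^ (1 / 3 : ℝ) * Φ z) + p.2 * (z ^ 2 * Φ z) + p.1 * (z * Φ z)
          - p.1 * (z ^ 2 * conv Φ Φ z)) z := by
      intro z hz
      have hz0 : (0:ℝ) < z := hz
      refine ((hasDerivAt_id z).mul ((hasDerivAt_den δ hz0).mul (hder z hz0))).congr_deriv ?_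
      have e1 := hden z hz0
      simp only [id, Pi.mul_apply]
      rw [e1]
      unfold den bCoef
      ring
    have hlim : Tendsto (fun z => z * (den δ z * Φ z)) atTop (𝓝 0) := by
      obtain ⟨C₃, hC₃, h3⟩ := exists_pow_le_exp (half_pos hβ₁) 2
      have hK := hΦ.nonneg
      have hg : Tendsto (fun z : ℝ => C₃ * K * Real.exp (-(β₁ / 2 * z))) atTop (𝓝 0) := by
        rw [← mul_zero (C₃ * K)]
        refine Tendsto.const_mul _ (Real.tendsto_exp_neg_atTop_nhds_zero.comp ?_)
        exact tendsto_id.const_mul_atTop (half_pos hβ₁)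
      refine squeeze_zero_norm' ?_ hg
      filter_upwards [eventually_ge_atTop 0] with z hz
      have h4 := h3 z hz
      have h5 := (hΦ.bound z hz).trans (mul_le_mul_of_nonneg_left (wt_le_exp hβ₂' hz) hK)
      have h6 := den_le hδ1 hz
      have h7 := (den_pos hδ hz).le
      rw [norm_mul, norm_mul, Real.norm_of_nonneg hz, Real.norm_of_nonneg h7, Real.norm_eq_abs,
        ← mul_assoc]
      have h8 : z * den δ z ≤ (1 + z) ^ 2 := by nlinarith
      calc z * den δ z * |Φ z| ≤ (C₃ * Real.exp (β₁ / 2 * z)) * (K * Real.exp (-β₁ * z)) :=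
            mul_le_mul (h8.trans h4) h5 (abs_nonneg _) (by positivity)
        _ = C₃ * K * (Real.exp (β₁ / 2 * z) * Real.exp (-β₁ * z)) := by ring
        _ = _ := by rw [← Real.exp_add]; ring_nf
    have hc0 : ContinuousWithinAt (fun z => z * (den δ z * Φ z)) (Ici 0) 0 :=
      (continuousOn_id.mul ((continuous_den δ).continuousOn.mul hcont)) 0 self_mem_Ici
    have k1 := i3.const_mul (lamLSW - δ)
    have k2 := i2.const_mul p.2
    have k3 := i1.const_mul p.1
    have k4 := i4.const_mul p.1
    have l1 : IntegrableOn (fun z => Φ z - (lamLSW - δ) * (z ^ (1 / 3 : ℝ) * Φ z)) (Ioi 0) :=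
      i0.sub k1
    have l2 : IntegrableOn (fun z => Φ z - (lamLSW - δ) * (z ^ (1 / 3 : ℝ) * Φ z)
      + p.2 * (z ^ 2 * Φ z)) (Ioi 0) := l1.add k2
    have l3 : IntegrableOn (fun z => Φ z - (lamLSW - δ) * (z ^ (1 / 3 : ℝ) * Φ z)
      + p.2 * (z ^ 2 * Φ z) + p.1 * (z * Φ z)) (Ioi 0) := l2.add k3
    have hI := integral_Ioi_of_hasDerivAt_of_tendsto hc0 hF
      (l3.sub k4) hlim
    rw [integral_sub l3 k4, integral_add l2 k3, integral_add l1 k2, integral_sub i0 k1, integral_const_mul, integral_const_mul,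
      integral_const_mul, integral_const_mul, integral_sq_mul_conv hβ₁ hβ₂' hΦ hcont, hM1] at hI
    rw [← hM0] at hI
    linear_combination hI
  refine ⟨hnn, i0, i3, i1, hM1, ?_, fun z hz => (hder z hz).differentiableAt, fun z hz => ?_⟩
  · have hne : ∫ z in Ioi (0:ℝ), z ^ (1 / 3 : ℝ) * Φ z ≠ 0 := by
      intro h0
      rw [h0, mul_zero] at hmean
      rw [hmean, mul_zero] at hM0
      exact hpc.2.1.1.ne hM0
    rw [eq_div_iff hne, hmean]
  · have hd1 := hder z hz
    have hd2 : HasDerivAt (fun y : ℝ => -1 + (lamLSW - δ) * y ^ (1 / 3 : ℝ))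
        ((lamLSW - δ) / 3 * z ^ (-2 / 3 : ℝ)) z := by
      have h := ((Real.hasDerivAt_rpow_const (x := z) (p := (1 / 3 : ℝ))
        (Or.inl hz.ne')).const_mul (lamLSW - δ)).const_add (-1)
      refine h.congr_deriv ?_
      norm_num
      ring
    have hd3 := hd2.mul hd1
    have hcoag : coag Φ z = z * conv Φ Φ z - Φ z * (z * (∫ y in Ioi (0:ℝ), Φ y) + 1) := by
      have e1 : ∫ y in Ioi (0:ℝ), (z + y) * Φ y = z * (∫ y in Ioi (0:ℝ), Φ y) + 1 := by
        simp_rw [add_mul]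
        rw [integral_add (i0.const_mul z) i1, integral_const_mul, hM1]
      have e2 : ∫ y in (0:ℝ)..z, z * Φ (z - y) * Φ y = z * ∫ y in (0:ℝ)..z, Φ (z - y) * Φ y := by
        rw [← intervalIntegral.integral_const_mul]
        simp_rw [mul_assoc]
      rw [coag, conv, e1, e2]
      ring
    rw [hd1.deriv, hcoag]
    have hd4 := hd3.deriv
    have e : ((fun y : ℝ => -1 + (lamLSW - δ) * y ^ (1 / 3 : ℝ)) * Φ)
        = fun y => (-1 + (lamLSW - δ) * y ^ (1 / 3 : ℝ)) * Φ y := rfl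
    rw [e] at hd4
    rw [hd4]
    have e1 := hden z hz
    unfold den at e1
    unfold bCoef at e1 ⊢
    rw [← hM0] at e1 ⊢
    -- With ε' = ε M₀ and M₁ = 1 the coupling terms are exactly the loss term of the coagulation
    -- operator.
    linear_combination -e1

/-! ### Contractions of weighted balls. -/

/-- Functions within weighted distance `ρ` of `φ` on `[0, ∞)`. -/
structure MemBall (β₁ β₂ ρ : ℝ) (φ Φ : ℝ → ℝ) : Prop where
  meas : AEStronglyMeasurable Φ (volume.restrict (Ioi 0))
  dist_le : ∀ z, 0 ≤ z → |Φ z - φ z| ≤ ρ * wt β₁ β₂ z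

theorem MemBall.mono {β₁ β₂ κ ρ : ℝ} {φ Φ : ℝ → ℝ} (h : MemBall β₁ β₂ κ φ Φ) (hκ : κ ≤ ρ) :
    MemBall β₁ β₂ ρ φ Φ :=
  ⟨h.meas, fun z hz => (h.dist_le z hz).trans
    (mul_le_mul_of_nonneg_right hκ (wt_pos β₁ β₂ hz).le)⟩

/-- Two fixed points of a contraction on a weighted ball agree on `[0, ∞)`. -/
theorem eqOn_of_fixed {β₁ β₂ ρ : ℝ} {φ : ℝ → ℝ} {A : (ℝ → ℝ) → ℝ → ℝ} (hρ : 0 ≤ ρ)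
    (hcontr : ∀ X Φ Ψ, 0 ≤ X → MemBall β₁ β₂ ρ φ Φ → MemBall β₁ β₂ ρ φ Ψ →
      (∀ z, 0 ≤ z → |Φ z - Ψ z| ≤ X * wt β₁ β₂ z) →
      ∀ z, 0 ≤ z → |A Φ z - A Ψ z| ≤ X * (1 / 2) * wt β₁ β₂ z)
    {Φ Ψ : ℝ → ℝ} (hΦ : MemBall β₁ β₂ ρ φ Φ) (hΨ : MemBall β₁ β₂ ρ φ Ψ)
    (hfΦ : EqOn Φ (A Φ) (Ici 0)) (hfΨ : EqOn Ψ (A Ψ) (Ici 0)) : EqOn Φ Ψ (Ici 0) := by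
  have h : ∀ n : ℕ, ∀ z, 0 ≤ z → |Φ z - Ψ z| ≤ 2 * ρ * (1 / 2) ^ n * wt β₁ β₂ z := by
    intro n
    induction n with
    | zero =>
      intro z hz
      have h1 := hΦ.dist_le z hz
      have h2 := hΨ.dist_le z hz
      have h3 := abs_sub_le (Φ z) (φ z) (Ψ z)
      rw [abs_sub_comm (φ z)] at h3
      simp only [pow_zero, mul_one]
      linarith
    | succ n ih =>
      intro z hz
      rw [hfΦ hz, hfΨ hz, pow_succ, ← mul_assoc]
      exact hcontr _ Φ Ψ (by positivity) hΦ hΨ ih z hz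
  intro z hz
  have hlim : Tendsto (fun n : ℕ => 2 * ρ * (1 / 2 : ℝ) ^ n * wt β₁ β₂ z) atTop (𝓝 0) := by
    have := ((tendsto_pow_atTop_nhds_zero_of_lt_one (r := (1 / 2 : ℝ)) (by norm_num)
      (by norm_num)).const_mul (2 * ρ)).mul_const (wt β₁ β₂ z)
    simpa using this
  have h0 := ge_of_tendsto' hlim fun n => h n z hz
  exact sub_eq_zero.1 (abs_nonpos_iff.1 h0)

/-- A contraction of a weighted ball that preserves nonnegativity has a nonnegative fixed point. -/
theorem exists_fixed {β₁ β₂ κ ρ : ℝ} {φ : ℝ → ℝ} {A : (ℝ → ℝ) → ℝ → ℝ} (hκ : 0 ≤ κ) (hκρ : κ ≤ ρ)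
    (hφ : AEStronglyMeasurable φ (volume.restrict (Ioi 0))) (hφ0 : ∀ z, 0 ≤ z → 0 ≤ φ z)
    (hmap : ∀ Φ, MemBall β₁ β₂ ρ φ Φ → MemBall β₁ β₂ κ φ (A Φ))
    (hcontr : ∀ X Φ Ψ, 0 ≤ X → MemBall β₁ β₂ ρ φ Φ → MemBall β₁ β₂ ρ φ Ψ →
      (∀ z, 0 ≤ z → |Φ z - Ψ z| ≤ X * wt β₁ β₂ z) →
      ∀ z, 0 ≤ z → |A Φ z - A Ψ z| ≤ X * (1 / 2) * wt β₁ β₂ z)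
    (hnn : ∀ Φ, MemBall β₁ β₂ ρ φ Φ → (∀ z, 0 ≤ z → 0 ≤ Φ z) → ∀ z, 0 ≤ z → 0 ≤ A Φ z) :
    ∃ Φ, MemBall β₁ β₂ κ φ Φ ∧ (∀ z, 0 ≤ z → 0 ≤ Φ z) ∧ EqOn Φ (A Φ) (Ici 0) := by
  -- Picard iteration from the centre, with pointwise weighted bounds. The iterates stay in the
  -- smaller ball and nonnegative, and both properties pass to the pointwise limit.
  set u : ℕ → ℝ → ℝ := fun n => A^[n] φ with hu
  have hsucc : ∀ n, u (n + 1) = A (u n) := fun n => Function.iterate_succ_apply' A n φ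
  have hball : ∀ n, MemBall β₁ β₂ κ φ (u n) := by
    intro n
    induction n with
    | zero =>
      refine ⟨hφ, fun z hz => ?_⟩
      have := mul_nonneg hκ (wt_pos β₁ β₂ hz).le
      simpa [hu] using this
    | succ n ih => rw [hsucc]; exact hmap _ (ih.mono hκρ)
  have hpos : ∀ n, ∀ z, 0 ≤ z → 0 ≤ u n z := by
    intro n
    induction n with
    | zero => exact hφ0
    | succ n ih => rw [hsucc]; exact hnn _ ((hball n).mono hκρ) ih
  have hstep : ∀ n : ℕ, ∀ z, 0 ≤ z → |u n z - u (n + 1) z| ≤ κ * (1 / 2) ^ n * wt β₁ β₂ z := by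
    intro n
    induction n with
    | zero =>
      intro z hz
      rw [abs_sub_comm, pow_zero, mul_one]
      exact (hball 1).dist_le z hz
    | succ n ih =>
      intro z hz
      rw [hsucc (n + 1), pow_succ, ← mul_assoc]
      nth_rewrite 1 [hsucc n]
      exact hcontr _ _ _ (by positivity) ((hball n).mono hκρ) ((hball (n + 1)).mono hκρ) ih z hz
  have hgeo : ∀ z, 0 ≤ z → ∀ n, dist (u n z) (u (n + 1) z) ≤ κ * wt β₁ β₂ z * (1 / 2) ^ n :=
    fun z hz n => by
      rw [Real.dist_eq]
      exact (hstep n z hz).trans_eq (by ring)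
  -- Negative arguments carry no estimate; the limit is set to 0 there.
  have hex : ∀ z, ∃ a, 0 ≤ z → Tendsto (fun n => u n z) atTop (𝓝 a) := fun z => by
    by_cases hz : 0 ≤ z
    · obtain ⟨a, ha⟩ := cauchySeq_tendsto_of_complete
        (cauchySeq_of_le_geometric _ _ (by norm_num) (hgeo z hz))
      exact ⟨a, fun _ => ha⟩
    · exact ⟨0, fun h => absurd h hz⟩
  choose Φ hΦ using hex
  have hΦball : MemBall β₁ β₂ κ φ Φ := by
    refine ⟨aestronglyMeasurable_of_tendsto_ae atTop (fun n => (hball n).meas) ?_, fun z hz => ?_⟩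
    · filter_upwards [ae_restrict_mem measurableSet_Ioi] with z hz using hΦ z (le_of_lt hz)
    · exact le_of_tendsto' ((hΦ z hz).sub_const (φ z)).abs fun n => (hball n).dist_le z hz
  have hdist : ∀ n : ℕ, ∀ z, 0 ≤ z → |u n z - Φ z| ≤ 2 * κ * (1 / 2) ^ n * wt β₁ β₂ z := by
    intro n z hz
    have h := dist_le_of_le_geometric_of_tendsto _ _ (by norm_num) (hgeo z hz) (hΦ z hz) n
    rw [Real.dist_eq] at h
    exact h.trans_eq (by ring)
  refine ⟨Φ, hΦball, fun z hz => ge_of_tendsto' (hΦ z hz) fun n => hpos n z hz, fun z hz => ?_⟩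
  have hlim : Tendsto (fun n => u (n + 1) z) atTop (𝓝 (A Φ z)) := by
    rw [tendsto_iff_dist_tendsto_zero]
    have h0 : Tendsto (fun n : ℕ => 2 * κ * (1 / 2 : ℝ) ^ n * (1 / 2) * wt β₁ β₂ z) atTop (𝓝 0) := by
      have := (((tendsto_pow_atTop_nhds_zero_of_lt_one (r := (1 / 2 : ℝ)) (by norm_num)
        (by norm_num)).const_mul (2 * κ)).mul_const (1 / 2)).mul_const (wt β₁ β₂ z)
      simpa using this
    refine squeeze_zero (fun _ => dist_nonneg) (fun n => ?_) h0
    rw [hsucc, Real.dist_eq]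
    exact hcontr _ _ _ (by positivity) ((hball n).mono hκρ) (hΦball.mono hκρ) (hdist n) z hz
  exact tendsto_nhds_unique ((tendsto_add_atTop_iff_nat 1).2 (hΦ z hz)) hlim

/-! ### Assembly: contraction property of `opIbar` and the main theorem. -/

theorem MemBall.of_normZ {β₁ β₂ r C : ℝ} {Φ φ : ℝ → ℝ}
    (hC : ∀ (R : ℝ) (f : ℝ → ℝ), 0 ≤ R → normZ β₁ β₂ f ≤ ENNReal.ofReal R →
      ∀ z, 0 ≤ z → |f z| ≤ C * R * wt β₁ β₂ z) (hr : 0 ≤ r) (hΦ : Φ ∈ spaceZ β₁ β₂)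
    (h : normZ β₁ β₂ (Φ - φ) ≤ ENNReal.ofReal r) : MemBall β₁ β₂ (C * r) φ Φ := by
  refine ⟨?_, fun z hz => hC r _ hr h z hz⟩
  rw [Measure.restrict_congr_set Ioi_ae_eq_Ici]
  exact hΦ.1

theorem mem_spaceZ_of_memW {β₁ β₂ K : ℝ} {Φ : ℝ → ℝ} (hβ₁ : 0 ≤ β₁) (hβ₂ : 0 ≤ β₂)
    (h : MemW β₁ β₂ K Φ) : Φ ∈ spaceZ β₁ β₂ := by
  refine ⟨?_, (normZ_le_of_wt hβ₁ hβ₂ h.nonneg h.bound).trans_lt ENNReal.ofReal_lt_top⟩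
  rw [← Measure.restrict_congr_set Ioi_ae_eq_Ici]
  exact h.meas

theorem varConst_nonneg {δ z : ℝ} {p : ℝ × ℝ} {h : ℝ → ℝ} (hδ : 0 < δ) (hz : 0 ≤ z)
    (hp : 0 ≤ p.1) (hh : ∀ ξ, 0 ≤ ξ → 0 ≤ h ξ) : 0 ≤ varConst δ p.1 p.2 h z := by
  rw [varConst_eq]
  refine mul_nonneg hp (setIntegral_nonneg measurableSet_Ioi fun ξ hξ => ?_)
  have hξ0 : 0 ≤ ξ := hz.trans (le_of_lt hξ)
  exact mul_nonneg (ker_nonneg p hδ hξ0) (hh ξ hξ0)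

/-- For small `δ` the operator `opIbar` is well defined on a weighted ball around `phiLSW`, maps it
into an arbitrarily small ball, is a contraction, and its nonnegative fixed points are stationary
solutions. -/
theorem exists_opIbar_contraction {β₁ β₂ : ℝ} (hβ₁ : 0 < β₁) (hβ₂ : 1 < β₂) :
    ∃ ρ : ℝ, 0 < ρ ∧ ∃ K : ℝ, 0 < K ∧
      (∀ Φ, MemBall β₁ β₂ ρ phiLSW Φ → MemW β₁ β₂ K Φ) ∧
      ∀ κ : ℝ, 0 < κ → ∀ η : ℝ, 0 < η → η ≤ 1 → ∃ δ₀ : ℝ, 0 < δ₀ ∧ ∀ δ : ℝ, 0 < δ → δ < δ₀ →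
        (∀ Φ, MemBall β₁ β₂ ρ phiLSW Φ → (∃! p, IsCoupling η δ (conv Φ Φ) p) ∧
          MemBall β₁ β₂ κ phiLSW (opIbar η δ Φ) ∧
          ((∀ z, 0 ≤ z → 0 ≤ Φ z) → (∀ z, 0 ≤ z → 0 ≤ opIbar η δ Φ z) ∧
            (EqOn Φ (opIbar η δ Φ) (Ici 0) →
              IsStationarySolution (coupling η δ (conv Φ Φ)).1 (lamLSW - δ) Φ))) ∧
        ∀ X Φ Ψ, 0 ≤ X → MemBall β₁ β₂ ρ phiLSW Φ → MemBall β₁ β₂ ρ phiLSW Ψ →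
          (∀ z, 0 ≤ z → |Φ z - Ψ z| ≤ X * wt β₁ β₂ z) →
          ∀ z, 0 ≤ z → |opIbar η δ Φ z - opIbar η δ Ψ z| ≤ X * (1 / 2) * wt β₁ β₂ z := by
  have hβ₂' : 0 ≤ β₂ := by linarith
  obtain ⟨ρ, hρ, K, hK, H, hH, c, hc, hgood⟩ := exists_goodH (β₁ := β₁) (β₂ := β₂) hβ₁ hβ₂
  refine ⟨ρ, hρ, K, hK, fun Φ hΦ => (hgood Φ hΦ.meas hΦ.dist_le).1, fun κ hκ η hη hη1 => ?_⟩
  -- Exponent 6: the solution varies like the couplings divided by δ^5, so one power of δ remains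
  -- for the contraction; δ^6 ≤ δ^4 also meets the smallness needed for closeness to the profile.
  obtain ⟨Cc, hCc, δ₁, hδ₁, hδ₁', hcoup⟩ :=
    exists_coupling (β₁ := β₁) (β₂ := β₂) hβ₁ hβ₂' hH.le hc 6 hη hη1
  obtain ⟨Ct, hCt, δ₂, hδ₂, -, htF⟩ :=
    exists_tFun_sub_le (β₁ := β₁) (β₂ := β₂) hβ₁ hβ₂' hH.le hc 1
  obtain ⟨δ₃, hδ₃, -, hphi⟩ :=
    exists_tFun_sub_phiLSW_le (β₁ := β₁) (β₂ := β₂) hβ₁ hβ₂' hH.le hc hCc hκ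
  obtain ⟨Cs, hCs, hsub⟩ := exists_conv_self_sub_le (β₁ := β₁) (β₂ := β₂) hβ₁ hβ₂
  -- The Lipschitz constant of `opIbar` is at most δ L: Cs K from Φ * Φ, then Ct Cc through the
  -- couplings and Ct directly.
  set L : ℝ := Ct * (Cc + 1) * (Cs * K) with hL
  have hL0 : 0 < L := by positivity
  refine ⟨min (min δ₁ δ₂) (min δ₃ (1 / (2 * L))), by positivity, fun δ hδ hlt => ?_⟩
  have hlt1 : δ < δ₁ := hlt.trans_le ((min_le_left _ _).trans (min_le_left _ _))
  have hlt2 : δ < δ₂ := hlt.trans_le ((min_le_left _ _).trans (min_le_right _ _))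
  have hlt3 : δ < δ₃ := hlt.trans_le ((min_le_right _ _).trans (min_le_left _ _))
  have hltL : δ * L ≤ 1 / 2 := by
    have h1 : δ < 1 / (2 * L) := hlt.trans_le ((min_le_right _ _).trans (min_le_right _ _))
    rw [lt_div_iff₀ (by positivity)] at h1
    linarith
  have hδ1 : δ ≤ 1 := hlt1.le.trans hδ₁'
  obtain ⟨hex, hprop, hlip⟩ := hcoup δ hδ hlt1
  have hG : ∀ Φ, MemBall β₁ β₂ ρ phiLSW Φ → GoodH β₁ β₂ H c δ (conv Φ Φ) := fun Φ hΦ =>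
    (hgood Φ hΦ.meas hΦ.dist_le).2 δ hδ hδ1
  have hopI : ∀ Φ, MemBall β₁ β₂ ρ phiLSW Φ → ∀ z, opIbar η δ Φ z
      = tFun δ (coupling η δ (conv Φ Φ)) (conv Φ Φ) z := fun Φ hΦ => (hprop _ (hG Φ hΦ)).2.2.2
  refine ⟨fun Φ hΦ => ⟨hex _ (hG Φ hΦ), ⟨?_, fun z hz => ?_⟩, fun hnn => ⟨fun z hz => ?_, ?_⟩⟩,
    fun X Φ Ψ hX hΦ hΨ hd z hz => ?_⟩
  · obtain ⟨hadm, -, -, -⟩ := hprop _ (hG Φ hΦ)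
    exact ((continuousOn_const.mul (continuousOn_jInt hβ₁ hβ₂' hδ hδ1 hadm
      (hG Φ hΦ).memW)).mono Ioi_subset_Ici_self).aestronglyMeasurable measurableSet_Ioi
  · obtain ⟨hadm, -, hsmall, -⟩ := hprop _ (hG Φ hΦ)
    rw [hopI Φ hΦ]
    refine hphi δ z _ _ hδ hlt3 hz hadm (hG Φ hΦ) (hsmall.trans ?_)
    exact mul_le_mul_of_nonneg_left (pow_le_pow_of_le_one hδ.le hδ1 (by norm_num)) hCc.le
  · exact varConst_nonneg hδ hz (hprop _ (hG Φ hΦ)).2.1.1.1.le fun ξ hξ => conv_nonneg hξ hnn hnn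
  · obtain ⟨hadm, hcp, -, -⟩ := hprop _ (hG Φ hΦ)
    exact isStationarySolution_of_fixed hβ₁ hβ₂ hδ hδ1 hadm hcp
      (hgood Φ hΦ.meas hΦ.dist_le).1 hnn
  · have hY : ∀ ξ, 0 ≤ ξ → |conv Φ Φ ξ - conv Ψ Ψ ξ| ≤ Cs * (K * X) * wt β₁ β₂ ξ :=
      hsub K X Φ Ψ (hgood Φ hΦ.meas hΦ.dist_le).1 (hgood Ψ hΨ.meas hΨ.dist_le).1
        ⟨hΦ.meas.sub hΨ.meas, hd⟩
    have hY0 : 0 ≤ Cs * (K * X) := by positivity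
    have h1 := hlip _ _ _ hY0 (hG Φ hΦ) (hG Ψ hΨ) hY
    have h2 := htF δ z _ _ _ _ _ hδ hlt2 hz hY0 (hprop _ (hG Φ hΦ)).1 (hprop _ (hG Ψ hΨ)).1
      (hG Φ hΦ) (hG Ψ hΨ) hY
    rw [hopI Φ hΦ, hopI Ψ hΨ]
    refine h2.trans (mul_le_mul_of_nonneg_right ?_ (wt_pos β₁ β₂ hz).le)
    have h3 : ‖coupling η δ (conv Φ Φ) - coupling η δ (conv Ψ Ψ)‖ / δ ^ 5
        ≤ Cc * δ * (Cs * (K * X)) := by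
      rw [div_le_iff₀ (by positivity)]
      exact h1.trans_eq (by ring)
    calc Ct * (‖coupling η δ (conv Φ Φ) - coupling η δ (conv Ψ Ψ)‖ / δ ^ 5
          + δ ^ 1 * (Cs * (K * X)))
        ≤ Ct * (Cc * δ * (Cs * (K * X)) + δ ^ 1 * (Cs * (K * X))) := by gcongr
      _ = X * (δ * L) := by rw [hL]; ring
      _ ≤ X * (1 / 2) := mul_le_mul_of_nonneg_left hltL hX

end LSW

end

theorem mainTheorem4 (β₁ β₂ : ℝ) (hβ₁ : 0 < β₁) (hβ₂ : 1 < β₂) :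
    ∃ r₀ : ℝ, 0 < r₀ ∧ ∃ η₀ : ℝ, 0 < η₀ ∧
      ∀ r : ℝ, 0 < r → r ≤ r₀ → ∀ η : ℝ, 0 < η → η ≤ η₀ →
      ∃ δ₀ : ℝ, 0 < δ₀ ∧ ∀ δ : ℝ, 0 < δ → δ < δ₀ →
        -- the operator is well defined on the ball around the LSW profile
        (∀ Φ ∈ LSW.spaceZ β₁ β₂, LSW.normZ β₁ β₂ (Φ - LSW.phiLSW) ≤ ENNReal.ofReal r →
          ∃! p : ℝ × ℝ, LSW.IsCoupling η δ (LSW.conv Φ Φ) p) ∧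
        ∃ Φ ∈ LSW.spaceZ β₁ β₂,
          LSW.normZ β₁ β₂ (Φ - LSW.phiLSW) < ENNReal.ofReal r ∧
          -- nonnegative fixed point
          (∀ z, 0 ≤ z → 0 ≤ Φ z) ∧
          Set.EqOn Φ (LSW.opIbar η δ Φ) (Set.Ici 0) ∧
          -- unique in the ball
          (∀ Ψ ∈ LSW.spaceZ β₁ β₂, LSW.normZ β₁ β₂ (Ψ - LSW.phiLSW) ≤ ENNReal.ofReal r →
            Set.EqOn Ψ (LSW.opIbar η δ Ψ) (Set.Ici 0) → Set.EqOn Ψ Φ (Set.Ici 0)) ∧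
          -- isolated in `Z`
          (∃ ρ : ℝ, 0 < ρ ∧ ∀ Ψ ∈ LSW.spaceZ β₁ β₂,
            LSW.normZ β₁ β₂ (Ψ - Φ) < ENNReal.ofReal ρ →
            Set.EqOn Ψ (LSW.opIbar η δ Ψ) (Set.Ici 0) → Set.EqOn Ψ Φ (Set.Ici 0)) ∧
          -- exponentially decaying stationary solution
          LSW.IsStationarySolution (LSW.coupling η δ (LSW.conv Φ Φ)).1 (LSW.lamLSW - δ) Φ ∧
          (∃ C : ℝ, ∀ z, 0 ≤ z → Φ z ≤ C * Real.exp (-β₁ * z)) := by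
  have hβ₂' : 0 ≤ β₂ := by linarith
  obtain ⟨ρ, hρ, K, hK, hW, hmain⟩ := LSW.exists_opIbar_contraction hβ₁ hβ₂
  obtain ⟨C, hC, hcmp⟩ := LSW.exists_wt_compare hβ₁ hβ₂'
  obtain ⟨K₀, -, hL⟩ := LSW.exists_phiLSW_memW hβ₁.le hβ₂'
  -- r₀ puts the ball of `Z` inside the weighted ball of radius ρ; η₀ = 1 keeps couplings in the
  -- admissible range.
  refine ⟨ρ / C, div_pos hρ hC, 1, one_pos, fun r hr hr0 η hη hη1 => ?_⟩
  have hCr : C * r ≤ ρ := by rwa [le_div_iff₀ hC, mul_comm] at hr0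
  -- Passing back to the norm of `Z` doubles κ, so the fixed point lies within r/2 of the profile.
  set κ : ℝ := min (r / 4) ρ with hκ
  have hκ0 : 0 < κ := lt_min (by linarith) hρ
  have hκρ : κ ≤ ρ := min_le_right _ _
  obtain ⟨δ₀, hδ₀, hop⟩ := hmain κ hκ0 η hη hη1
  refine ⟨δ₀, hδ₀, fun δ hδ hlt => ?_⟩
  obtain ⟨hA, hcontr⟩ := hop δ hδ hlt
  have hball : ∀ Φ ∈ LSW.spaceZ β₁ β₂, LSW.normZ β₁ β₂ (Φ - LSW.phiLSW) ≤ ENNReal.ofReal r →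
      LSW.MemBall β₁ β₂ ρ LSW.phiLSW Φ := fun Φ hΦ h =>
    (LSW.MemBall.of_normZ hcmp hr.le hΦ h).mono hCr
  refine ⟨fun Φ hΦ h => (hA Φ (hball Φ hΦ h)).1, ?_⟩
  obtain ⟨Φ, hΦκ, hnn, hfix⟩ := LSW.exists_fixed hκ0.le hκρ hL.meas
    (fun z _ => LSW.phiLSW_nonneg z) (fun Φ hΦ => (hA Φ hΦ).2.1) hcontr
    (fun Φ hΦ h => ((hA Φ hΦ).2.2 h).1)
  have hΦ := hΦκ.mono hκρ
  have hnorm : LSW.normZ β₁ β₂ (Φ - LSW.phiLSW) ≤ ENNReal.ofReal (r / 2) := by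
    refine (LSW.normZ_le_of_wt hβ₁.le hβ₂' hκ0.le hΦκ.dist_le).trans
      (ENNReal.ofReal_le_ofReal ?_)
    have := min_le_left (r / 4) ρ
    linarith
  have huniq : ∀ Ψ ∈ LSW.spaceZ β₁ β₂,
      LSW.normZ β₁ β₂ (Ψ - LSW.phiLSW) ≤ ENNReal.ofReal r →
      Set.EqOn Ψ (LSW.opIbar η δ Ψ) (Set.Ici 0) → Set.EqOn Ψ Φ (Set.Ici 0) :=
    fun Ψ hΨ h hf => LSW.eqOn_of_fixed hρ.le hcontr (hball Ψ hΨ h) hΦ hf hfix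
  refine ⟨Φ, LSW.mem_spaceZ_of_memW hβ₁.le hβ₂' (hW Φ hΦ), hnorm.trans_lt ?_, hnn, hfix, huniq,
    -- Functions within r/2 of the fixed point lie in the r-ball around the profile, where
    -- uniqueness holds.
    ⟨r / 2, by linarith, fun Ψ hΨ h hf => huniq Ψ hΨ ?_ hf⟩, ((hA Φ hΦ).2.2 hnn).2 hfix,
    K, fun z hz => ?_⟩
  · exact (ENNReal.ofReal_lt_ofReal_iff hr).2 (by linarith)
  · refine (LSW.normZ_triangle β₁ β₂ Ψ Φ LSW.phiLSW).trans ?_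
    calc LSW.normZ β₁ β₂ (Ψ - Φ) + LSW.normZ β₁ β₂ (Φ - LSW.phiLSW)
        ≤ ENNReal.ofReal (r / 2) + ENNReal.ofReal (r / 2) := add_le_add h.le hnorm
      _ = ENNReal.ofReal r := by
        rw [← ENNReal.ofReal_add (by linarith) (by linarith), add_halves]
  · exact (le_abs_self _).trans (((hW Φ hΦ).bound z hz).trans
      (mul_le_mul_of_nonneg_left (LSW.wt_le_exp hβ₂' hz) hK.le))
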